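/- **Theorem (Validity of the double-negation translation).** *The theories.* $\mathbf{emTT}$ is the extensional level of the Minimalist Foundation (Maietti 2009): a dependent type theory with judgements $\Gamma\ ctx$, $A\ type\ [\Gamma]$, $A=B\ type\ [\Gamma]$, $a\in A\ [\Gamma]$, $a=b\in A\ [\Gamma]$, where $type$ is one of the kinds $prop_s$, $prop$, $set$, $col$, with inclusions $prop_s\subseteq prop\subseteq col$ and $prop_s\subseteq set\subseteq col$. The pre-syntax is fully annotated. Sets are generated by $\mathsf{N_0}$, $\mathsf{N_1}$, $\Sigma$, $\Pi$, $\mathsf{List}$, $+$ and quotients of sets by small equivalence relations (which are effective); collections are closed under $\Sigma$ and include the power collection $\mathcal P(1)$ of small propositions up to equiprovability and, for each set $A$, the function collection $A\to\mathcal P(1)$; these and the products $(\Pi x\in A)B$ of sets over sets are the only dependent products that are formed, and they satisfy $\beta$ and $\eta$. Eliminators act towards arbitrary collections. Propositions are those of intuitionistic predicate logic with an extensional equality $\mathsf{Eq}$ reflecting judgemental equality, and are proof-irrelevant with canonical proof $\mathsf{true}$; $\varphi\ \mathsf{true}$ stands for $\mathsf{true}\in\varphi$. They are small when quantifiers and equalities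 range over sets; moreover $\mathsf{Eq}(\mathcal P(1),U,V)$ is small. In $\mathcal P(1)$, $[\varphi]=[\psi]$ iff $\varphi\Leftrightarrow\psi\ \mathsf{true}$, and $U=[\mathsf{Dc}(U)]$, where $\mathsf{Dc}(U):\equiv\mathsf{Eq}(\mathcal P(1),U,[\top])$. $\mathbf{emTT}^c$ is $\mathbf{emTT}$ plus the rule: from $\varphi\ prop$ infer $\varphi\vee\neg\varphi\ \mathsf{true}$. *The translation.* Write $\mathrm{st}(\varphi):\equiv\neg\neg\varphi\Rightarrow\varphi$ and let $\pi_1$ be the first projection from a dependent sum. The translation $(-)^{\mathcal N}$ on pre-contexts, pre-types, pre-propositions and pre-terms leaves variables unchanged and commutes with all constructors, of contexts, types, propositions and terms, except for the following clauses: $$(\varphi\vee\psi)^{\mathcal N}:\equiv\neg\neg(\varphi^{\mathcal N}\vee\psi^{\mathcal N}),\qquad ((\exists x\in A)\varphi)^{\mathcal N}:\equiv\neg\neg(\exists x\in A^{\mathcal N})\varphi^{\mathcal N},$$ $$\mathcal P(1)^{\mathcal N}:\equiv(\Sigma x\in\mathcal P(1))\,\mathrm{st}(\mathsf{Dc}(x)),\qquad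 [\varphi]^{\mathcal N}:\equiv\langle[\varphi^{\mathcal N}],\mathsf{true}\rangle,$$ $$\mathsf{Eq}(\mathcal P(1),a,b)^{\mathcal N}:\equiv\mathsf{Eq}(\mathcal P(1),\pi_1(a^{\mathcal N}),\pi_1(b^{\mathcal N})),$$ and, for the function collections towards $\mathcal P(1)$, $$(A\to\mathcal P(1))^{\mathcal N}:\equiv(\Sigma f\in A^{\mathcal N}\to\mathcal P(1))(\forall x\in A^{\mathcal N})\,\mathrm{st}(\mathsf{Dc}(f(x))),$$ $$((\lambda x\in A)c)^{\mathcal N}:\equiv\langle(\lambda x\in A^{\mathcal N})\pi_1(c^{\mathcal N}),\mathsf{true}\rangle,\qquad \mathsf{Ap}(f,a)^{\mathcal N}:\equiv\langle\mathsf{Ap}(\pi_1(f^{\mathcal N}),a^{\mathcal N}),\mathsf{true}\rangle .$$ *Statement.* The translation is an interpretation of $\mathbf{emTT}^c$ into $\mathbf{emTT}$: 1. if $\mathbf{emTT}^c\vdash\Gamma\ ctx$, then $\mathbf{emTT}\vdash\Gamma^{\mathcal N}\ ctx$; 2. if $\mathbf{emTT}^c\vdash A\ type\ [\Gamma]$,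 then $\mathbf{emTT}\vdash A^{\mathcal N}\ type\ [\Gamma^{\mathcal N}]$, with the same kind $type\in\{prop_s,prop,set,col\}$; 3. if $\mathbf{emTT}^c\vdash a\in A\ [\Gamma]$, then $\mathbf{emTT}\vdash a^{\mathcal N}\in A^{\mathcal N}\ [\Gamma^{\mathcal N}]$; 4. if $\mathbf{emTT}^c\vdash A=B\ type\ [\Gamma]$, then $\mathbf{emTT}\vdash A^{\mathcal N}=B^{\mathcal N}\ type\ [\Gamma^{\mathcal N}]$, with the same kind; 5. if $\mathbf{emTT}^c\vdash a=b\in A\ [\Gamma]$, then $\mathbf{emTT}\vdash a^{\mathcal N}=b^{\mathcal N}\in A^{\mathcal N}\ [\Gamma^{\mathcal N}]$. Moreover, it produces stable propositions and collections with stable equality: 6. if $\mathbf{emTT}^c\vdash\varphi\ prop\ [\Gamma]$, then $\mathbf{emTT}\vdash\neg\neg\varphi^{\mathcal N}\Rightarrow\varphi^{\mathcal N}\ \mathsf{true}\ [\Gamma^{\mathcal N}]$; 7. if $\mathbf{emTT}^c\vdash A\ col\ [\Gamma]$, then $\mathbf{emTT}\vdash\neg\neg\mathsf{Eq}(A^{\mathcal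 N},x,y)\Rightarrow\mathsf{Eq}(A^{\mathcal N},x,y)\ \mathsf{true}\ [\Gamma^{\mathcal N},x\in A^{\mathcal N},y\in A^{\mathcal N}]$. Finally, on $\mathcal P(1)$ too the translation of equality is, up to equiprovability, equality of the translations: 8. if $\mathbf{emTT}^c\vdash a\in\mathcal P(1)\ [\Gamma]$ and $\mathbf{emTT}^c\vdash b\in\mathcal P(1)\ [\Gamma]$, then $\mathbf{emTT}\vdash\mathsf{Eq}(\mathcal P(1),a,b)^{\mathcal N}\Leftrightarrow\mathsf{Eq}(\mathcal P(1)^{\mathcal N},a^{\mathcal N},b^{\mathcal N})\ \mathsf{true}\ [\Gamma^{\mathcal N}]$. -/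

import Mathlib

namespace EmTT

/-! ### Pre-syntax

Expressions are fully annotated and use de Bruijn indices; propositions are particular types. -/

/-- The two syntactic categories: types (propositions included) and terms. -/
inductive Cat : Type
  | ty
  | tm

/-- Pre-types, pre-propositions and pre-terms. In the comments, `x. e` means that `e` has one more
free variable `x`, which is the variable of index `0` of `e`; in `x y. e` the index of `y` is `0`
and that of `x` is `1`, and so on. -/
inductive Expr : Cat → Type
  -- the empty set and the singleton set
  | n0 : Expr .ty
  | n1 : Expr .ty
  -- dependent sum of `A` and `x. B`
  | sigma (A B : Expr .ty) : Expr .ty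
  -- dependent product of `A` and `x. B`
  | pi (A B : Expr .ty) : Expr .ty
  | list (A : Expr .ty) : Expr .ty
  -- disjoint sum
  | sum (A B : Expr .ty) : Expr .ty
  -- quotient of `A` by `x y. R`
  | quot (A R : Expr .ty) : Expr .ty
  -- power collection of the singleton
  | pow1 : Expr .ty
  -- propositions
  | falsum : Expr .ty
  | conj (P Q : Expr .ty) : Expr .ty
  | disj (P Q : Expr .ty) : Expr .ty
  | imp (P Q : Expr .ty) : Expr .ty
  -- quantification of `x. P` over `A`
  | all (A P : Expr .ty) : Expr .ty
  | ex (A P : Expr .ty) : Expr .ty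
  -- propositional equality
  | eq (A : Expr .ty) (a b : Expr .tm) : Expr .ty
  -- variables
  | var (i : ℕ) : Expr .tm
  -- the canonical proof-term `true` of the proposition `P`
  | triv (P : Expr .ty) : Expr .tm
  -- eliminator of the empty set: motive `z. M`, argument
  | elN0 (M : Expr .ty) (c : Expr .tm) : Expr .tm
  -- the element of the singleton set; its eliminator: motive `z. M`, argument, case
  | star : Expr .tm
  | elN1 (M : Expr .ty) (t c : Expr .tm) : Expr .tm
  -- pairing for the sum of `A` and `x. B`; the eliminator: motive `z. M`, argument, `x y. m`
  | pair (A B : Expr .ty) (a b : Expr .tm) : Expr .tm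
  | elSigma (A B M : Expr .ty) (d m : Expr .tm) : Expr .tm
  -- abstraction of `x. b` and application, for the product of `A` and `x. B`
  | lam (A B : Expr .ty) (b : Expr .tm) : Expr .tm
  | app (A B : Expr .ty) (f a : Expr .tm) : Expr .tm
  -- lists; `cons A s a` is the list `s` extended by the element `a`;
  -- the eliminator: motive `z. M`, argument, case of the empty list, `x y z. l`
  | nil (A : Expr .ty) : Expr .tm
  | cons (A : Expr .ty) (s a : Expr .tm) : Expr .tm
  | elList (A M : Expr .ty) (s b l : Expr .tm) : Expr .tm
  -- injections; the eliminator: motive `z. M`, argument, `x. l`, `y. r`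
  | inl (A B : Expr .ty) (a : Expr .tm) : Expr .tm
  | inr (A B : Expr .ty) (b : Expr .tm) : Expr .tm
  | elSum (A B M : Expr .ty) (d l r : Expr .tm) : Expr .tm
  -- equivalence class of `a` in the quotient of `A` by `x y. R`;
  -- the eliminator: motive `z. M`, argument, `x. l`
  | cls (A R : Expr .ty) (a : Expr .tm) : Expr .tm
  | elQuot (A R M : Expr .ty) (p l : Expr .tm) : Expr .tm
  -- the element `[P]` of the power collection of the singleton
  | code (P : Expr .ty) : Expr .tm

/-- Pre-types. -/
abbrev Ty : Type := Expr .ty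

/-- Pre-terms. -/
abbrev Tm : Type := Expr .tm

/-- Pre-contexts; the head of the list is the type of the last declared variable. -/
abbrev Ctx : Type := List Ty

/-- Extension of a renaming under one binder. -/
def lift (ρ : ℕ → ℕ) : ℕ → ℕ
  | 0 => 0
  | i + 1 => ρ i + 1

namespace Expr

/-- Renaming of variables. -/
def ren : {s : Cat} → Expr s → (ℕ → ℕ) → Expr s
  | _, n0, _ => n0
  | _, n1, _ => n1
  | _, sigma A B, ρ => sigma (A.ren ρ) (B.ren (lift ρ))
  | _, pi A B, ρ => pi (A.ren ρ) (B.ren (lift ρ))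
  | _, list A, ρ => list (A.ren ρ)
  | _, sum A B, ρ => sum (A.ren ρ) (B.ren ρ)
  | _, quot A R, ρ => quot (A.ren ρ) (R.ren (lift (lift ρ)))
  | _, pow1, _ => pow1
  | _, falsum, _ => falsum
  | _, conj P Q, ρ => conj (P.ren ρ) (Q.ren ρ)
  | _, disj P Q, ρ => disj (P.ren ρ) (Q.ren ρ)
  | _, imp P Q, ρ => imp (P.ren ρ) (Q.ren ρ)
  | _, all A P, ρ => all (A.ren ρ) (P.ren (lift ρ))
  | _, ex A P, ρ => ex (A.ren ρ) (P.ren (lift ρ))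
  | _, eq A a b, ρ => eq (A.ren ρ) (a.ren ρ) (b.ren ρ)
  | _, var i, ρ => var (ρ i)
  | _, triv P, ρ => triv (P.ren ρ)
  | _, elN0 M c, ρ => elN0 (M.ren (lift ρ)) (c.ren ρ)
  | _, star, _ => star
  | _, elN1 M t c, ρ => elN1 (M.ren (lift ρ)) (t.ren ρ) (c.ren ρ)
  | _, pair A B a b, ρ => pair (A.ren ρ) (B.ren (lift ρ)) (a.ren ρ) (b.ren ρ)
  | _, elSigma A B M d m, ρ =>
      elSigma (A.ren ρ) (B.ren (lift ρ)) (M.ren (lift ρ)) (d.ren ρ) (m.ren (lift (lift ρ)))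
  | _, lam A B b, ρ => lam (A.ren ρ) (B.ren (lift ρ)) (b.ren (lift ρ))
  | _, app A B f a, ρ => app (A.ren ρ) (B.ren (lift ρ)) (f.ren ρ) (a.ren ρ)
  | _, nil A, ρ => nil (A.ren ρ)
  | _, cons A s a, ρ => cons (A.ren ρ) (s.ren ρ) (a.ren ρ)
  | _, elList A M s b l, ρ =>
      elList (A.ren ρ) (M.ren (lift ρ)) (s.ren ρ) (b.ren ρ) (l.ren (lift (lift (lift ρ))))
  | _, inl A B a, ρ => inl (A.ren ρ) (B.ren ρ) (a.ren ρ)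
  | _, inr A B b, ρ => inr (A.ren ρ) (B.ren ρ) (b.ren ρ)
  | _, elSum A B M d l r, ρ =>
      elSum (A.ren ρ) (B.ren ρ) (M.ren (lift ρ)) (d.ren ρ) (l.ren (lift ρ)) (r.ren (lift ρ))
  | _, cls A R a, ρ => cls (A.ren ρ) (R.ren (lift (lift ρ))) (a.ren ρ)
  | _, elQuot A R M p l, ρ =>
      elQuot (A.ren ρ) (R.ren (lift (lift ρ))) (M.ren (lift ρ)) (p.ren ρ) (l.ren (lift ρ))
  | _, code P, ρ => code (P.ren ρ)

end Expr

/-- Extension of a substitution under one binder. -/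
def up (σ : ℕ → Tm) : ℕ → Tm
  | 0 => .var 0
  | i + 1 => (σ i).ren Nat.succ

/-- The substitution sending the variable `0` to `t` and `i + 1` to `σ i`. -/
def scons (t : Tm) (σ : ℕ → Tm) : ℕ → Tm
  | 0 => t
  | i + 1 => σ i

namespace Expr

/-- Simultaneous substitution. -/
def sub : {s : Cat} → Expr s → (ℕ → Tm) → Expr s
  | _, n0, _ => n0
  | _, n1, _ => n1
  | _, sigma A B, σ => sigma (A.sub σ) (B.sub (up σ))
  | _, pi A B, σ => pi (A.sub σ) (B.sub (up σ))
  | _, list A, σ => list (A.sub σ)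
  | _, sum A B, σ => sum (A.sub σ) (B.sub σ)
  | _, quot A R, σ => quot (A.sub σ) (R.sub (up (up σ)))
  | _, pow1, _ => pow1
  | _, falsum, _ => falsum
  | _, conj P Q, σ => conj (P.sub σ) (Q.sub σ)
  | _, disj P Q, σ => disj (P.sub σ) (Q.sub σ)
  | _, imp P Q, σ => imp (P.sub σ) (Q.sub σ)
  | _, all A P, σ => all (A.sub σ) (P.sub (up σ))
  | _, ex A P, σ => ex (A.sub σ) (P.sub (up σ))
  | _, eq A a b, σ => eq (A.sub σ) (a.sub σ) (b.sub σ)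
  | _, var i, σ => σ i
  | _, triv P, σ => triv (P.sub σ)
  | _, elN0 M c, σ => elN0 (M.sub (up σ)) (c.sub σ)
  | _, star, _ => star
  | _, elN1 M t c, σ => elN1 (M.sub (up σ)) (t.sub σ) (c.sub σ)
  | _, pair A B a b, σ => pair (A.sub σ) (B.sub (up σ)) (a.sub σ) (b.sub σ)
  | _, elSigma A B M d m, σ =>
      elSigma (A.sub σ) (B.sub (up σ)) (M.sub (up σ)) (d.sub σ) (m.sub (up (up σ)))
  | _, lam A B b, σ => lam (A.sub σ) (B.sub (up σ)) (b.sub (up σ))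
  | _, app A B f a, σ => app (A.sub σ) (B.sub (up σ)) (f.sub σ) (a.sub σ)
  | _, nil A, σ => nil (A.sub σ)
  | _, cons A s a, σ => cons (A.sub σ) (s.sub σ) (a.sub σ)
  | _, elList A M s b l, σ =>
      elList (A.sub σ) (M.sub (up σ)) (s.sub σ) (b.sub σ) (l.sub (up (up (up σ))))
  | _, inl A B a, σ => inl (A.sub σ) (B.sub σ) (a.sub σ)
  | _, inr A B b, σ => inr (A.sub σ) (B.sub σ) (b.sub σ)
  | _, elSum A B M d l r, σ =>
      elSum (A.sub σ) (B.sub σ) (M.sub (up σ)) (d.sub σ) (l.sub (up σ)) (r.sub (up σ))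
  | _, cls A R a, σ => cls (A.sub σ) (R.sub (up (up σ))) (a.sub σ)
  | _, elQuot A R M p l, σ =>
      elQuot (A.sub σ) (R.sub (up (up σ))) (M.sub (up σ)) (p.sub σ) (l.sub (up σ))
  | _, code P, σ => code (P.sub σ)

/-- Weakening of `e` by `n` new variables declared last. -/
def wk {s : Cat} (n : ℕ) (e : Expr s) : Expr s := e.ren (fun i => i + n)

/-- Weakening of `x. e` by `n` new variables declared just before `x`. -/
def wk₁ {s : Cat} (n : ℕ) (e : Expr s) : Expr s := e.ren (lift (fun i => i + n))

/-- Weakening of `x y. e` by `n` new variables declared just before `x` and `y`. -/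
def wk₂ {s : Cat} (n : ℕ) (e : Expr s) : Expr s := e.ren (lift (lift (fun i => i + n)))

/-- `x. e` with `x` replaced by a term `t` that may contain `n` new variables declared last. -/
def inst {s : Cat} (n : ℕ) (e : Expr s) (t : Tm) : Expr s :=
  e.sub (scons t (fun i => var (i + n)))

/-- `x y. e` with `x` and `y` replaced by terms `a` and `b` that may contain `n` new variables
declared last. -/
def inst₂ {s : Cat} (n : ℕ) (e : Expr s) (a b : Tm) : Expr s :=
  e.sub (scons b (scons a (fun i => var (i + n))))

/-- `x y. e` with `x` and `y` replaced by `a` and `b`, all of them over the same context extended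
by three variables `x y z` in the case of the list eliminator. -/
def inst₃ {s : Cat} (e : Expr s) (a b c : Tm) : Expr s :=
  e.sub (scons c (scons b (scons a var)))

/-- Negation. -/
def neg (P : Ty) : Ty := imp P falsum

/-- The true constant. -/
def top : Ty := neg falsum

/-- Logical equivalence. -/
def iff (P Q : Ty) : Ty := conj (imp P Q) (imp Q P)

/-- Decoding of an element of the power collection of the singleton. -/
def dc (U : Tm) : Ty := eq pow1 U (code top)

/-- The proposition that `P` is stable under double negation. -/
def stab (P : Ty) : Ty := imp (neg (neg P)) P

/-- First projection of the dependent sum of `A` and `x. B`. -/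
def proj₁ (A B : Ty) (d : Tm) : Tm := elSigma A B (A.wk 1) d (var 1)

end Expr

open _root_.EmTT.Expr

/-! ### The theories -/

/-- The kinds of types. -/
inductive Kind : Type
  | props
  | prop
  | set
  | col

/-- The basic inclusions between kinds. -/
inductive Kind.Incl : Kind → Kind → Prop
  | props_prop : Kind.Incl .props .prop
  | props_set : Kind.Incl .props .set
  | prop_col : Kind.Incl .prop .col
  | set_col : Kind.Incl .set .col

/-- The kinds closed under connectives. -/
inductive Kind.Logical : Kind → Prop
  | small : Kind.Logical .props
  | large : Kind.Logical .prop

/-- The kinds closed under dependent sums. -/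
inductive Kind.Sums : Kind → Prop
  | set : Kind.Sums .set
  | col : Kind.Sums .col

/-- `Kind.Quant k k'`: a quantification over a type of kind `k` of a proposition of kind `k'` has
kind `k'`. -/
inductive Kind.Quant : Kind → Kind → Prop
  | small : Kind.Quant .set .props
  | large : Kind.Quant .col .prop

/-- `EqDom k A k'`: the propositional equality of a type `A` of kind `k` has kind `k'`. Equality of
the power collection of the singleton is small. -/
inductive EqDom : Kind → Ty → Kind → Prop
  | set (A : Ty) : EqDom .set A .props
  | col (A : Ty) : EqDom .col A .prop
  | pow1 : EqDom .col .pow1 .props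

/-- `PiCod B k`: dependent products over a set of the types `B` of kind `k` are formed, and have
kind `k`. These are the products of sets, and the function collections towards the power collection
of the singleton. -/
inductive PiCod : Ty → Kind → Prop
  | set (B : Ty) : PiCod B .set
  | pow1 : PiCod .pow1 .col

/-- `Lookup Γ i A`: the variable of index `i` has type `A` in the context `Γ`. -/
inductive Lookup : Ctx → ℕ → Ty → Prop
  | zero (Γ : Ctx) (A : Ty) : Lookup (A :: Γ) 0 (A.wk 1)
  | succ {Γ : Ctx} {i : ℕ} {A : Ty} (B : Ty) : Lookup Γ i A → Lookup (B :: Γ) (i + 1) (A.wk 1)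

/-- The judgements. -/
inductive Judgement : Type
  -- `Γ ctx`
  | ctx (Γ : Ctx)
  -- `A k [Γ]`
  | isTy (Γ : Ctx) (A : Ty) (k : Kind)
  -- `A = B k [Γ]`
  | eqTy (Γ : Ctx) (A B : Ty) (k : Kind)
  -- `a ∈ A [Γ]`
  | isTm (Γ : Ctx) (a : Tm) (A : Ty)
  -- `a = b ∈ A [Γ]`
  | eqTm (Γ : Ctx) (a b : Tm) (A : Ty)

/-- The judgement `P true [Γ]`. -/
abbrev Judgement.holds (Γ : Ctx) (P : Ty) : Judgement := .isTm Γ (.triv P) P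

/-- The extensional level `emTT` of the Minimalist Foundation, and its classical version. -/
inductive Theory : Type
  | emTT
  | emTTc

open Judgement in
/-- Derivability of judgements. -/
inductive Derives (T : Theory) : Judgement → Prop
  -- contexts and variables
  | ctx_nil : Derives T (ctx [])
  | ctx_cons {Γ A} : Derives T (isTy Γ A .col) → Derives T (ctx (A :: Γ))
  | var {Γ i A} : Derives T (ctx Γ) → Lookup Γ i A → Derives T (isTm Γ (.var i) A)
  -- inclusions between kinds
  | incl {Γ A k k'} : Kind.Incl k k' → Derives T (isTy Γ A k) → Derives T (isTy Γ A k')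
  | eq_incl {Γ A B k k'} : Kind.Incl k k' → Derives T (eqTy Γ A B k) → Derives T (eqTy Γ A B k')
  -- judgemental equality is an equivalence relation, and typing respects it
  | ty_refl {Γ A k} : Derives T (isTy Γ A k) → Derives T (eqTy Γ A A k)
  | ty_symm {Γ A B k} : Derives T (eqTy Γ A B k) → Derives T (eqTy Γ B A k)
  | ty_trans {Γ A B C k} : Derives T (eqTy Γ A B k) → Derives T (eqTy Γ B C k) →
      Derives T (eqTy Γ A C k)
  | tm_refl {Γ a A} : Derives T (isTm Γ a A) → Derives T (eqTm Γ a a A)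
  | tm_symm {Γ a b A} : Derives T (eqTm Γ a b A) → Derives T (eqTm Γ b a A)
  | tm_trans {Γ a b c A} : Derives T (eqTm Γ a b A) → Derives T (eqTm Γ b c A) →
      Derives T (eqTm Γ a c A)
  | conv {Γ a A B} : Derives T (isTm Γ a A) → Derives T (eqTy Γ A B .col) → Derives T (isTm Γ a B)
  | eq_conv {Γ a b A B} : Derives T (eqTm Γ a b A) → Derives T (eqTy Γ A B .col) →
      Derives T (eqTm Γ a b B)
  -- substitution along a telescopic substitution (weakening is an instance),
  -- and replacement of equals along two equal ones
  | sub_ty {Γ Δ A k σ} : Derives T (ctx Δ) →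
      (∀ i C, Lookup Γ i C → Derives T (isTm Δ (σ i) (C.sub σ))) →
      Derives T (isTy Γ A k) → Derives T (isTy Δ (A.sub σ) k)
  | sub_eqTy {Γ Δ A B k σ} : Derives T (ctx Δ) →
      (∀ i C, Lookup Γ i C → Derives T (isTm Δ (σ i) (C.sub σ))) →
      Derives T (eqTy Γ A B k) → Derives T (eqTy Δ (A.sub σ) (B.sub σ) k)
  | sub_tm {Γ Δ a A σ} : Derives T (ctx Δ) →
      (∀ i C, Lookup Γ i C → Derives T (isTm Δ (σ i) (C.sub σ))) →
      Derives T (isTm Γ a A) → Derives T (isTm Δ (a.sub σ) (A.sub σ))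
  | sub_eqTm {Γ Δ a b A σ} : Derives T (ctx Δ) →
      (∀ i C, Lookup Γ i C → Derives T (isTm Δ (σ i) (C.sub σ))) →
      Derives T (eqTm Γ a b A) → Derives T (eqTm Δ (a.sub σ) (b.sub σ) (A.sub σ))
  | repl_ty {Γ Δ A k σ τ} : Derives T (ctx Δ) →
      (∀ i C, Lookup Γ i C → Derives T (isTm Δ (σ i) (C.sub σ))) →
      (∀ i C, Lookup Γ i C → Derives T (isTm Δ (τ i) (C.sub τ))) →
      (∀ i C, Lookup Γ i C → Derives T (eqTm Δ (σ i) (τ i) (C.sub σ))) →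
      Derives T (isTy Γ A k) → Derives T (eqTy Δ (A.sub σ) (A.sub τ) k)
  | repl_tm {Γ Δ a A σ τ} : Derives T (ctx Δ) →
      (∀ i C, Lookup Γ i C → Derives T (isTm Δ (σ i) (C.sub σ))) →
      (∀ i C, Lookup Γ i C → Derives T (isTm Δ (τ i) (C.sub τ))) →
      (∀ i C, Lookup Γ i C → Derives T (eqTm Δ (σ i) (τ i) (C.sub σ))) →
      Derives T (isTm Γ a A) → Derives T (eqTm Δ (a.sub σ) (a.sub τ) (A.sub σ))
  -- the empty set
  | n0_form {Γ} : Derives T (ctx Γ) → Derives T (isTy Γ .n0 .set)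
  | n0_elim {Γ M c} : Derives T (isTy (.n0 :: Γ) M .col) → Derives T (isTm Γ c .n0) →
      Derives T (isTm Γ (.elN0 M c) (M.inst 0 c))
  | n0_elim_eq {Γ M M' c c'} : Derives T (eqTy (.n0 :: Γ) M M' .col) →
      Derives T (eqTm Γ c c' .n0) →
      Derives T (eqTm Γ (.elN0 M c) (.elN0 M' c') (M.inst 0 c))
  -- the singleton set
  | n1_form {Γ} : Derives T (ctx Γ) → Derives T (isTy Γ .n1 .set)
  | n1_intro {Γ} : Derives T (ctx Γ) → Derives T (isTm Γ .star .n1)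
  | n1_elim {Γ M t c} : Derives T (isTy (.n1 :: Γ) M .col) → Derives T (isTm Γ t .n1) →
      Derives T (isTm Γ c (M.inst 0 .star)) →
      Derives T (isTm Γ (.elN1 M t c) (M.inst 0 t))
  | n1_elim_eq {Γ M M' t t' c c'} : Derives T (eqTy (.n1 :: Γ) M M' .col) →
      Derives T (eqTm Γ t t' .n1) → Derives T (eqTm Γ c c' (M.inst 0 .star)) →
      Derives T (eqTm Γ (.elN1 M t c) (.elN1 M' t' c') (M.inst 0 t))
  | n1_comp {Γ M c} : Derives T (isTy (.n1 :: Γ) M .col) →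
      Derives T (isTm Γ c (M.inst 0 .star)) →
      Derives T (eqTm Γ (.elN1 M .star c) c (M.inst 0 .star))
  -- dependent sums
  | sigma_form {Γ A B k} : Kind.Sums k → Derives T (isTy Γ A k) → Derives T (isTy (A :: Γ) B k) →
      Derives T (isTy Γ (.sigma A B) k)
  | sigma_form_eq {Γ A A' B B' k} : Kind.Sums k → Derives T (isTy Γ A k) →
      Derives T (eqTy Γ A A' k) → Derives T (isTy (A :: Γ) B k) →
      Derives T (eqTy (A :: Γ) B B' k) →
      Derives T (eqTy Γ (.sigma A B) (.sigma A' B') k)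
  | sigma_intro {Γ A B a b} : Derives T (isTy Γ A .col) → Derives T (isTy (A :: Γ) B .col) →
      Derives T (isTm Γ a A) → Derives T (isTm Γ b (B.inst 0 a)) →
      Derives T (isTm Γ (.pair A B a b) (.sigma A B))
  | sigma_intro_eq {Γ A A' B B' a a' b b'} : Derives T (isTy Γ A .col) →
      Derives T (eqTy Γ A A' .col) → Derives T (isTy (A :: Γ) B .col) →
      Derives T (eqTy (A :: Γ) B B' .col) →
      Derives T (eqTm Γ a a' A) → Derives T (eqTm Γ b b' (B.inst 0 a)) →
      Derives T (eqTm Γ (.pair A B a b) (.pair A' B' a' b') (.sigma A B))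
  | sigma_elim {Γ A B M d m} : Derives T (isTy Γ A .col) → Derives T (isTy (A :: Γ) B .col) →
      Derives T (isTy (.sigma A B :: Γ) M .col) → Derives T (isTm Γ d (.sigma A B)) →
      Derives T (isTm (B :: A :: Γ) m
        (M.inst 2 (.pair (A.wk 2) (B.wk₁ 2) (.var 1) (.var 0)))) →
      Derives T (isTm Γ (.elSigma A B M d m) (M.inst 0 d))
  | sigma_elim_eq {Γ A A' B B' M M' d d' m m'} : Derives T (isTy Γ A .col) →
      Derives T (eqTy Γ A A' .col) → Derives T (isTy (A :: Γ) B .col) →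
      Derives T (eqTy (A :: Γ) B B' .col) → Derives T (isTy (.sigma A B :: Γ) M .col) →
      Derives T (eqTy (.sigma A B :: Γ) M M' .col) → Derives T (eqTm Γ d d' (.sigma A B)) →
      Derives T (eqTm (B :: A :: Γ) m m'
        (M.inst 2 (.pair (A.wk 2) (B.wk₁ 2) (.var 1) (.var 0)))) →
      Derives T (eqTm Γ (.elSigma A B M d m) (.elSigma A' B' M' d' m') (M.inst 0 d))
  | sigma_comp {Γ A B M a b m} : Derives T (isTy Γ A .col) → Derives T (isTy (A :: Γ) B .col) →
      Derives T (isTy (.sigma A B :: Γ) M .col) → Derives T (isTm Γ a A) →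
      Derives T (isTm Γ b (B.inst 0 a)) →
      Derives T (isTm (B :: A :: Γ) m
        (M.inst 2 (.pair (A.wk 2) (B.wk₁ 2) (.var 1) (.var 0)))) →
      Derives T (eqTm Γ (.elSigma A B M (.pair A B a b) m) (m.inst₂ 0 a b)
        (M.inst 0 (.pair A B a b)))
  -- dependent products
  | pi_form {Γ A B k} : PiCod B k → Derives T (isTy Γ A .set) → Derives T (isTy (A :: Γ) B k) →
      Derives T (isTy Γ (.pi A B) k)
  | pi_form_eq {Γ A A' B B' k} : PiCod B k → Derives T (isTy Γ A .set) →
      Derives T (eqTy Γ A A' .set) → Derives T (isTy (A :: Γ) B k) →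
      Derives T (eqTy (A :: Γ) B B' k) →
      Derives T (eqTy Γ (.pi A B) (.pi A' B') k)
  | pi_intro {Γ A B k b} : PiCod B k → Derives T (isTy Γ A .set) →
      Derives T (isTy (A :: Γ) B k) → Derives T (isTm (A :: Γ) b B) →
      Derives T (isTm Γ (.lam A B b) (.pi A B))
  | pi_intro_eq {Γ A A' B B' k b b'} : PiCod B k → Derives T (isTy Γ A .set) →
      Derives T (eqTy Γ A A' .set) → Derives T (isTy (A :: Γ) B k) →
      Derives T (eqTy (A :: Γ) B B' k) → Derives T (eqTm (A :: Γ) b b' B) →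
      Derives T (eqTm Γ (.lam A B b) (.lam A' B' b') (.pi A B))
  | pi_elim {Γ A B k f a} : PiCod B k → Derives T (isTy Γ A .set) →
      Derives T (isTy (A :: Γ) B k) → Derives T (isTm Γ f (.pi A B)) → Derives T (isTm Γ a A) →
      Derives T (isTm Γ (.app A B f a) (B.inst 0 a))
  | pi_elim_eq {Γ A A' B B' k f f' a a'} : PiCod B k → Derives T (isTy Γ A .set) →
      Derives T (eqTy Γ A A' .set) → Derives T (isTy (A :: Γ) B k) →
      Derives T (eqTy (A :: Γ) B B' k) → Derives T (eqTm Γ f f' (.pi A B)) →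
      Derives T (eqTm Γ a a' A) →
      Derives T (eqTm Γ (.app A B f a) (.app A' B' f' a') (B.inst 0 a))
  | pi_beta {Γ A B k b a} : PiCod B k → Derives T (isTy Γ A .set) →
      Derives T (isTy (A :: Γ) B k) → Derives T (isTm (A :: Γ) b B) → Derives T (isTm Γ a A) →
      Derives T (eqTm Γ (.app A B (.lam A B b) a) (b.inst 0 a) (B.inst 0 a))
  | pi_eta {Γ A B k f} : PiCod B k → Derives T (isTy Γ A .set) →
      Derives T (isTy (A :: Γ) B k) → Derives T (isTm Γ f (.pi A B)) →
      Derives T (eqTm Γ (.lam A B (.app (A.wk 1) (B.wk₁ 1) (f.wk 1) (.var 0))) f (.pi A B))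
  -- lists
  | list_form {Γ A} : Derives T (isTy Γ A .set) → Derives T (isTy Γ (.list A) .set)
  | list_form_eq {Γ A A'} : Derives T (eqTy Γ A A' .set) →
      Derives T (eqTy Γ (.list A) (.list A') .set)
  | list_nil {Γ A} : Derives T (isTy Γ A .set) → Derives T (isTm Γ (.nil A) (.list A))
  | list_nil_eq {Γ A A'} : Derives T (eqTy Γ A A' .set) →
      Derives T (eqTm Γ (.nil A) (.nil A') (.list A))
  | list_cons {Γ A s a} : Derives T (isTy Γ A .set) → Derives T (isTm Γ s (.list A)) →
      Derives T (isTm Γ a A) → Derives T (isTm Γ (.cons A s a) (.list A))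
  | list_cons_eq {Γ A A' s s' a a'} : Derives T (eqTy Γ A A' .set) →
      Derives T (eqTm Γ s s' (.list A)) → Derives T (eqTm Γ a a' A) →
      Derives T (eqTm Γ (.cons A s a) (.cons A' s' a') (.list A))
  | list_elim {Γ A M s b l} : Derives T (isTy Γ A .set) →
      Derives T (isTy (.list A :: Γ) M .col) → Derives T (isTm Γ s (.list A)) →
      Derives T (isTm Γ b (M.inst 0 (.nil A))) →
      Derives T (isTm (M.inst 2 (.var 1) :: A.wk 1 :: .list A :: Γ) l
        (M.inst 3 (.cons (A.wk 3) (.var 2) (.var 1)))) →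
      Derives T (isTm Γ (.elList A M s b l) (M.inst 0 s))
  | list_elim_eq {Γ A A' M M' s s' b b' l l'} : Derives T (isTy Γ A .set) →
      Derives T (eqTy Γ A A' .set) → Derives T (isTy (.list A :: Γ) M .col) →
      Derives T (eqTy (.list A :: Γ) M M' .col) → Derives T (eqTm Γ s s' (.list A)) →
      Derives T (eqTm Γ b b' (M.inst 0 (.nil A))) →
      Derives T (eqTm (M.inst 2 (.var 1) :: A.wk 1 :: .list A :: Γ) l l'
        (M.inst 3 (.cons (A.wk 3) (.var 2) (.var 1)))) →
      Derives T (eqTm Γ (.elList A M s b l) (.elList A' M' s' b' l') (M.inst 0 s))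
  | list_comp_nil {Γ A M b l} : Derives T (isTy Γ A .set) →
      Derives T (isTy (.list A :: Γ) M .col) →
      Derives T (isTm Γ b (M.inst 0 (.nil A))) →
      Derives T (isTm (M.inst 2 (.var 1) :: A.wk 1 :: .list A :: Γ) l
        (M.inst 3 (.cons (A.wk 3) (.var 2) (.var 1)))) →
      Derives T (eqTm Γ (.elList A M (.nil A) b l) b (M.inst 0 (.nil A)))
  | list_comp_cons {Γ A M s a b l} : Derives T (isTy Γ A .set) →
      Derives T (isTy (.list A :: Γ) M .col) → Derives T (isTm Γ s (.list A)) →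
      Derives T (isTm Γ a A) → Derives T (isTm Γ b (M.inst 0 (.nil A))) →
      Derives T (isTm (M.inst 2 (.var 1) :: A.wk 1 :: .list A :: Γ) l
        (M.inst 3 (.cons (A.wk 3) (.var 2) (.var 1)))) →
      Derives T (eqTm Γ (.elList A M (.cons A s a) b l) (l.inst₃ s a (.elList A M s b l))
        (M.inst 0 (.cons A s a)))
  -- disjoint sums
  | sum_form {Γ A B} : Derives T (isTy Γ A .set) → Derives T (isTy Γ B .set) →
      Derives T (isTy Γ (.sum A B) .set)
  | sum_form_eq {Γ A A' B B'} : Derives T (eqTy Γ A A' .set) → Derives T (eqTy Γ B B' .set) →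
      Derives T (eqTy Γ (.sum A B) (.sum A' B') .set)
  | sum_inl {Γ A B a} : Derives T (isTy Γ A .set) → Derives T (isTy Γ B .set) →
      Derives T (isTm Γ a A) → Derives T (isTm Γ (.inl A B a) (.sum A B))
  | sum_inl_eq {Γ A A' B B' a a'} : Derives T (eqTy Γ A A' .set) →
      Derives T (eqTy Γ B B' .set) → Derives T (eqTm Γ a a' A) →
      Derives T (eqTm Γ (.inl A B a) (.inl A' B' a') (.sum A B))
  | sum_inr {Γ A B b} : Derives T (isTy Γ A .set) → Derives T (isTy Γ B .set) →
      Derives T (isTm Γ b B) → Derives T (isTm Γ (.inr A B b) (.sum A B))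
  | sum_inr_eq {Γ A A' B B' b b'} : Derives T (eqTy Γ A A' .set) →
      Derives T (eqTy Γ B B' .set) → Derives T (eqTm Γ b b' B) →
      Derives T (eqTm Γ (.inr A B b) (.inr A' B' b') (.sum A B))
  | sum_elim {Γ A B M d l r} : Derives T (isTy Γ A .set) → Derives T (isTy Γ B .set) →
      Derives T (isTy (.sum A B :: Γ) M .col) → Derives T (isTm Γ d (.sum A B)) →
      Derives T (isTm (A :: Γ) l (M.inst 1 (.inl (A.wk 1) (B.wk 1) (.var 0)))) →
      Derives T (isTm (B :: Γ) r (M.inst 1 (.inr (A.wk 1) (B.wk 1) (.var 0)))) →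
      Derives T (isTm Γ (.elSum A B M d l r) (M.inst 0 d))
  | sum_elim_eq {Γ A A' B B' M M' d d' l l' r r'} : Derives T (isTy Γ A .set) →
      Derives T (eqTy Γ A A' .set) → Derives T (isTy Γ B .set) → Derives T (eqTy Γ B B' .set) →
      Derives T (isTy (.sum A B :: Γ) M .col) → Derives T (eqTy (.sum A B :: Γ) M M' .col) →
      Derives T (eqTm Γ d d' (.sum A B)) →
      Derives T (eqTm (A :: Γ) l l' (M.inst 1 (.inl (A.wk 1) (B.wk 1) (.var 0)))) →
      Derives T (eqTm (B :: Γ) r r' (M.inst 1 (.inr (A.wk 1) (B.wk 1) (.var 0)))) →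
      Derives T (eqTm Γ (.elSum A B M d l r) (.elSum A' B' M' d' l' r') (M.inst 0 d))
  | sum_comp_inl {Γ A B M a l r} : Derives T (isTy Γ A .set) → Derives T (isTy Γ B .set) →
      Derives T (isTy (.sum A B :: Γ) M .col) → Derives T (isTm Γ a A) →
      Derives T (isTm (A :: Γ) l (M.inst 1 (.inl (A.wk 1) (B.wk 1) (.var 0)))) →
      Derives T (isTm (B :: Γ) r (M.inst 1 (.inr (A.wk 1) (B.wk 1) (.var 0)))) →
      Derives T (eqTm Γ (.elSum A B M (.inl A B a) l r) (l.inst 0 a) (M.inst 0 (.inl A B a)))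
  | sum_comp_inr {Γ A B M b l r} : Derives T (isTy Γ A .set) → Derives T (isTy Γ B .set) →
      Derives T (isTy (.sum A B :: Γ) M .col) → Derives T (isTm Γ b B) →
      Derives T (isTm (A :: Γ) l (M.inst 1 (.inl (A.wk 1) (B.wk 1) (.var 0)))) →
      Derives T (isTm (B :: Γ) r (M.inst 1 (.inr (A.wk 1) (B.wk 1) (.var 0)))) →
      Derives T (eqTm Γ (.elSum A B M (.inr A B b) l r) (r.inst 0 b) (M.inst 0 (.inr A B b)))
  -- quotients of a set by a small equivalence relation
  | quot_form {Γ A R} : Derives T (isTy Γ A .set) →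
      Derives T (isTy (A.wk 1 :: A :: Γ) R .props) →
      Derives T (holds (A :: Γ) (R.inst₂ 1 (.var 0) (.var 0))) →
      Derives T (holds (R :: A.wk 1 :: A :: Γ) (R.inst₂ 3 (.var 1) (.var 2))) →
      Derives T (holds (R.inst₂ 4 (.var 2) (.var 1) :: R.wk 1 :: A.wk 2 :: A.wk 1 :: A :: Γ)
        (R.inst₂ 5 (.var 4) (.var 2))) →
      Derives T (isTy Γ (.quot A R) .set)
  | quot_form_eq {Γ A A' R R'} : Derives T (eqTy Γ A A' .set) →
      Derives T (eqTy (A.wk 1 :: A :: Γ) R R' .props) → Derives T (isTy Γ (.quot A R) .set) →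
      Derives T (isTy Γ (.quot A' R') .set) →
      Derives T (eqTy Γ (.quot A R) (.quot A' R') .set)
  | quot_intro {Γ A R a} : Derives T (isTy Γ (.quot A R) .set) → Derives T (isTm Γ a A) →
      Derives T (isTm Γ (.cls A R a) (.quot A R))
  | quot_intro_eq {Γ A A' R R' a a'} : Derives T (eqTy Γ A A' .set) →
      Derives T (eqTy (A.wk 1 :: A :: Γ) R R' .props) → Derives T (isTy Γ (.quot A R) .set) →
      Derives T (isTy Γ (.quot A' R') .set) → Derives T (eqTm Γ a a' A) →
      Derives T (eqTm Γ (.cls A R a) (.cls A' R' a') (.quot A R))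
  | quot_eq {Γ A R a b} : Derives T (isTy Γ (.quot A R) .set) → Derives T (isTm Γ a A) →
      Derives T (isTm Γ b A) → Derives T (holds Γ (R.inst₂ 0 a b)) →
      Derives T (eqTm Γ (.cls A R a) (.cls A R b) (.quot A R))
  | quot_eff {Γ A R a b} : Derives T (isTy Γ (.quot A R) .set) → Derives T (isTm Γ a A) →
      Derives T (isTm Γ b A) → Derives T (eqTm Γ (.cls A R a) (.cls A R b) (.quot A R)) →
      Derives T (holds Γ (R.inst₂ 0 a b))
  | quot_elim {Γ A R M p l} : Derives T (isTy Γ (.quot A R) .set) →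
      Derives T (isTy (.quot A R :: Γ) M .col) → Derives T (isTm Γ p (.quot A R)) →
      Derives T (isTm (A :: Γ) l (M.inst 1 (.cls (A.wk 1) (R.wk₂ 1) (.var 0)))) →
      Derives T (eqTm (R :: A.wk 1 :: A :: Γ) (l.inst 3 (.var 2)) (l.inst 3 (.var 1))
        (M.inst 3 (.cls (A.wk 3) (R.wk₂ 3) (.var 2)))) →
      Derives T (isTm Γ (.elQuot A R M p l) (M.inst 0 p))
  | quot_elim_eq {Γ A A' R R' M M' p p' l l'} : Derives T (eqTy Γ A A' .set) →
      Derives T (eqTy (A.wk 1 :: A :: Γ) R R' .props) → Derives T (isTy Γ (.quot A R) .set) →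
      Derives T (isTy Γ (.quot A' R') .set) → Derives T (isTy (.quot A R :: Γ) M .col) →
      Derives T (eqTy (.quot A R :: Γ) M M' .col) → Derives T (eqTm Γ p p' (.quot A R)) →
      Derives T (eqTm (A :: Γ) l l' (M.inst 1 (.cls (A.wk 1) (R.wk₂ 1) (.var 0)))) →
      Derives T (eqTm (R :: A.wk 1 :: A :: Γ) (l.inst 3 (.var 2)) (l.inst 3 (.var 1))
        (M.inst 3 (.cls (A.wk 3) (R.wk₂ 3) (.var 2)))) →
      Derives T (eqTm Γ (.elQuot A R M p l) (.elQuot A' R' M' p' l') (M.inst 0 p))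
  | quot_comp {Γ A R M a l} : Derives T (isTy Γ (.quot A R) .set) →
      Derives T (isTy (.quot A R :: Γ) M .col) → Derives T (isTm Γ a A) →
      Derives T (isTm (A :: Γ) l (M.inst 1 (.cls (A.wk 1) (R.wk₂ 1) (.var 0)))) →
      Derives T (eqTm (R :: A.wk 1 :: A :: Γ) (l.inst 3 (.var 2)) (l.inst 3 (.var 1))
        (M.inst 3 (.cls (A.wk 3) (R.wk₂ 3) (.var 2)))) →
      Derives T (eqTm Γ (.elQuot A R M (.cls A R a) l) (l.inst 0 a) (M.inst 0 (.cls A R a)))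
  -- the power collection of the singleton
  | pow1_form {Γ} : Derives T (ctx Γ) → Derives T (isTy Γ .pow1 .col)
  | pow1_intro {Γ P} : Derives T (isTy Γ P .props) → Derives T (isTm Γ (.code P) .pow1)
  | pow1_eq {Γ P Q} : Derives T (isTy Γ P .props) → Derives T (isTy Γ Q .props) →
      Derives T (holds Γ (iff P Q)) → Derives T (eqTm Γ (.code P) (.code Q) .pow1)
  | pow1_eff {Γ P Q} : Derives T (isTy Γ P .props) → Derives T (isTy Γ Q .props) →
      Derives T (eqTm Γ (.code P) (.code Q) .pow1) → Derives T (holds Γ (iff P Q))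
  | pow1_eta {Γ U} : Derives T (isTm Γ U .pow1) → Derives T (eqTm Γ U (.code (dc U)) .pow1)
  -- formation of propositions
  | falsum_form {Γ} : Derives T (ctx Γ) → Derives T (isTy Γ .falsum .props)
  | conj_form {Γ P Q k} : Kind.Logical k → Derives T (isTy Γ P k) → Derives T (isTy Γ Q k) →
      Derives T (isTy Γ (.conj P Q) k)
  | conj_form_eq {Γ P P' Q Q' k} : Kind.Logical k → Derives T (eqTy Γ P P' k) →
      Derives T (eqTy Γ Q Q' k) → Derives T (eqTy Γ (.conj P Q) (.conj P' Q') k)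
  | disj_form {Γ P Q k} : Kind.Logical k → Derives T (isTy Γ P k) → Derives T (isTy Γ Q k) →
      Derives T (isTy Γ (.disj P Q) k)
  | disj_form_eq {Γ P P' Q Q' k} : Kind.Logical k → Derives T (eqTy Γ P P' k) →
      Derives T (eqTy Γ Q Q' k) → Derives T (eqTy Γ (.disj P Q) (.disj P' Q') k)
  | imp_form {Γ P Q k} : Kind.Logical k → Derives T (isTy Γ P k) → Derives T (isTy Γ Q k) →
      Derives T (isTy Γ (.imp P Q) k)
  | imp_form_eq {Γ P P' Q Q' k} : Kind.Logical k → Derives T (eqTy Γ P P' k) →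
      Derives T (eqTy Γ Q Q' k) → Derives T (eqTy Γ (.imp P Q) (.imp P' Q') k)
  | all_form {Γ A P k k'} : Kind.Quant k k' → Derives T (isTy Γ A k) →
      Derives T (isTy (A :: Γ) P k') → Derives T (isTy Γ (.all A P) k')
  | all_form_eq {Γ A A' P P' k k'} : Kind.Quant k k' → Derives T (isTy Γ A k) →
      Derives T (eqTy Γ A A' k) → Derives T (eqTy (A :: Γ) P P' k') →
      Derives T (eqTy Γ (.all A P) (.all A' P') k')
  | ex_form {Γ A P k k'} : Kind.Quant k k' → Derives T (isTy Γ A k) →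
      Derives T (isTy (A :: Γ) P k') → Derives T (isTy Γ (.ex A P) k')
  | ex_form_eq {Γ A A' P P' k k'} : Kind.Quant k k' → Derives T (isTy Γ A k) →
      Derives T (eqTy Γ A A' k) → Derives T (eqTy (A :: Γ) P P' k') →
      Derives T (eqTy Γ (.ex A P) (.ex A' P') k')
  | eq_form {Γ A a b k k'} : EqDom k A k' → Derives T (isTy Γ A k) → Derives T (isTm Γ a A) →
      Derives T (isTm Γ b A) → Derives T (isTy Γ (.eq A a b) k')
  | eq_form_eq {Γ A A' a a' b b' k k'} : EqDom k A k' → Derives T (isTy Γ A k) →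
      Derives T (eqTy Γ A A' k) → Derives T (eqTm Γ a a' A) → Derives T (eqTm Γ b b' A) →
      Derives T (eqTy Γ (.eq A a b) (.eq A' a' b') k')
  -- propositions are proof-irrelevant
  | prop_mono {Γ P p q} : Derives T (isTy Γ P .prop) → Derives T (isTm Γ p P) →
      Derives T (isTm Γ q P) → Derives T (eqTm Γ p q P)
  | prop_true {Γ P p} : Derives T (isTy Γ P .prop) → Derives T (isTm Γ p P) →
      Derives T (holds Γ P)
  -- intuitionistic logic
  | falsum_elim {Γ P} : Derives T (isTy Γ P .prop) → Derives T (holds Γ .falsum) →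
      Derives T (holds Γ P)
  | conj_intro {Γ P Q} : Derives T (isTy Γ P .prop) → Derives T (isTy Γ Q .prop) →
      Derives T (holds Γ P) → Derives T (holds Γ Q) → Derives T (holds Γ (.conj P Q))
  | conj_left {Γ P Q} : Derives T (isTy Γ P .prop) → Derives T (isTy Γ Q .prop) →
      Derives T (holds Γ (.conj P Q)) → Derives T (holds Γ P)
  | conj_right {Γ P Q} : Derives T (isTy Γ P .prop) → Derives T (isTy Γ Q .prop) →
      Derives T (holds Γ (.conj P Q)) → Derives T (holds Γ Q)
  | disj_left {Γ P Q} : Derives T (isTy Γ P .prop) → Derives T (isTy Γ Q .prop) →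
      Derives T (holds Γ P) → Derives T (holds Γ (.disj P Q))
  | disj_right {Γ P Q} : Derives T (isTy Γ P .prop) → Derives T (isTy Γ Q .prop) →
      Derives T (holds Γ Q) → Derives T (holds Γ (.disj P Q))
  | disj_elim {Γ P Q C} : Derives T (isTy Γ P .prop) → Derives T (isTy Γ Q .prop) →
      Derives T (isTy Γ C .prop) → Derives T (holds Γ (.disj P Q)) →
      Derives T (holds (P :: Γ) (C.wk 1)) → Derives T (holds (Q :: Γ) (C.wk 1)) →
      Derives T (holds Γ C)
  | imp_intro {Γ P Q} : Derives T (isTy Γ P .prop) → Derives T (isTy Γ Q .prop) →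
      Derives T (holds (P :: Γ) (Q.wk 1)) → Derives T (holds Γ (.imp P Q))
  | imp_elim {Γ P Q} : Derives T (isTy Γ P .prop) → Derives T (isTy Γ Q .prop) →
      Derives T (holds Γ (.imp P Q)) → Derives T (holds Γ P) → Derives T (holds Γ Q)
  | all_intro {Γ A P} : Derives T (isTy Γ A .col) → Derives T (isTy (A :: Γ) P .prop) →
      Derives T (holds (A :: Γ) P) → Derives T (holds Γ (.all A P))
  | all_elim {Γ A P a} : Derives T (isTy Γ A .col) → Derives T (isTy (A :: Γ) P .prop) →
      Derives T (holds Γ (.all A P)) → Derives T (isTm Γ a A) →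
      Derives T (holds Γ (P.inst 0 a))
  | ex_intro {Γ A P a} : Derives T (isTy Γ A .col) → Derives T (isTy (A :: Γ) P .prop) →
      Derives T (isTm Γ a A) → Derives T (holds Γ (P.inst 0 a)) → Derives T (holds Γ (.ex A P))
  | ex_elim {Γ A P C} : Derives T (isTy Γ A .col) → Derives T (isTy (A :: Γ) P .prop) →
      Derives T (isTy Γ C .prop) → Derives T (holds Γ (.ex A P)) →
      Derives T (holds (P :: A :: Γ) (C.wk 2)) → Derives T (holds Γ C)
  -- extensional propositional equality
  | eq_intro {Γ A a} : Derives T (isTy Γ A .col) → Derives T (isTm Γ a A) →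
      Derives T (holds Γ (.eq A a a))
  | eq_elim {Γ A a b} : Derives T (isTy Γ A .col) → Derives T (isTm Γ a A) →
      Derives T (isTm Γ b A) → Derives T (holds Γ (.eq A a b)) → Derives T (eqTm Γ a b A)
  -- the law of excluded middle, only in the classical theory
  | lem {Γ P} : T = .emTTc → Derives T (isTy Γ P .prop) → Derives T (holds Γ (.disj P (neg P)))

/-! ### The double-negation translation -/

namespace Expr

/-- The collection of (small, up to equiprovability) stable propositions. -/
def stabPow1 : Ty := sigma pow1 (stab (dc (var 0)))

/-- The collection of the functions from a set `A` to the power collection of the singleton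
all of whose values are stable. -/
def stabPow (A : Ty) : Ty :=
  sigma (pi A pow1) (all (A.wk 1) (stab (dc (app (A.wk 2) pow1 (var 1) (var 0)))))

/-- The stable proposition underlying an element of `stabPow1`, as an element of `pow1`. -/
def fromStab (u : Tm) : Tm := proj₁ pow1 (stab (dc (var 0))) u

/-- The element of `stabPow1` given by an element `U` of `pow1` whose decoding is stable. -/
def toStab (U : Tm) : Tm := pair pow1 (stab (dc (var 0))) U (triv (stab (dc U)))

/-- The function underlying an element of `stabPow A`. -/
def fromStabPow (A : Ty) (f : Tm) : Tm :=
  proj₁ (pi A pow1) (all (A.wk 1) (stab (dc (app (A.wk 2) pow1 (var 1) (var 0))))) f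

/-- The element of `stabPow A` given by a function `g` with stable values. -/
def toStabPow (A : Ty) (g : Tm) : Tm :=
  pair (pi A pow1) (all (A.wk 1) (stab (dc (app (A.wk 2) pow1 (var 1) (var 0))))) g
    (triv (all A (stab (dc (app (A.wk 1) pow1 (g.wk 1) (var 0))))))

/-- The double-negation translation of expressions. -/
def dn : {s : Cat} → Expr s → Expr s
  | _, n0 => n0
  | _, n1 => n1
  | _, sigma A B => sigma A.dn B.dn
  | _, pi A pow1 => stabPow A.dn
  | _, pi A B => pi A.dn B.dn
  | _, list A => list A.dn
  | _, sum A B => sum A.dn B.dn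
  | _, quot A R => quot A.dn R.dn
  | _, pow1 => stabPow1
  | _, falsum => falsum
  | _, conj P Q => conj P.dn Q.dn
  | _, disj P Q => neg (neg (disj P.dn Q.dn))
  | _, imp P Q => imp P.dn Q.dn
  | _, all A P => all A.dn P.dn
  | _, ex A P => neg (neg (ex A.dn P.dn))
  | _, eq pow1 a b => eq pow1 (fromStab a.dn) (fromStab b.dn)
  | _, eq A a b => eq A.dn a.dn b.dn
  | _, var i => var i
  | _, triv P => triv P.dn
  | _, elN0 M c => elN0 M.dn c.dn
  | _, star => star
  | _, elN1 M t c => elN1 M.dn t.dn c.dn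
  | _, pair A B a b => pair A.dn B.dn a.dn b.dn
  | _, elSigma A B M d m => elSigma A.dn B.dn M.dn d.dn m.dn
  | _, lam A pow1 b => toStabPow A.dn (lam A.dn pow1 (fromStab b.dn))
  | _, lam A B b => lam A.dn B.dn b.dn
  | _, app A pow1 f a => toStab (app A.dn pow1 (fromStabPow A.dn f.dn) a.dn)
  | _, app A B f a => app A.dn B.dn f.dn a.dn
  | _, nil A => nil A.dn
  | _, cons A s a => cons A.dn s.dn a.dn
  | _, elList A M s b l => elList A.dn M.dn s.dn b.dn l.dn
  | _, inl A B a => inl A.dn B.dn a.dn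
  | _, inr A B b => inr A.dn B.dn b.dn
  | _, elSum A B M d l r => elSum A.dn B.dn M.dn d.dn l.dn r.dn
  | _, cls A R a => cls A.dn R.dn a.dn
  | _, elQuot A R M p l => elQuot A.dn R.dn M.dn p.dn l.dn
  | _, code P => toStab (code P.dn)

end Expr

/-- The double-negation translation of contexts. -/
def Ctx.dn (Γ : Ctx) : Ctx := List.map Expr.dn Γ

end EmTT

namespace EmTT

/-! The proof is a Gödel–Gentzen argument, carried out by a single induction on derivations of the
classical theory (`Derives.valid`). Excluded middle becomes $\neg\neg(\varphi\vee\neg\varphi)$,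
which is intuitionistically provable. The eliminations of the doubly negated $\vee$ and $\exists$ go
through because their conclusions are stable, so the induction must carry the stability of every
translated proposition. Implication, conjunction and universal quantification preserve stability,
and negations are always stable. What remains is equality, which must be stable in every translated
type. This is the second invariant, `SEq`. The two are intertwined: equality in a quotient is stable
because the relation is.

Stable equality is proved type by type. For propositions it is proof irrelevance. For sums, disjoint
sums and lists, induction reduces to canonical elements. Constructors are injective and different
ones are disjoint, so an equality of canonical elements either reduces to its components or is
refutable. Disjointness comes from eliminating into $\mathcal P(1)$, where $[\top]=[\bot]$ is
absurd. Functions are compared pointwise by $\eta$. In a quotient, effectiveness turns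
$\neg\neg([a]=[b])$ into $\neg\neg R(a,b)$. Stable equality of $\mathcal P(1)$ itself would make
every small proposition stable, hence the passage to the stable elements. There $U=V$ amounts to
$\mathsf{Dc}(U)\Leftrightarrow\mathsf{Dc}(V)$, an equivalence of stable propositions. The
subcollections involved have irrelevant second components, so the rules for the translated
constructors are checked on first projections.

Two facts make the clauses coherent: the translation commutes with substitution (`dn_sub`), and
whether a type is literally `pow1`, on which the clauses depend, is invariant under substitution and
judgemental equality (`Derives.inv`). Substitution is a primitive rule, so inversion and
presuppositions (`Derives.presup`) need inductions of their own, valid for both theories. Logical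
arguments are in Kripke style: a hypothesis is added by passing to an arbitrary well-typed
substitution into the context (`imp_intro_sub`, `nn_map`). -/

/-! ### The substitution calculus -/

/-- The substitution that weakens by `n` variables. -/
def shift (n : ℕ) : ℕ → Tm := fun i => .var (i + n)

/-- Composition of substitutions, in diagrammatic order. -/
def cmp (σ τ : ℕ → Tm) : ℕ → Tm := fun i => (σ i).sub τ

theorem lift_comp (ρ ρ' : ℕ → ℕ) : lift ρ' ∘ lift ρ = lift (ρ' ∘ ρ) := by
  funext i; cases i <;> rfl

theorem up_comp_lift (σ : ℕ → Tm) (ρ : ℕ → ℕ) : up σ ∘ lift ρ = up (σ ∘ ρ) := by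
  funext i; cases i <;> rfl

theorem up_var_comp (ρ : ℕ → ℕ) : up (Expr.var ∘ ρ) = Expr.var ∘ lift ρ := by
  funext i; cases i <;> rfl

theorem up_var : up Expr.var = Expr.var := by
  funext i; cases i <;> rfl

namespace Expr

/-- The composition law for two substitutions needs the mixed laws with renamings first, since going
under a binder renames the substituted terms. -/
theorem ren_ren {s : Cat} (e : Expr s) (ρ ρ' : ℕ → ℕ) :
    (e.ren ρ).ren ρ' = e.ren (ρ' ∘ ρ) := by
  induction e generalizing ρ ρ' <;> simp [ren, *, lift_comp]

theorem ren_eq_sub {s : Cat} (e : Expr s) (ρ : ℕ → ℕ) : e.ren ρ = e.sub (var ∘ ρ) := by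
  induction e generalizing ρ <;> simp [ren, sub, *, up_var_comp]

theorem ren_sub {s : Cat} (e : Expr s) (ρ : ℕ → ℕ) (σ : ℕ → Tm) :
    (e.ren ρ).sub σ = e.sub (σ ∘ ρ) := by
  induction e generalizing ρ σ <;> simp [ren, sub, *, up_comp_lift]

theorem sub_var {s : Cat} (e : Expr s) : e.sub var = e := by
  induction e <;> simp [sub, *, up_var]

end Expr

theorem ren_up (σ : ℕ → Tm) (ρ : ℕ → ℕ) :
    (fun i => (up σ i).ren (lift ρ)) = up (fun i => (σ i).ren ρ) := by
  funext i
  cases i with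
  | zero => rfl
  | succ i => simp only [up, Expr.ren_ren]; rfl

namespace Expr

theorem sub_ren {s : Cat} (e : Expr s) (σ : ℕ → Tm) (ρ : ℕ → ℕ) :
    (e.sub σ).ren ρ = e.sub (fun i => (σ i).ren ρ) := by
  induction e generalizing σ ρ <;> simp [ren, sub, *, ren_up]

end Expr

theorem cmp_up (σ τ : ℕ → Tm) : cmp (up σ) (up τ) = up (cmp σ τ) := by
  funext i
  cases i with
  | zero => rfl
  | succ i => simp only [cmp, up, Expr.ren_sub, Expr.sub_ren]; rfl

namespace Expr

theorem sub_sub {s : Cat} (e : Expr s) (σ τ : ℕ → Tm) :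
    (e.sub σ).sub τ = e.sub (cmp σ τ) := by
  induction e generalizing σ τ <;> simp [sub, *, cmp_up]
  rfl

theorem wk_eq {s : Cat} (n : ℕ) (e : Expr s) : e.wk n = e.sub (shift n) := ren_eq_sub ..

end Expr

/-- Eliminates `up` in favour of `scons`, `cmp` and `shift`, in terms of which substitutions are
normalised. -/
theorem up_eq (σ : ℕ → Tm) : up σ = scons (.var 0) (cmp σ (shift 1)) := by
  funext i
  cases i with
  | zero => rfl
  | succ i => simp only [up, scons, Expr.ren_eq_sub]; rfl

namespace Expr

theorem wk₁_eq {s : Cat} (n : ℕ) (e : Expr s) : e.wk₁ n = e.sub (up (shift n)) := by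
  rw [wk₁, ren_eq_sub, ← up_var_comp]; rfl

theorem wk₂_eq {s : Cat} (n : ℕ) (e : Expr s) : e.wk₂ n = e.sub (up (up (shift n))) := by
  rw [wk₂, ren_eq_sub, ← up_var_comp, ← up_var_comp]; rfl

theorem inst_eq {s : Cat} (n : ℕ) (e : Expr s) (t : Tm) :
    e.inst n t = e.sub (scons t (shift n)) := rfl

theorem inst₂_eq {s : Cat} (n : ℕ) (e : Expr s) (a b : Tm) :
    e.inst₂ n a b = e.sub (scons b (scons a (shift n))) := rfl

theorem inst₃_eq {s : Cat} (e : Expr s) (a b c : Tm) :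
    e.inst₃ a b c = e.sub (scons c (scons b (scons a (shift 0)))) := rfl

end Expr

/-! ### Normal forms of substitutions -/

theorem shift_zero : shift 0 = Expr.var := rfl

theorem shift_apply (n i : ℕ) : shift n i = .var (i + n) := rfl

theorem cmp_assoc (σ τ θ : ℕ → Tm) : cmp (cmp σ τ) θ = cmp σ (cmp τ θ) := by
  funext i; exact Expr.sub_sub ..

theorem cmp_var (σ : ℕ → Tm) : cmp σ .var = σ := by
  funext i; exact Expr.sub_var _

theorem var_cmp (σ : ℕ → Tm) : cmp .var σ = σ := rfl

theorem scons_cmp (t : Tm) (σ τ : ℕ → Tm) : cmp (scons t σ) τ = scons (t.sub τ) (cmp σ τ) := by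
  funext i; cases i <;> rfl

theorem shift_cmp_shift (m n : ℕ) : cmp (shift m) (shift n) = shift (m + n) := by
  funext i; simp only [cmp, shift, Expr.sub, add_assoc]

theorem shift_cmp_shift_cmp (m n : ℕ) (σ : ℕ → Tm) :
    cmp (shift m) (cmp (shift n) σ) = cmp (shift (m + n)) σ := by
  rw [← cmp_assoc, shift_cmp_shift]

theorem shift_succ_cmp_scons (n : ℕ) (t : Tm) (σ : ℕ → Tm) :
    cmp (shift (n + 1)) (scons t σ) = cmp (shift n) σ := rfl

theorem shift_one_cmp_scons (t : Tm) (σ : ℕ → Tm) : cmp (shift 1) (scons t σ) = σ := rfl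

theorem scons_zero (t : Tm) (σ : ℕ → Tm) : scons t σ 0 = t := rfl

theorem scons_succ (t : Tm) (σ : ℕ → Tm) (i : ℕ) : scons t σ (i + 1) = σ i := rfl

theorem scons_one (t : Tm) (σ : ℕ → Tm) : scons t σ 1 = σ 0 := rfl

theorem cmp_apply (σ τ : ℕ → Tm) (i : ℕ) : cmp σ τ i = (σ i).sub τ := rfl

theorem scons_var_shift (n : ℕ) : scons (.var n) (shift (n + 1)) = shift n := by
  funext i
  cases i with
  | zero => simp [scons, shift]
  | succ i => simp [scons, shift]; omega

theorem scons_var_zero : scons (.var 0) (shift 1) = .var := scons_var_shift 0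

theorem scons_var_one : scons (.var 1) (shift 2) = shift 1 := scons_var_shift 1

theorem scons_var_two : scons (.var 2) (shift 3) = shift 2 := scons_var_shift 2

-- Oriented this way, the equations form a calculus of explicit substitutions. Most uses of `simpa`
-- below compare two forms of a weakened or instantiated expression by normalising with it.
attribute [simp] Expr.sub Expr.sub_var Expr.sub_sub Expr.wk_eq Expr.wk₁_eq Expr.wk₂_eq Expr.inst_eq
  Expr.inst₂_eq Expr.inst₃_eq up_eq shift_zero shift_apply cmp_assoc cmp_var var_cmp scons_cmp
  shift_cmp_shift shift_cmp_shift_cmp shift_succ_cmp_scons shift_one_cmp_scons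
  scons_zero scons_succ scons_one cmp_apply scons_var_zero scons_var_one scons_var_two

namespace Expr

@[simp] theorem neg_sub (P : Ty) (σ : ℕ → Tm) : (neg P).sub σ = neg (P.sub σ) := rfl
@[simp] theorem stab_sub (P : Ty) (σ : ℕ → Tm) : (stab P).sub σ = stab (P.sub σ) := rfl
@[simp] theorem iff_sub (P Q : Ty) (σ : ℕ → Tm) : (iff P Q).sub σ = iff (P.sub σ) (Q.sub σ) := rfl
@[simp] theorem dc_sub (U : Tm) (σ : ℕ → Tm) : (dc U).sub σ = dc (U.sub σ) := rfl
@[simp] theorem top_sub (σ : ℕ → Tm) : top.sub σ = top := rfl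

@[simp] theorem proj₁_sub (A B : Ty) (d : Tm) (σ : ℕ → Tm) :
    (proj₁ A B d).sub σ = proj₁ (A.sub σ) (B.sub (up σ)) (d.sub σ) := by
  simp [proj₁]

@[simp] theorem stabPow_sub (A : Ty) (σ : ℕ → Tm) : (stabPow A).sub σ = stabPow (A.sub σ) := by
  simp [stabPow]

@[simp] theorem stabPow1_sub (σ : ℕ → Tm) : stabPow1.sub σ = stabPow1 := rfl

@[simp] theorem fromStab_sub (u : Tm) (σ : ℕ → Tm) : (fromStab u).sub σ = fromStab (u.sub σ) := by
  simp [fromStab]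

@[simp] theorem toStab_sub (u : Tm) (σ : ℕ → Tm) : (toStab u).sub σ = toStab (u.sub σ) := by
  simp [toStab]

@[simp] theorem fromStabPow_sub (A : Ty) (f : Tm) (σ : ℕ → Tm) :
    (fromStabPow A f).sub σ = fromStabPow (A.sub σ) (f.sub σ) := by
  simp [fromStabPow]

@[simp] theorem toStabPow_sub (A : Ty) (g : Tm) (σ : ℕ → Tm) :
    (toStabPow A g).sub σ = toStabPow (A.sub σ) (g.sub σ) := by
  simp [toStabPow]

/-! ### Commutation of the translation with substitution -/

theorem dn_pi {A B : Ty} (h : B ≠ pow1) : (pi A B).dn = pi A.dn B.dn := by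
  cases B <;> first | rfl | exact absurd rfl h

theorem dn_lam {A B : Ty} {b : Tm} (h : B ≠ pow1) : (lam A B b).dn = lam A.dn B.dn b.dn := by
  cases B <;> first | rfl | exact absurd rfl h

theorem dn_app {A B : Ty} {f a : Tm} (h : B ≠ pow1) :
    (app A B f a).dn = app A.dn B.dn f.dn a.dn := by
  cases B <;> first | rfl | exact absurd rfl h

theorem dn_eq {A : Ty} {a b : Tm} (h : A ≠ pow1) : (eq A a b).dn = eq A.dn a.dn b.dn := by
  cases A <;> first | rfl | exact absurd rfl h

/-- There are no type variables, so renaming, and likewise substitution, neither creates nor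
destroys `pow1`. The special clauses of `dn` therefore apply afterwards exactly when they applied
before. -/
theorem ren_eq_pow1 {A : Ty} {ρ : ℕ → ℕ} : A.ren ρ = pow1 ↔ A = pow1 := by
  cases A <;> simp [ren]

theorem sub_eq_pow1 {A : Ty} {σ : ℕ → Tm} : A.sub σ = pow1 ↔ A = pow1 := by
  cases A <;> simp [sub]

/-- Precedes the case of substitutions, where each binder weakens the substituted terms. -/
theorem dn_ren {s : Cat} (e : Expr s) (ρ : ℕ → ℕ) : (e.ren ρ).dn = e.dn.ren ρ := by
  induction e generalizing ρ with
  | pi A B hA hB =>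
    by_cases h : B = pow1
    · subst h
      simp only [ren, dn, hA]
      simp only [ren_eq_sub, stabPow_sub]
    · rw [ren, dn_pi h, dn_pi (mt ren_eq_pow1.1 h), ren, hA, hB]
  | lam A B b hA hB hb =>
    by_cases h : B = pow1
    · subst h
      simp only [ren, dn, hA, hb]
      simp only [ren_eq_sub, toStabPow_sub, sub, fromStab_sub, up_var_comp]
    · rw [ren, dn_lam h, dn_lam (mt ren_eq_pow1.1 h), ren, hA, hB, hb]
  | app A B f a hA hB hf ha =>
    by_cases h : B = pow1
    · subst h
      simp only [ren, dn, hA, hf, ha]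
      simp only [ren_eq_sub, toStab_sub, sub, fromStabPow_sub]
    · rw [ren, dn_app h, dn_app (mt ren_eq_pow1.1 h), ren, hA, hB, hf, ha]
  | eq A a b hA ha hb =>
    by_cases h : A = pow1
    · subst h
      simp only [ren, dn, ha, hb]
      simp only [ren_eq_sub, fromStab_sub]
    · rw [ren, dn_eq h, dn_eq (mt ren_eq_pow1.1 h), ren, hA, ha, hb]
  | pow1 => simp only [ren, dn, ren_eq_sub, stabPow1_sub]
  | code P hP => simp only [ren, dn, hP]; simp only [ren_eq_sub, toStab_sub, sub]
  | _ => simp [ren, dn, neg, *]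

theorem dn_comp_up (σ : ℕ → Tm) : (fun i => (up σ i).dn) = up (fun i => (σ i).dn) := by
  funext i
  cases i with
  | zero => rfl
  | succ i => exact dn_ren ..

theorem dn_sub {s : Cat} (e : Expr s) (σ : ℕ → Tm) :
    (e.sub σ).dn = e.dn.sub (fun i => (σ i).dn) := by
  induction e generalizing σ with
  | pi A B hA hB =>
    by_cases h : B = pow1
    · subst h
      simp only [sub, dn, hA, stabPow_sub]
    · rw [sub, dn_pi h, dn_pi (mt sub_eq_pow1.1 h), sub, hA, hB, dn_comp_up]
  | lam A B b hA hB hb =>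
    by_cases h : B = pow1
    · subst h
      simp only [dn, hA, hb, toStabPow_sub, sub, fromStab_sub, dn_comp_up]
    · rw [sub, dn_lam h, dn_lam (mt sub_eq_pow1.1 h), sub, hA, hB, hb, dn_comp_up]
  | app A B f a hA hB hf ha =>
    by_cases h : B = pow1
    · subst h
      simp only [dn, hA, hf, ha, toStab_sub, sub, fromStabPow_sub]
    · rw [sub, dn_app h, dn_app (mt sub_eq_pow1.1 h), sub, hA, hB, hf, ha, dn_comp_up]
  | eq A a b hA ha hb =>
    by_cases h : A = pow1
    · subst h
      simp only [dn, ha, hb, fromStab_sub, sub]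
    · rw [sub, dn_eq h, dn_eq (mt sub_eq_pow1.1 h), sub, hA, ha, hb]
  | pow1 => simp only [sub, dn, stabPow1_sub]
  | code P hP => simp only [dn, hP, toStab_sub, sub]
  | _ => simp only [sub, dn, neg, dn_comp_up, *]

theorem dn_wk {s : Cat} (n : ℕ) (e : Expr s) : (e.wk n).dn = e.dn.wk n := dn_ren ..

theorem dn_wk₁ {s : Cat} (n : ℕ) (e : Expr s) : (e.wk₁ n).dn = e.dn.wk₁ n := dn_ren ..

theorem dn_wk₂ {s : Cat} (n : ℕ) (e : Expr s) : (e.wk₂ n).dn = e.dn.wk₂ n := dn_ren ..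

theorem dn_comp_scons (t : Tm) (σ : ℕ → Tm) :
    (fun i => (scons t σ i).dn) = scons t.dn (fun i => (σ i).dn) := by
  funext i; cases i <;> rfl

theorem dn_inst {s : Cat} (n : ℕ) (e : Expr s) (t : Tm) : (e.inst n t).dn = e.dn.inst n t.dn := by
  simp only [inst, dn_sub, dn_comp_scons, dn]

theorem dn_inst₂ {s : Cat} (n : ℕ) (e : Expr s) (a b : Tm) :
    (e.inst₂ n a b).dn = e.dn.inst₂ n a.dn b.dn := by
  simp only [inst₂, dn_sub, dn_comp_scons, dn]

theorem dn_inst₃ {s : Cat} (e : Expr s) (a b c : Tm) :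
    (e.inst₃ a b c).dn = e.dn.inst₃ a.dn b.dn c.dn := by
  simp only [inst₃, dn_sub, dn_comp_scons, dn]

end Expr

/-! ### Typed substitutions -/

open Judgement _root_.EmTT.Expr

section
variable {T : Theory} {Γ Δ Θ : Ctx} {σ τ : ℕ → Tm} {A A' B B' : Ty} {a b t t' : Tm} {k : Kind}

/-- `Sb T Δ σ Γ`: the substitution `σ` is well-typed from `Δ` to `Γ`. -/
structure Sb (T : Theory) (Δ : Ctx) (σ : ℕ → Tm) (Γ : Ctx) : Prop where
  ctx : Derives T (ctx Δ)
  tm : ∀ i C, Lookup Γ i C → Derives T (isTm Δ (σ i) (C.sub σ))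

/-- Two well-typed substitutions are equal. -/
structure SbEq (T : Theory) (Δ : Ctx) (σ τ : ℕ → Tm) (Γ : Ctx) : Prop where
  left : Sb T Δ σ Γ
  right : Sb T Δ τ Γ
  eq : ∀ i C, Lookup Γ i C → Derives T (eqTm Δ (σ i) (τ i) (C.sub σ))

/-- The context of a judgement. -/
def Judgement.context : Judgement → Ctx
  | .ctx Γ => Γ
  | .isTy Γ _ _ => Γ
  | .eqTy Γ _ _ _ => Γ
  | .isTm Γ _ _ => Γ
  | .eqTm Γ _ _ _ => Γ

/-- Apart from the rules that form contexts, each rule has a premise in the context of its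
conclusion. -/
theorem Derives.ctx_context {J : Judgement} (h : Derives T J) : Derives T (.ctx J.context) := by
  induction h with
  | ctx_nil => exact .ctx_nil
  | ctx_cons h => exact .ctx_cons h
  | _ => assumption

theorem Derives.of_ctx_cons (h : Derives T (.ctx (A :: Γ))) : Derives T (isTy Γ A .col) := by
  cases h; assumption

theorem Derives.col (h : Derives T (isTy Γ A k)) : Derives T (isTy Γ A .col) := by
  cases k
  · exact .incl .set_col (.incl .props_set h)
  · exact .incl .prop_col h
  · exact .incl .set_col h
  · exact h

theorem Derives.eq_col (h : Derives T (eqTy Γ A B k)) : Derives T (eqTy Γ A B .col) := by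
  cases k
  · exact .eq_incl .set_col (.eq_incl .props_set h)
  · exact .eq_incl .prop_col h
  · exact .eq_incl .set_col h
  · exact h

theorem Derives.prop (h : Derives T (isTy Γ A k)) (hk : k.Logical) : Derives T
    (isTy Γ A .prop) := by
  cases hk
  · exact .incl .props_prop h
  · exact h

theorem Derives.ctx_ext (h : Derives T (isTy Γ A k)) : Derives T (.ctx (A :: Γ)) := .ctx_cons h.col

theorem Sb.sub_ty (s : Sb T Δ σ Γ) (h : Derives T (isTy Γ A k)) : Derives T (isTy Δ (A.sub σ) k) :=
  .sub_ty s.ctx s.tm h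

theorem Sb.sub_eqTy (s : Sb T Δ σ Γ) (h : Derives T (eqTy Γ A B k)) :
    Derives T (eqTy Δ (A.sub σ) (B.sub σ) k) :=
  .sub_eqTy s.ctx s.tm h

theorem Sb.sub_tm (s : Sb T Δ σ Γ) (h : Derives T (isTm Γ a A)) :
    Derives T (isTm Δ (a.sub σ) (A.sub σ)) :=
  .sub_tm s.ctx s.tm h

theorem Sb.sub_eqTm (s : Sb T Δ σ Γ) (h : Derives T (eqTm Γ a b A)) :
    Derives T (eqTm Δ (a.sub σ) (b.sub σ) (A.sub σ)) :=
  .sub_eqTm s.ctx s.tm h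

theorem SbEq.repl_ty (s : SbEq T Δ σ τ Γ) (h : Derives T (isTy Γ A k)) :
    Derives T (eqTy Δ (A.sub σ) (A.sub τ) k) :=
  .repl_ty s.left.ctx s.left.tm s.right.tm s.eq h

theorem SbEq.repl_tm (s : SbEq T Δ σ τ Γ) (h : Derives T (isTm Γ a A)) :
    Derives T (eqTm Δ (a.sub σ) (a.sub τ) (A.sub σ)) :=
  .repl_tm s.left.ctx s.left.tm s.right.tm s.eq h

theorem Sb.id (h : Derives T (.ctx Γ)) : Sb T Γ .var Γ :=
  ⟨h, fun i C hi => by simpa using Derives.var h hi⟩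

theorem Sb.comp (s : Sb T Δ σ Γ) (s' : Sb T Θ τ Δ) : Sb T Θ (cmp σ τ) Γ :=
  ⟨s'.ctx, fun i C hi => by simpa using s'.sub_tm (s.tm i C hi)⟩

theorem Sb.shift_one (h : Derives T (.ctx (A :: Γ))) : Sb T (A :: Γ) (shift 1) Γ :=
  ⟨h, fun i C hi => by simpa using Derives.var h (hi.succ A)⟩

theorem Sb.wk (s : Sb T Δ σ Γ) (h : Derives T (.ctx (A :: Δ))) : Sb T (A :: Δ) (cmp σ
    (shift 1)) Γ :=
  s.comp (.shift_one h)

theorem Sb.cons (s : Sb T Δ σ Γ) (h : Derives T (isTm Δ t (A.sub σ))) :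
    Sb T Δ (scons t σ) (A :: Γ) := by
  refine ⟨s.ctx, fun i C hi => ?_⟩
  cases hi with
  | zero => simpa using h
  | succ _ hi => simpa using s.tm _ _ hi

theorem Derives.ty_ctx (h : Derives T (isTy Γ A k)) : Derives T (.ctx Γ) := h.ctx_context

theorem Derives.tm_ctx (h : Derives T (isTm Γ a A)) : Derives T (.ctx Γ) := h.ctx_context

theorem Derives.var_zero (h : Derives T (.ctx (A :: Γ))) : Derives T (isTm (A :: Γ) (.var 0)
    (A.wk 1)) :=
  .var h (.zero _ _)

/-- Extension of a substitution under a binder whose type is changed to an equal one. -/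
theorem Sb.up_conv (s : Sb T Δ σ Γ) (h : Derives T (.ctx (A' :: Δ)))
    (e : Derives T (eqTy Δ A' (A.sub σ) .col)) : Sb T (A' :: Δ) (up σ) (A :: Γ) := by
  rw [up_eq]
  refine (s.wk h).cons ?_
  have := (Sb.shift_one h).sub_eqTy e
  simp at this
  exact .conv (by simpa using Derives.var_zero h) this

theorem Sb.up (s : Sb T Δ σ Γ) (h : Derives T (isTy Γ A k)) :
    Sb T (A.sub σ :: Δ) (EmTT.up σ) (A :: Γ) :=
  s.up_conv (s.sub_ty h).ctx_ext (.ty_refl (s.sub_ty h).col)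

theorem SbEq.refl (s : Sb T Δ σ Γ) : SbEq T Δ σ σ Γ := ⟨s, s, fun i C hi => .tm_refl (s.tm i C hi)⟩

theorem SbEq.cons (s : SbEq T Δ σ τ Γ) (h : Derives T (isTm Δ t (A.sub σ)))
    (h' : Derives T (isTm Δ t' (A.sub τ))) (e : Derives T (eqTm Δ t t' (A.sub σ))) :
    SbEq T Δ (scons t σ) (scons t' τ) (A :: Γ) := by
  refine ⟨s.left.cons h, s.right.cons h', fun i C hi => ?_⟩
  cases hi with
  | zero => simpa using e
  | succ _ hi => simpa using s.eq _ _ hi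

theorem Sb.single (h : Derives T (isTm Γ t A)) : Sb T Γ (scons t .var) (A :: Γ) :=
  (Sb.id h.tm_ctx).cons (by simpa using h)

/-- A context whose last type is changed to an equal one. -/
theorem Sb.conv_last (h : Derives T (isTy Γ A' .col)) (e : Derives T (eqTy Γ A' A .col)) :
    Sb T (A' :: Γ) .var (A :: Γ) := by
  have := Sb.up_conv (A := A) (Sb.id h.ty_ctx) (.ctx_cons h) (by simpa using e)
  rwa [up_var] at this

/-- Context conversion is not a primitive rule. It is substitution along the identity, which stays
well typed when the two contexts are extended by equal types; iterating this changes several types.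
-/
theorem Sb.conv_cons (s : Sb T Δ .var Γ) (h : Derives T (isTy Δ A' .col))
    (e : Derives T (eqTy Δ A' A .col)) : Sb T (A' :: Δ) .var (A :: Γ) := by
  have := Sb.up_conv (A := A) s (.ctx_cons h) (by simpa using e)
  rwa [up_var] at this

theorem Sb.ty (s : Sb T Δ .var Γ) (h : Derives T (isTy Γ A k)) : Derives T (isTy Δ A k) := by
  simpa using s.sub_ty h

theorem Sb.eqTy (s : Sb T Δ .var Γ) (h : Derives T (.eqTy Γ A B k)) : Derives T
    (.eqTy Δ A B k) := by
  simpa using s.sub_eqTy h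

theorem Sb.isTm (s : Sb T Δ .var Γ) (h : Derives T (.isTm Γ a A)) : Derives T (.isTm Δ a A) := by
  simpa using s.sub_tm h

theorem Sb.eqTm (s : Sb T Δ .var Γ) (h : Derives T (.eqTm Γ a b A)) : Derives T
    (.eqTm Δ a b A) := by
  simpa using s.sub_eqTm h

/-- Motive and argument change together, as they do between the two sides of a congruence rule for
an eliminator. -/
theorem Sb.sub_scons_eq {M M' : Ty} (s : Sb T Δ σ Γ) (hM : Derives T (.eqTy (A :: Γ) M M' k))
    (hM' : Derives T (.isTy (A :: Γ) M' k)) (h : Derives T (.isTm Δ t (A.sub σ)))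
    (h' : Derives T (.isTm Δ t' (A.sub σ))) (e : Derives T (.eqTm Δ t t' (A.sub σ))) :
    Derives T (.eqTy Δ (M.sub (scons t σ)) (M'.sub (scons t' σ)) k) :=
  .ty_trans ((s.cons h).sub_eqTy hM) (((SbEq.refl s).cons h h' e).repl_ty hM')

theorem Derives.lookup {i : ℕ} (h : Derives T (.ctx Γ)) (hi : Lookup Γ i A) :
    Derives T (isTy Γ A .col) := by
  induction hi with
  | zero => simpa using (Sb.shift_one h).sub_ty h.of_ctx_cons
  | succ B _ ih => simpa using (Sb.shift_one h).sub_ty (ih h.of_ctx_cons.ty_ctx)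

/-! ### Inversion of formation -/

/-- What the formation of a type amounts to. -/
def TyInv (T : Theory) (Γ : Ctx) : Ty → Prop
  | sigma A B => Derives T (isTy Γ A .col) ∧ Derives T (isTy (A :: Γ) B .col)
  | list A => Derives T (isTy Γ A .set)
  | sum A B => Derives T (isTy Γ A .set) ∧ Derives T (isTy Γ B .set)
  | quot A R => Derives T (isTy Γ A .set) ∧ Derives T (isTy (A.wk 1 :: A :: Γ) R .props)
  | pi A B => Derives T (isTy Γ A .set) ∧ ∃ k, PiCod B k ∧ Derives T (isTy (A :: Γ) B k)
  | conj P Q => Derives T (isTy Γ P .prop) ∧ Derives T (isTy Γ Q .prop)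
  | disj P Q => Derives T (isTy Γ P .prop) ∧ Derives T (isTy Γ Q .prop)
  | imp P Q => Derives T (isTy Γ P .prop) ∧ Derives T (isTy Γ Q .prop)
  | all A P => Derives T (isTy Γ A .col) ∧ Derives T (isTy (A :: Γ) P .prop)
  | ex A P => Derives T (isTy Γ A .col) ∧ Derives T (isTy (A :: Γ) P .prop)
  | eq A a b => Derives T (isTy Γ A .col) ∧ Derives T (isTm Γ a A) ∧ Derives T (isTm Γ b A)
  | _ => True

theorem PiCod.sub (h : PiCod B k) (σ : ℕ → Tm) : PiCod (B.sub σ) k := by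
  cases h
  · exact .set _
  · exact .pow1

theorem TyInv.sub (s : Sb T Δ σ Γ) (h : TyInv T Γ A) : TyInv T Δ (A.sub σ) := by
  cases A with
  | sigma A B => exact ⟨s.sub_ty h.1, (s.up h.1).sub_ty h.2⟩
  | list A => exact s.sub_ty (A := A) h
  | sum A B => exact ⟨s.sub_ty h.1, s.sub_ty h.2⟩
  | quot A R =>
    have h1 := (Sb.shift_one h.1.ctx_ext).sub_ty h.1
    have := ((s.up h.1).up h1).sub_ty (by simpa using h.2)
    exact ⟨s.sub_ty h.1, by simpa using this⟩
  | pi A B =>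
    obtain ⟨h, k, hk, h'⟩ := h
    exact ⟨s.sub_ty h, k, hk.sub _, (s.up h).sub_ty h'⟩
  | conj P Q => exact ⟨s.sub_ty h.1, s.sub_ty h.2⟩
  | disj P Q => exact ⟨s.sub_ty h.1, s.sub_ty h.2⟩
  | imp P Q => exact ⟨s.sub_ty h.1, s.sub_ty h.2⟩
  | all A P => exact ⟨s.sub_ty h.1, (s.up h.1).sub_ty h.2⟩
  | ex A P => exact ⟨s.sub_ty h.1, (s.up h.1).sub_ty h.2⟩
  | eq A a b => exact ⟨s.sub_ty h.1, s.sub_tm h.2.1, s.sub_tm h.2.2⟩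
  | _ => trivial

theorem Kind.Incl.eq_col {k k' : Kind} (h : Kind.Incl k k') (e : k = .col) : k' = .col := by
  cases h <;> cases e

theorem Kind.Quant.logical {k k' : Kind} (h : Kind.Quant k k') : k'.Logical := by
  cases h <;> constructor

/-- The inversion property of a judgement. -/
def Judgement.Inv (T : Theory) : Judgement → Prop
  | .isTy Γ A k => TyInv T Γ A ∧ (A = pow1 → k = .col)
  | .eqTy _ A B _ => A = pow1 ↔ B = pow1
  | .isTm Γ (.var i) _ => ∃ C, Lookup Γ i C
  | .isTm Γ (.triv P) _ => Derives T (.isTy Γ P .prop)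
  | _ => True

/-- The last rule of a derivation may be a substitution or an inclusion of kinds, so inversion is an
induction resting on `TyInv.sub`. The same induction shows that `pow1` is equal only to itself and
is never a set, which the special clauses of the translation require. -/
theorem Derives.inv {J : Judgement} (h : Derives T J) : J.Inv T := by
  induction h with
  | var _ h => exact ⟨_, h⟩
  | incl hk h ih => exact ⟨ih.1, fun e => hk.eq_col (ih.2 e)⟩
  | eq_incl _ _ ih => exact ih
  | ty_refl => exact Iff.rfl
  | ty_symm _ ih => exact ih.symm
  | ty_trans _ _ ih ih' => exact ih.trans ih'
  | @conv _ a _ _ _ _ ih _ => cases a <;> exact ih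
  | sub_ty hΔ hσ _ _ _ ih => exact ⟨ih.1.sub ⟨hΔ, hσ⟩, fun e => ih.2 (sub_eq_pow1.1 e)⟩
  | sub_eqTy hΔ hσ _ _ _ ih => simpa only [Judgement.Inv, sub_eq_pow1] using ih
  | @sub_tm _ _ a _ σ hΔ hσ h ihΔ ihσ ih =>
    cases a with
    | triv P => exact Sb.sub_ty ⟨hΔ, hσ⟩ ih
    -- Substitution may turn a variable into a `triv`, so the induction hypothesis for the term
    -- replacing it is needed. It is available because the variable is known to be declared.
    | var i =>
      obtain ⟨C, hC⟩ := ih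
      have := ihσ i C hC
      rw [Expr.sub]
      revert this
      cases σ i <;> exact _root_.id
    | _ => trivial
  | repl_ty => simp only [Judgement.Inv, sub_eq_pow1]
  | sigma_form hk hA hB => exact ⟨⟨hA.col, hB.col⟩, nofun⟩
  | pi_form hk hA hB => exact ⟨⟨hA, _, hk, hB⟩, nofun⟩
  | list_form hA => exact ⟨hA, nofun⟩
  | sum_form hA hB => exact ⟨⟨hA, hB⟩, nofun⟩
  | quot_form hA hR => exact ⟨⟨hA, hR⟩, nofun⟩
  | pow1_form => exact ⟨trivial, fun _ => rfl⟩
  | conj_form hk hP hQ => exact ⟨⟨hP.prop hk, hQ.prop hk⟩, nofun⟩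
  | disj_form hk hP hQ => exact ⟨⟨hP.prop hk, hQ.prop hk⟩, nofun⟩
  | imp_form hk hP hQ => exact ⟨⟨hP.prop hk, hQ.prop hk⟩, nofun⟩
  | all_form hk hA hP => exact ⟨⟨hA.col, hP.prop hk.logical⟩, nofun⟩
  | ex_form hk hA hP => exact ⟨⟨hA.col, hP.prop hk.logical⟩, nofun⟩
  | eq_form _ hA ha hb => exact ⟨⟨hA.col, ha, hb⟩, nofun⟩
  | n0_form | n1_form | falsum_form => exact ⟨trivial, nofun⟩
  | prop_true hP | falsum_elim hP => exact hP
  | conj_intro hP hQ => exact .conj_form .large hP hQ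
  | disj_left hP hQ | disj_right hP hQ => exact .disj_form .large hP hQ
  | conj_left hP hQ => exact hP
  | conj_right hP hQ => exact hQ
  | disj_elim _ _ hC => exact hC
  | imp_intro hP hQ => exact .imp_form .large hP hQ
  | imp_elim _ hQ => exact hQ
  | all_intro hA hP => exact .all_form .large hA hP
  | all_elim hA hP _ ha => simpa [Judgement.Inv] using (Sb.single ha).sub_ty hP
  | ex_intro hA hP => exact .ex_form .large hA hP
  | ex_elim _ _ hC => exact hC
  | eq_intro hA ha => exact .eq_form (.col _) hA ha ha
  | lem _ hP => exact .disj_form .large hP (.imp_form .large hP (.incl .props_prop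
    (.falsum_form hP.ty_ctx)))
  | pow1_eff hP hQ =>
    have hP := Derives.prop hP .small
    have hQ := Derives.prop hQ .small
    exact .conj_form .large (.imp_form .large hP hQ) (.imp_form .large hQ hP)
  | @quot_eff _ A _ _ b hQ ha hb _ ihQ =>
    have hR := Derives.prop ihQ.1.2 .small
    have := ((Sb.single ha).cons (A := A.wk 1) (t := b) (by simpa using hb)).sub_ty hR
    simpa [Judgement.Inv] using this
  | _ => first | trivial | exact ⟨nofun, nofun⟩

theorem Derives.imp_inv {P Q : Ty} (h : Derives T (isTy Γ (imp P Q) k)) :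
    Derives T (isTy Γ P .prop) ∧ Derives T (isTy Γ Q .prop) := h.inv.1

theorem Derives.prop_of_holds {P : Ty} (h : Derives T (holds Γ P)) : Derives T (isTy Γ P .prop) :=
  h.inv

end

section
variable {T : Theory} {Γ Δ Θ : Ctx} {σ τ : ℕ → Tm} {A A' B B' : Ty} {a b t t' : Tm} {k : Kind}

/-! ### Presuppositions -/

/-- The presuppositions of a judgement, its context excepted. -/
def Judgement.Presup (T : Theory) : Judgement → Prop
  | .ctx _ => True
  | .isTy _ _ _ => True
  | .eqTy Γ A B k => Derives T (.isTy Γ A k) ∧ Derives T (.isTy Γ B k)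
  | .isTm Γ _ A => Derives T (.isTy Γ A .col)
  | .eqTm Γ a b A => Derives T (.isTm Γ a A) ∧ Derives T (.isTm Γ b A) ∧ Derives T (.isTy Γ A .col)

theorem Derives.inst_ty {M : Ty} (hM : Derives T (isTy (A :: Γ) M k)) (h : Derives T (isTm Γ t A)) :
    Derives T (isTy Γ (M.inst 0 t) k) := by
  simpa using (Sb.single h).sub_ty hM

theorem Derives.inst_eqTy {M M' : Ty} (hM : Derives T (eqTy (A :: Γ) M M' k))
    (hM' : Derives T (isTy (A :: Γ) M' k)) (h : Derives T (isTm Γ t A)) (h' : Derives T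
      (isTm Γ t' A))
    (e : Derives T (eqTm Γ t t' A)) : Derives T (eqTy Γ (M.inst 0 t) (M'.inst 0 t') k) := by
  simpa using (Sb.id h.tm_ctx).sub_scons_eq hM hM' (t := t) (t' := t') (by simpa using h)
    (by simpa using h') (by simpa using e)

/-- Terms carry type annotations, so the right-hand side of a congruence rule has the primed
annotations but must inhabit the unprimed type. -/
theorem Derives.pair_conv (hA : Derives T (isTy Γ A .col)) (hA' : Derives T (isTy Γ A' .col))
    (eA : Derives T (eqTy Γ A A' .col)) (hB : Derives T (isTy (A :: Γ) B .col))
    (hB' : Derives T (isTy (A :: Γ) B' .col)) (eB : Derives T (eqTy (A :: Γ) B B' .col))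
    (ha : Derives T (isTm Γ a A)) (hb : Derives T (isTm Γ b (B.inst 0 a))) :
    Derives T (isTm Γ (pair A' B' a b) (sigma A B)) :=
  .conv (.sigma_intro hA' ((Sb.conv_last hA' (.ty_symm eA)).ty hB') (.conv ha eA)
    (.conv hb (eB.inst_eqTy hB' ha ha (.tm_refl ha)))) (.ty_symm (.sigma_form_eq .col hA eA hB eB))

theorem Sb.shift_two (hB : Derives T (isTy (A :: Γ) B k)) : Sb T (B :: A :: Γ) (shift 2) Γ := by
  simpa using (Sb.shift_one hB.ty_ctx).wk hB.ctx_ext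

theorem Sb.shift_three {C : Ty} (hC : Derives T (isTy (B :: A :: Γ) C k)) :
    Sb T (C :: B :: A :: Γ) (shift 3) Γ := by
  simpa using (Sb.shift_two hC.ty_ctx.of_ctx_cons).wk hC.ctx_ext

theorem Derives.var_one (hB : Derives T (isTy (A :: Γ) B k)) :
    Derives T (isTm (B :: A :: Γ) (.var 1) (A.wk 2)) := by
  simpa using (Sb.shift_one hB.ctx_ext).sub_tm (Derives.var_zero hB.ty_ctx)

theorem Derives.var_two {C : Ty} (hC : Derives T (isTy (B :: A :: Γ) C k)) :
    Derives T (isTm (C :: B :: A :: Γ) (.var 2) (A.wk 3)) := by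
  simpa using (Sb.shift_one hC.ctx_ext).sub_tm (Derives.var_one hC.ty_ctx.of_ctx_cons)

theorem PiCod.of_eqTy (h : PiCod B k) (e : Derives T (eqTy Γ B B' k)) : PiCod B' k := by
  cases h
  · exact .set _
  · rw [e.inv.1 rfl]
    exact .pow1

theorem Derives.cons_conv {s : Tm} (hA' : Derives T (isTy Γ A' .set))
    (eA : Derives T (eqTy Γ A A' .set)) (hs : Derives T (isTm Γ s (list A)))
    (ha : Derives T (isTm Γ a A)) : Derives T (isTm Γ (cons A' s a) (list A)) :=
  have eL := (Derives.list_form_eq eA).eq_col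
  .conv (.list_cons hA' (.conv hs eL) (.conv ha eA.eq_col)) (.ty_symm eL)

theorem Derives.inl_conv (hA' : Derives T (isTy Γ A' .set)) (hB' : Derives T (isTy Γ B' .set))
    (eA : Derives T (eqTy Γ A A' .set)) (eB : Derives T (eqTy Γ B B' .set))
    (ha : Derives T (isTm Γ a A)) : Derives T (isTm Γ (inl A' B' a) (sum A B)) :=
  .conv (.sum_inl hA' hB' (.conv ha eA.eq_col)) (.ty_symm (Derives.sum_form_eq eA eB).eq_col)

theorem Derives.inr_conv (hA' : Derives T (isTy Γ A' .set)) (hB' : Derives T (isTy Γ B' .set))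
    (eA : Derives T (eqTy Γ A A' .set)) (eB : Derives T (eqTy Γ B B' .set))
    (hb : Derives T (isTm Γ b B)) : Derives T (isTm Γ (inr A' B' b) (sum A B)) :=
  .conv (.sum_inr hA' hB' (.conv hb eB.eq_col)) (.ty_symm (Derives.sum_form_eq eA eB).eq_col)

theorem Derives.cls_conv {R R' : Ty} (eA : Derives T (eqTy Γ A A' .set))
    (eR : Derives T (eqTy (A.wk 1 :: A :: Γ) R R' .props)) (hQ : Derives T (isTy Γ (quot A R) .set))
    (hQ' : Derives T (isTy Γ (quot A' R') .set)) (ha : Derives T (isTm Γ a A)) :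
    Derives T (isTm Γ (cls A' R' a) (quot A R)) :=
  .conv (.quot_intro hQ' (.conv ha eA.eq_col)) (.ty_symm (Derives.quot_form_eq eA eR hQ hQ').eq_col)

theorem EqDom.of_eqTy {k' : Kind} (h : EqDom k A k') (e : Derives T (eqTy Γ A A' k)) :
    EqDom k A' k' := by
  cases h
  · exact .set _
  · exact .col _
  · rw [e.inv.1 rfl]
    exact .pow1

theorem Derives.dc (h : Derives T (isTm Γ a pow1)) : Derives T (isTy Γ (Expr.dc a) .props) :=
  have hF := Derives.falsum_form h.tm_ctx
  .eq_form .pow1 (.pow1_form h.tm_ctx) h (.pow1_intro (.imp_form .small hF hF))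

/-- The work is in the congruence rules of the eliminators. The right-hand branches are known over
the unprimed context and motive, and must be moved to the primed ones before the elimination rule
applies; the result is then converted back. -/
theorem Derives.presup {J : Judgement} (h : Derives T J) : J.Presup T := by
  induction h with
  | ctx_nil | ctx_cons | incl | sub_ty => trivial
  | n0_form | n1_form | sigma_form | pi_form | list_form | sum_form | quot_form | pow1_form =>
    trivial
  | falsum_form | conj_form | disj_form | imp_form | all_form | ex_form | eq_form => trivial
  | var h hi => exact h.lookup hi
  | eq_incl hk _ ih => exact ⟨.incl hk ih.1, .incl hk ih.2⟩
  | ty_refl h => exact ⟨h, h⟩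
  | ty_symm _ ih => exact ⟨ih.2, ih.1⟩
  | ty_trans _ _ ih ih' => exact ⟨ih.1, ih'.2⟩
  | tm_refl h ih => exact ⟨h, h, ih⟩
  | tm_symm _ ih => exact ⟨ih.2.1, ih.1, ih.2.2⟩
  | tm_trans _ _ ih ih' => exact ⟨ih.1, ih'.2.1, ih.2.2⟩
  | conv _ _ _ ih => exact ih.2
  | eq_conv _ e ih ih' => exact ⟨.conv ih.1 e, .conv ih.2.1 e, ih'.2⟩
  | sub_eqTy hΔ hσ _ _ _ ih => exact ⟨Sb.sub_ty ⟨hΔ, hσ⟩ ih.1, Sb.sub_ty ⟨hΔ, hσ⟩ ih.2⟩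
  | sub_tm hΔ hσ _ _ _ ih => exact Sb.sub_ty ⟨hΔ, hσ⟩ ih
  | sub_eqTm hΔ hσ _ _ _ ih =>
    exact ⟨Sb.sub_tm ⟨hΔ, hσ⟩ ih.1, Sb.sub_tm ⟨hΔ, hσ⟩ ih.2.1, Sb.sub_ty ⟨hΔ, hσ⟩ ih.2.2⟩
  | repl_ty hΔ hσ hτ _ h => exact ⟨Sb.sub_ty ⟨hΔ, hσ⟩ h, Sb.sub_ty ⟨hΔ, hτ⟩ h⟩
  | repl_tm hΔ hσ hτ e h _ _ _ _ ih =>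
    exact ⟨Sb.sub_tm ⟨hΔ, hσ⟩ h,
      .conv (Sb.sub_tm ⟨hΔ, hτ⟩ h) (.ty_symm (SbEq.repl_ty ⟨⟨hΔ, hσ⟩, ⟨hΔ, hτ⟩, e⟩ ih)),
      Sb.sub_ty ⟨hΔ, hσ⟩ ih⟩
  | n0_elim hM hc => exact hM.inst_ty hc
  | n0_elim_eq hM hc ihM ihc =>
    exact ⟨.n0_elim ihM.1 ihc.1,
      .conv (.n0_elim ihM.2 ihc.2.1) (.ty_symm (hM.inst_eqTy ihM.2 ihc.1 ihc.2.1 hc)),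
      ihM.1.inst_ty ihc.1⟩
  | n1_intro h => exact (Derives.n1_form h).col
  | n1_elim hM ht => exact hM.inst_ty ht
  | n1_elim_eq hM ht hc ihM iht ihc =>
    have hs := Derives.n1_intro (T := T) iht.1.tm_ctx
    exact ⟨.n1_elim ihM.1 iht.1 ihc.1,
      .conv (.n1_elim ihM.2 iht.2.1 (.conv ihc.2.1 (hM.inst_eqTy ihM.2 hs hs (.tm_refl hs))))
        (.ty_symm (hM.inst_eqTy ihM.2 iht.1 iht.2.1 ht)),
      ihM.1.inst_ty iht.1⟩
  | n1_comp hM hc ihM ihc => exact ⟨.n1_elim hM (.n1_intro hc.tm_ctx) hc, hc, ihc⟩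
  | sigma_form_eq hk hA eA hB eB _ ihA _ ihB =>
    exact ⟨.sigma_form hk hA hB, .sigma_form hk ihA.2
      ((Sb.conv_last ihA.2.col (.ty_symm eA.eq_col)).ty ihB.2)⟩
  | sigma_intro hA hB => exact .sigma_form .col hA hB
  | sigma_intro_eq hA eA hB eB ea eb _ ihA _ ihB iha ihb =>
    refine ⟨.sigma_intro hA hB iha.1 ihb.1, .pair_conv hA ihA.2 eA hB ihB.2 eB iha.2.1
      (.conv ihb.2.1 ((Derives.ty_refl hB).inst_eqTy hB iha.1 iha.2.1 ea)), .sigma_form .col hA hB⟩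
  | sigma_elim hA hB hM hd => exact hM.inst_ty hd
  | @sigma_elim_eq Γ A A' B B' M M' d d' m m' hA eA hB eB hM eM ed em _ ihA _ ihB _ ihM ihd ihm =>
    have eS := Derives.sigma_form_eq .col hA eA hB eB
    have hB' := (Sb.conv_last ihA.2 (.ty_symm eA)).ty ihB.2
    have eB' := (Sb.conv_last ihA.2 (.ty_symm eA)).eqTy (.ty_symm eB)
    have hS' := Derives.sigma_form .col ihA.2 hB'
    -- `s` changes the context of the branch to the primed one; `e` below changes its type, from `M`
    -- at the generic pair to `M'` at the generic pair with primed annotations.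
    have s := (Sb.conv_last ihA.2 (.ty_symm eA)).conv_cons hB' eB'
    have w := Sb.shift_two hB
    have h1 := Derives.var_one hB
    have h0 := Derives.var_zero hB.ctx_ext
    have p := Derives.sigma_intro_eq (a := .var 1) (b := .var 0) (w.sub_ty hA) (w.sub_eqTy eA)
      ((w.up hA).sub_ty hB) ((w.up hA).sub_eqTy eB) (by simpa using Derives.tm_refl h1)
      (by simpa using Derives.tm_refl h0)
    have p1 := Derives.sigma_intro (a := .var 1) (b := .var 0) (w.sub_ty hA)
      ((w.up hA).sub_ty hB) (by simpa using h1) (by simpa using h0)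
    have p2 := Derives.pair_conv (a := .var 1) (b := .var 0) (w.sub_ty hA) (w.sub_ty ihA.2)
      (w.sub_eqTy eA) ((w.up hA).sub_ty hB) ((w.up hA).sub_ty ihB.2) ((w.up hA).sub_eqTy eB)
      (by simpa using h1) (by simpa using h0)
    have e := w.sub_scons_eq eM ihM.2 p1 p2 p
    have m1 := s.isTm (Derives.conv ihm.2.1 (by simpa using e))
    refine ⟨.sigma_elim hA hB hM ihd.1 ihm.1, .conv (.sigma_elim ihA.2 hB'
      ((Sb.conv_last hS' (.ty_symm eS)).ty ihM.2) (.conv ihd.2.1 eS) (by simpa using m1))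
      (.ty_symm (eM.inst_eqTy ihM.2 ihd.1 ihd.2.1 ed)), hM.inst_ty ihd.1⟩
  | @sigma_comp Γ A B M a b m hA hB hM ha hb hm =>
    have hp := Derives.sigma_intro hA hB ha hb
    have := ((Sb.single ha).cons (t := b) (by simpa using hb)).sub_tm hm
    exact ⟨.sigma_elim hA hB hM hp hm, by simpa using this, hM.inst_ty hp⟩
  | pi_form_eq hk hA eA hB eB _ ihA _ ihB =>
    exact ⟨.pi_form hk hA hB, .pi_form (hk.of_eqTy eB) ihA.2
      ((Sb.conv_last ihA.2.col (.ty_symm eA.eq_col)).ty ihB.2)⟩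
  | pi_intro hk hA hB hb => exact (Derives.pi_form hk hA hB).col
  | pi_intro_eq hk hA eA hB eB eb _ ihA _ ihB ihb =>
    have s := Sb.conv_last ihA.2.col (.ty_symm eA.eq_col)
    exact ⟨.pi_intro hk hA hB ihb.1, .conv (.pi_intro (hk.of_eqTy eB) ihA.2 (s.ty ihB.2)
      (s.isTm (.conv ihb.2.1 eB.eq_col))) (.ty_symm (Derives.pi_form_eq hk hA eA hB eB).eq_col),
      (Derives.pi_form hk hA hB).col⟩
  | pi_elim hk hA hB hf ha => exact (hB.inst_ty ha).col
  | pi_elim_eq hk hA eA hB eB ef ea _ ihA _ ihB ihf iha =>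
    have s := Sb.conv_last ihA.2.col (.ty_symm eA.eq_col)
    exact ⟨.pi_elim hk hA hB ihf.1 iha.1, .conv (.pi_elim (hk.of_eqTy eB) ihA.2 (s.ty ihB.2)
      (.conv ihf.2.1 (Derives.pi_form_eq hk hA eA hB eB).eq_col) (.conv iha.2.1 eA.eq_col))
      (.ty_symm (eB.inst_eqTy ihB.2 iha.1 iha.2.1 ea).eq_col), (hB.inst_ty iha.1).col⟩
  | pi_beta hk hA hB hb ha =>
    exact ⟨.pi_elim hk hA hB (.pi_intro hk hA hB hb) ha, by simpa using (Sb.single ha).sub_tm hb,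
      (hB.inst_ty ha).col⟩
  | @pi_eta Γ A B k f hk hA hB hf _ _ ihf =>
    have w := Sb.shift_one hA.ctx_ext
    have := Derives.pi_elim (hk.sub _) (w.sub_ty hA) ((w.up hA).sub_ty hB)
      (f := f.sub (shift 1)) (by simpa using w.sub_tm hf)
      (by simpa using Derives.var_zero hA.ctx_ext)
    exact ⟨.pi_intro hk hA hB (by simpa using this), hf, (Derives.pi_form hk hA hB).col⟩
  | list_form_eq _ ih => exact ⟨.list_form ih.1, .list_form ih.2⟩
  | list_nil hA => exact (Derives.list_form hA).col
  | list_nil_eq eA ih =>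
    exact ⟨.list_nil ih.1, .conv (.list_nil ih.2) (.ty_symm (Derives.list_form_eq eA).eq_col),
      (Derives.list_form ih.1).col⟩
  | list_cons hA => exact (Derives.list_form hA).col
  | list_cons_eq eA es ea ihA ihs iha =>
    exact ⟨.list_cons ihA.1 ihs.1 iha.1, .cons_conv ihA.2 eA ihs.2.1 iha.2.1,
      (Derives.list_form ihA.1).col⟩
  | list_elim hA hM hs => exact hM.inst_ty hs
  | @list_elim_eq Γ A A' M M' s s' b b' l l' hA eA hM eM es eb el _ ihA _ ihM ihs ihb ihl =>
    have eL := (Derives.list_form_eq eA).eq_col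
    have hL' := Derives.list_form ihA.2
    have hL := Derives.list_form hA
    have s0 := Sb.conv_last hL'.col (.ty_symm eL)
    have hwA : Derives T (.isTy (list A :: Γ) (A.wk 1) .set) := by
      simpa using (Sb.shift_one hL.ctx_ext).sub_ty hA
    have s1 : Sb T (A'.wk 1 :: list A' :: Γ) .var (A.wk 1 :: list A :: Γ) :=
      s0.conv_cons (by simpa using ((Sb.shift_one hL'.ctx_ext).sub_ty ihA.2).col)
        (by simpa using (Sb.shift_one hL'.ctx_ext).sub_eqTy (Derives.ty_symm eA).eq_col)
    have w := Sb.shift_two hwA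
    have v := Derives.var_one hwA
    have w1 := w.cons (A := list A) (t := .var 1) (by simpa using v)
    -- Context conversion for all three variables of the branch, the last being the recursive value.
    have s2 := s1.conv_cons (s1.ty (w1.sub_ty ihM.2)) (s1.eqTy (.ty_symm (w1.sub_eqTy eM)))
    have hM2 : Derives T (.isTy (A.wk 1 :: list A :: Γ) (M.inst 2 (.var 1)) .col) := w1.sub_ty hM
    have w3 := Sb.shift_three hM2
    have v2 := Derives.var_two hM2
    have v1 := Derives.var_one hM2
    have c1 := Derives.list_cons (s := .var 2) (a := .var 1) (w3.sub_ty hA) (by simpa using v2)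
      (by simpa using v1)
    have c2 := Derives.cons_conv (s := .var 2) (a := .var 1) (w3.sub_ty ihA.2)
      (w3.sub_eqTy eA) (by simpa using v2) (by simpa using v1)
    have c := Derives.list_cons_eq (s := .var 2) (a := .var 1) (w3.sub_eqTy eA)
      (by simpa using Derives.tm_refl v2) (by simpa using Derives.tm_refl v1)
    have e := w3.sub_scons_eq eM ihM.2 c1 c2 c
    have l1 := s2.isTm (Derives.conv ihl.2.1 (by simpa using e))
    have n1 := Derives.list_nil hA
    have n2 := Derives.conv (Derives.list_nil ihA.2) (.ty_symm eL)
    exact ⟨.list_elim hA hM ihs.1 ihb.1 ihl.1, .conv (.list_elim ihA.2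
      ((Sb.conv_last hL'.col (.ty_symm eL)).ty ihM.2) (.conv ihs.2.1 eL)
      (.conv ihb.2.1 (eM.inst_eqTy ihM.2 n1 n2 (.list_nil_eq eA))) (by simpa using l1))
      (.ty_symm (eM.inst_eqTy ihM.2 ihs.1 ihs.2.1 es)), hM.inst_ty ihs.1⟩
  | list_comp_nil hA hM hb hl =>
    exact ⟨.list_elim hA hM (.list_nil hA) hb hl, hb, hM.inst_ty (.list_nil hA)⟩
  | @list_comp_cons Γ A M s a b l hA hM hs ha hb hl =>
    have hc := Derives.list_cons hA hs ha
    have := (((Sb.single hs).cons (t := a) (by simpa using ha)).cons (t := elList A M s b l)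
      (by simpa using Derives.list_elim hA hM hs hb hl)).sub_tm hl
    exact ⟨.list_elim hA hM hc hb hl, by simpa using this, hM.inst_ty hc⟩
  | sum_form_eq _ _ ihA ihB => exact ⟨.sum_form ihA.1 ihB.1, .sum_form ihA.2 ihB.2⟩
  | sum_inl hA hB => exact (Derives.sum_form hA hB).col
  | sum_inr hA hB => exact (Derives.sum_form hA hB).col
  | sum_inl_eq eA eB ea ihA ihB iha =>
    exact ⟨.sum_inl ihA.1 ihB.1 iha.1, .inl_conv ihA.2 ihB.2 eA eB iha.2.1,
      (Derives.sum_form ihA.1 ihB.1).col⟩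
  | sum_inr_eq eA eB eb ihA ihB ihb =>
    exact ⟨.sum_inr ihA.1 ihB.1 ihb.1, .inr_conv ihA.2 ihB.2 eA eB ihb.2.1,
      (Derives.sum_form ihA.1 ihB.1).col⟩
  | sum_elim hA hB hM hd => exact hM.inst_ty hd
  | sum_elim_eq hA eA hB eB hM eM ed el er _ ihA _ ihB _ ihM ihd ihl ihr =>
    have eS := (Derives.sum_form_eq eA eB).eq_col
    have hS' := Derives.sum_form ihA.2 ihB.2
    have wA := Sb.shift_one hA.ctx_ext
    have wB := Sb.shift_one hB.ctx_ext
    have vA := Derives.var_zero hA.ctx_ext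
    have vB := Derives.var_zero hB.ctx_ext
    have e1 := wA.sub_scons_eq eM ihM.2
      (.sum_inl (a := .var 0) (wA.sub_ty hA) (wA.sub_ty hB) (by simpa using vA))
      (.inl_conv (a := .var 0) (wA.sub_ty ihA.2) (wA.sub_ty ihB.2) (wA.sub_eqTy eA) (wA.sub_eqTy eB)
        (by simpa using vA))
      (.sum_inl_eq (wA.sub_eqTy eA) (wA.sub_eqTy eB) (by simpa using Derives.tm_refl vA))
    have e2 := wB.sub_scons_eq eM ihM.2
      (.sum_inr (b := .var 0) (wB.sub_ty hA) (wB.sub_ty hB) (by simpa using vB))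
      (.inr_conv (b := .var 0) (wB.sub_ty ihA.2) (wB.sub_ty ihB.2) (wB.sub_eqTy eA) (wB.sub_eqTy eB)
        (by simpa using vB))
      (.sum_inr_eq (wB.sub_eqTy eA) (wB.sub_eqTy eB) (by simpa using Derives.tm_refl vB))
    have l1 := (Sb.conv_last ihA.2.col (.ty_symm eA.eq_col)).isTm
      (Derives.conv ihl.2.1 (by simpa using e1))
    have r1 := (Sb.conv_last ihB.2.col (.ty_symm eB.eq_col)).isTm
      (Derives.conv ihr.2.1 (by simpa using e2))
    exact ⟨.sum_elim hA hB hM ihd.1 ihl.1 ihr.1, .conv (.sum_elim ihA.2 ihB.2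
      ((Sb.conv_last hS'.col (.ty_symm eS)).ty ihM.2) (.conv ihd.2.1 eS) (by simpa using l1)
      (by simpa using r1)) (.ty_symm (eM.inst_eqTy ihM.2 ihd.1 ihd.2.1 ed)), hM.inst_ty ihd.1⟩
  | sum_comp_inl hA hB hM ha hl hr =>
    have hi := Derives.sum_inl hA hB ha
    exact ⟨.sum_elim hA hB hM hi hl hr, by simpa using (Sb.single ha).sub_tm hl, hM.inst_ty hi⟩
  | sum_comp_inr hA hB hM hb hl hr =>
    have hi := Derives.sum_inr hA hB hb
    exact ⟨.sum_elim hA hB hM hi hl hr, by simpa using (Sb.single hb).sub_tm hr, hM.inst_ty hi⟩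
  | quot_form_eq _ _ h h' => exact ⟨h, h'⟩
  | quot_intro hQ => exact hQ.col
  | quot_intro_eq eA eR hQ hQ' ea ihA _ _ _ iha =>
    exact ⟨.quot_intro hQ iha.1, .cls_conv eA eR hQ hQ' iha.2.1, hQ.col⟩
  | quot_eq hQ ha hb => exact ⟨.quot_intro hQ ha, .quot_intro hQ hb, hQ.col⟩
  | quot_eff hQ ha hb h => exact (Derives.quot_eff hQ ha hb h).prop_of_holds.col
  | quot_elim hQ hM hp => exact hM.inst_ty hp
  | @quot_elim_eq Γ A A' R R' M M' p p' l l' eA eR hQ hQ' hM eM ep el c ihA ihR _ _ _ ihM ihp ihl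
    ihc =>
    have eQ := (Derives.quot_form_eq eA eR hQ hQ').eq_col
    have s0 := Sb.conv_last ihA.2.col (.ty_symm eA.eq_col)
    have wA := Sb.shift_one ihA.1.ctx_ext
    have wA' := Sb.shift_one ihA.2.ctx_ext
    have vA := Derives.var_zero ihA.1.ctx_ext
    have s1 : Sb T (A'.wk 1 :: A' :: Γ) .var (A.wk 1 :: A :: Γ) :=
      s0.conv_cons (by simpa using (wA'.sub_ty ihA.2).col)
        (by simpa using wA'.sub_eqTy (Derives.ty_symm eA).eq_col)
    have s2 : Sb T (R' :: A'.wk 1 :: A' :: Γ) .var (R :: A.wk 1 :: A :: Γ) :=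
      s1.conv_cons (s1.ty ihR.2).col (s1.eqTy (Derives.ty_symm eR).eq_col)
    have hR := ihR.1
    have wR : Sb T (R :: A.wk 1 :: A :: Γ) (shift 3) Γ := Sb.shift_three ihR.1
    have v2 := Derives.var_two ihR.1
    have v1 := Derives.var_one ihR.1
    have wRA : ∀ {Δ σ}, Sb T Δ σ Γ → Sb T ((A.sub σ).wk 1 :: A.sub σ :: Δ) (up (up σ))
      (A.wk 1 :: A :: Γ) := by
      intro Δ σ s
      have := (s.up ihA.1).up (wA.sub_ty ihA.1)
      simpa using this
    -- Stated over an arbitrary substitution because it is needed twice: at the variable of the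
    -- branch, and in the context of two related elements.
    have cls1 : ∀ {Δ σ t}, Sb T Δ σ Γ → Derives T (.isTm Δ t (A.sub σ)) →
        Derives T (.eqTy Δ (M.sub (scons (cls (A.sub σ) (R.sub (up (up σ))) t) σ))
          (M'.sub (scons (cls (A'.sub σ) (R'.sub (up (up σ))) t) σ)) .col) := by
      intro Δ σ t s ht
      exact s.sub_scons_eq eM ihM.2 (.quot_intro (s.sub_ty hQ) ht)
        (.cls_conv (s.sub_eqTy eA) ((wRA s).sub_eqTy eR) (s.sub_ty hQ) (s.sub_ty hQ') ht)
        (.quot_intro_eq (s.sub_eqTy eA) ((wRA s).sub_eqTy eR) (s.sub_ty hQ) (s.sub_ty hQ')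
          (.tm_refl ht))
    have e1 := cls1 (t := .var 0) wA (by simpa using vA)
    have e2 := cls1 (t := .var 2) wR (by simpa using v2)
    have l1 := s0.isTm (Derives.conv ihl.2.1 (by simpa using e1))
    have q2 := (wR.cons (t := .var 2) (by simpa using v2)).sub_eqTm el
    have q1 := (wR.cons (t := .var 1) (by simpa using v1)).sub_eqTm el
    have hR1 := ((Sb.shift_one ihR.1.ctx_ext).sub_ty ihR.1).prop .small
    have r0 := Derives.prop_true hR1 (by simpa using Derives.var_zero ihR.1.ctx_ext)
    have q0 := Derives.quot_eq (wR.sub_ty hQ) (a := .var 2) (b := .var 1) (by simpa using v2)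
      (by simpa using v1) (by simpa using r0)
    have q3 := wR.sub_scons_eq (.ty_refl hM) hM (.quot_intro (wR.sub_ty hQ) (by simpa using v2))
      (.quot_intro (wR.sub_ty hQ) (by simpa using v1)) q0
    -- With $x$, $y$ related, $l'(x)=l(x)=l(y)=l'(y)$. The last equality lives in `M` at the class
    -- of $y$, which `q3` identifies with `M` at the class of $x$.
    have c1 := Derives.tm_trans (.tm_symm (by simpa using q2)) (.tm_trans (by simpa using c)
      (.eq_conv (by simpa using q1) (.ty_symm (by simpa using q3))))
    have c2 := s2.eqTm (Derives.eq_conv (by simpa using c1) e2)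
    exact ⟨.quot_elim hQ hM ihp.1 ihl.1 c, .conv (.quot_elim hQ'
      ((Sb.conv_last hQ'.col (.ty_symm eQ)).ty ihM.2) (.conv ihp.2.1 eQ) (by simpa using l1)
      (by simpa using c2)) (.ty_symm (eM.inst_eqTy ihM.2 ihp.1 ihp.2.1 ep)), hM.inst_ty ihp.1⟩
  | quot_comp hQ hM ha hl hc =>
    have hi := Derives.quot_intro hQ ha
    exact ⟨.quot_elim hQ hM hi hl hc, by simpa using (Sb.single ha).sub_tm hl, hM.inst_ty hi⟩
  | pow1_intro hP => exact .pow1_form hP.ty_ctx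
  | pow1_eq hP hQ => exact ⟨.pow1_intro hP, .pow1_intro hQ, .pow1_form hP.ty_ctx⟩
  | pow1_eff hP hQ h => exact (Derives.pow1_eff hP hQ h).prop_of_holds.col
  | pow1_eta h ih => exact ⟨h, .pow1_intro (.dc h), ih⟩
  | conj_form_eq hk _ _ ihP ihQ => exact ⟨.conj_form hk ihP.1 ihQ.1, .conj_form hk ihP.2 ihQ.2⟩
  | disj_form_eq hk _ _ ihP ihQ => exact ⟨.disj_form hk ihP.1 ihQ.1, .disj_form hk ihP.2 ihQ.2⟩
  | imp_form_eq hk _ _ ihP ihQ => exact ⟨.imp_form hk ihP.1 ihQ.1, .imp_form hk ihP.2 ihQ.2⟩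
  | all_form_eq hk hA eA eP _ ihA ihP =>
    exact ⟨.all_form hk hA ihP.1, .all_form hk ihA.2
      ((Sb.conv_last ihA.2.col (.ty_symm eA.eq_col)).ty ihP.2)⟩
  | ex_form_eq hk hA eA eP _ ihA ihP =>
    exact ⟨.ex_form hk hA ihP.1, .ex_form hk ihA.2
      ((Sb.conv_last ihA.2.col (.ty_symm eA.eq_col)).ty ihP.2)⟩
  | eq_form_eq hk hA eA ea eb _ ihA iha ihb =>
    exact ⟨.eq_form hk hA iha.1 ihb.1, .eq_form (hk.of_eqTy eA) ihA.2 (.conv iha.2.1 eA.eq_col)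
      (.conv ihb.2.1 eA.eq_col)⟩
  | prop_mono hP hp hq => exact ⟨hp, hq, hP.col⟩
  | prop_true hP => exact hP.col
  | falsum_elim hP => exact hP.col
  | conj_intro hP hQ => exact (Derives.conj_form .large hP hQ).col
  | conj_left hP hQ => exact hP.col
  | conj_right hP hQ => exact hQ.col
  | disj_left hP hQ | disj_right hP hQ => exact (Derives.disj_form .large hP hQ).col
  | disj_elim _ _ hC => exact hC.col
  | imp_intro hP hQ => exact (Derives.imp_form .large hP hQ).col
  | imp_elim _ hQ => exact hQ.col
  | all_intro hA hP => exact (Derives.all_form .large hA hP).col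
  | all_elim hA hP _ ha => exact (hP.inst_ty ha).col
  | ex_intro hA hP => exact (Derives.ex_form .large hA hP).col
  | ex_elim _ _ hC => exact hC.col
  | eq_intro hA ha => exact (Derives.eq_form (.col _) hA ha ha).col
  | eq_elim hA ha hb => exact ⟨ha, hb, hA⟩
  | lem hT hP => exact (Derives.lem hT hP).prop_of_holds.col

end

section
variable {T : Theory} {Γ Δ Θ : Ctx} {σ τ : ℕ → Tm} {A A' B B' P P' Q C : Ty} {a a' b b' t t' : Tm}
  {k : Kind}

/-! ### Derived rules of logic -/

namespace Derives

theorem of_isTm (h : Derives T (isTm Γ a A)) : Derives T (isTy Γ A .col) := h.presup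

theorem left (h : Derives T (eqTm Γ a b A)) : Derives T (isTm Γ a A) := h.presup.1

theorem right (h : Derives T (eqTm Γ a b A)) : Derives T (isTm Γ b A) := h.presup.2.1

theorem neg (h : Derives T (isTy Γ P k)) (hk : k.Logical) : Derives T (isTy Γ (Expr.neg P) k) := by
  refine .imp_form hk h ?_
  cases hk
  · exact .falsum_form h.ty_ctx
  · exact .incl .props_prop (.falsum_form h.ty_ctx)

theorem stab (h : Derives T (isTy Γ P k)) (hk : k.Logical) : Derives T (isTy Γ (Expr.stab P) k) :=
  .imp_form hk ((h.neg hk).neg hk) h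

theorem mp (h : Derives T (holds Γ (imp P Q))) (h' : Derives T (holds Γ P)) :
    Derives T (holds Γ Q) :=
  .imp_elim h.prop_of_holds.imp_inv.1 h.prop_of_holds.imp_inv.2 h h'

theorem holds_conv (h : Derives T (holds Γ P)) (e : Derives T (eqTy Γ P Q .prop)) :
    Derives T (holds Γ Q) :=
  .prop_true e.presup.2 (.conv h e.eq_col)

theorem holds_eq (h : Derives T (eqTm Γ a b A)) : Derives T (holds Γ (eq A a b)) :=
  (Derives.eq_intro h.left.of_isTm h.left).holds_conv
    (.eq_form_eq (.col _) h.left.of_isTm (.ty_refl h.left.of_isTm) (.tm_refl h.left) h)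

theorem eq_of_holds (h : Derives T (holds Γ (eq A a b))) : Derives T (eqTm Γ a b A) :=
  have i := h.prop_of_holds.inv.1
  .eq_elim i.1 i.2.1 i.2.2 h

theorem hyp_zero (h : Derives T (isTy Γ P .prop)) : Derives T (holds (P :: Γ) (P.sub (shift 1))) :=
  .prop_true ((Sb.shift_one h.ctx_ext).sub_ty h) (by simpa using var_zero h.ctx_ext)

/-- The Kripke reading of implication: only the weakening by `P` itself is used, but asking for all
substitutions lets proofs be written without naming variables. -/
theorem imp_intro_sub (hP : Derives T (isTy Γ P .prop)) (hQ : Derives T (isTy Γ Q .prop))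
    (h : ∀ Δ σ, Sb T Δ σ Γ → Derives T (holds Δ (P.sub σ)) → Derives T (holds Δ (Q.sub σ))) :
    Derives T (holds Γ (imp P Q)) :=
  .imp_intro hP hQ (by simpa using h _ _ (Sb.shift_one hP.ctx_ext) hP.hyp_zero)

theorem all_intro_sub (hA : Derives T (isTy Γ A .col)) (hP : Derives T (isTy (A :: Γ) P .prop))
    (h : ∀ Δ σ t, Sb T Δ σ Γ → Derives T (isTm Δ t (A.sub σ)) →
      Derives T (holds Δ (P.sub (scons t σ)))) : Derives T (holds Γ (all A P)) :=
  .all_intro hA hP (by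
    simpa using h _ _ (.var 0) (Sb.shift_one hA.ctx_ext) (by simpa using var_zero hA.ctx_ext))

theorem all_apply (h : Derives T (holds Γ (all A P))) (ha : Derives T (isTm Γ a A)) :
    Derives T (holds Γ (P.inst 0 a)) :=
  have i := h.prop_of_holds.inv.1
  .all_elim i.1 i.2 h ha

theorem fst (h : Derives T (holds Γ (conj P Q))) : Derives T (holds Γ P) :=
  have i := h.prop_of_holds.inv.1
  .conj_left i.1 i.2 h

theorem snd (h : Derives T (holds Γ (conj P Q))) : Derives T (holds Γ Q) :=
  have i := h.prop_of_holds.inv.1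
  .conj_right i.1 i.2 h

theorem and (h : Derives T (holds Γ P)) (h' : Derives T (holds Γ Q)) :
    Derives T (holds Γ (conj P Q)) :=
  .conj_intro h.prop_of_holds h'.prop_of_holds h h'

theorem top_holds (h : Derives T (.ctx Γ)) : Derives T (holds Γ top) :=
  have hF := Derives.incl .props_prop (.falsum_form h)
  .imp_intro_sub hF hF fun _ _ _ h => h

/-- Functoriality of double negation. -/
theorem nn_map (h : Derives T (holds Γ (Expr.neg (Expr.neg P)))) (hQ : Derives T (isTy Γ Q .prop))
    (f : ∀ Δ σ, Sb T Δ σ Γ → Derives T (holds Δ (P.sub σ)) → Derives T (holds Δ (Q.sub σ))) :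
    Derives T (holds Γ (Expr.neg (Expr.neg Q))) := by
  have hP := h.prop_of_holds.imp_inv.1.imp_inv.1
  have hF := h.prop_of_holds.imp_inv.2
  refine .imp_intro_sub (hQ.neg .large) hF fun Δ σ s hn => ?_
  refine (s.sub_tm h).mp (.imp_intro_sub (s.sub_ty hP) (s.sub_ty hF) fun Δ' σ' s' hp => ?_)
  refine (s'.sub_tm hn).mp ?_
  simpa using f Δ' _ (s.comp s') (by simpa using hp)

/-- The form in which stability is used: a double negation may be dropped while proving a stable
conclusion. -/
theorem nn_elim (h : Derives T (holds Γ (Expr.neg (Expr.neg P)))) (hC : Derives T (holds Γ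
    (Expr.stab C)))
    (f : ∀ Δ σ, Sb T Δ σ Γ → Derives T (holds Δ (P.sub σ)) → Derives T (holds Δ (C.sub σ))) :
    Derives T (holds Γ C) :=
  hC.mp (h.nn_map hC.prop_of_holds.imp_inv.2 f)

theorem nn_intro (h : Derives T (holds Γ P)) : Derives T (holds Γ (Expr.neg (Expr.neg P))) :=
  .imp_intro_sub (h.prop_of_holds.neg .large) (.incl .props_prop (.falsum_form h.tm_ctx))
    fun _ _ s hn => Derives.mp hn (s.sub_tm h)

theorem stab_intro_sub (hP : Derives T (isTy Γ P .prop))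
    (h : ∀ Δ σ, Sb T Δ σ Γ → Derives T (holds Δ (Expr.neg (Expr.neg (P.sub σ)))) →
      Derives T (holds Δ (P.sub σ))) : Derives T (holds Γ (Expr.stab P)) :=
  .imp_intro_sub ((hP.neg .large).neg .large) hP h

theorem stab_of_holds (h : Derives T (holds Γ P)) : Derives T (holds Γ (Expr.stab P)) :=
  .stab_intro_sub h.prop_of_holds fun _ _ s _ => s.sub_tm h

theorem ex_falso (h : Derives T (holds Γ falsum)) (hP : Derives T (isTy Γ P .prop)) :
    Derives T (holds Γ P) := .falsum_elim hP h

theorem nn_falsum (h : Derives T (holds Γ (Expr.neg (Expr.neg falsum)))) :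
    Derives T (holds Γ falsum) := h.mp (top_holds h.tm_ctx)

theorem stab_falsum (h : Derives T (.ctx Γ)) : Derives T (holds Γ (Expr.stab falsum)) :=
  .stab_intro_sub (.incl .props_prop (.falsum_form h)) fun _ _ _ h => nn_falsum h

theorem stab_conj (hP : Derives T (holds Γ (Expr.stab P))) (hQ : Derives T (holds Γ
    (Expr.stab Q))) :
    Derives T (holds Γ (Expr.stab (conj P Q))) := by
  have tP := hP.prop_of_holds.imp_inv.2
  have tQ := hQ.prop_of_holds.imp_inv.2
  refine .stab_intro_sub (.conj_form .large tP tQ) fun Δ σ s h => ?_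
  exact .and (h.nn_elim (s.sub_tm hP) fun _ _ _ h => h.fst)
    (h.nn_elim (s.sub_tm hQ) fun _ _ _ h => h.snd)

/-- The premise may be arbitrary. With `falsum` as conclusion this makes all negations stable, in
particular the translated disjunctions and existentials. -/
theorem stab_imp (hP : Derives T (isTy Γ P .prop)) (hQ : Derives T (holds Γ (Expr.stab Q))) :
    Derives T (holds Γ (Expr.stab (imp P Q))) := by
  have tQ := hQ.prop_of_holds.imp_inv.2
  refine .stab_intro_sub (.imp_form .large hP tQ) fun Δ σ s h => ?_
  refine .imp_intro_sub (s.sub_ty hP) (s.sub_ty tQ) fun Δ' σ' s' hp => ?_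
  exact nn_elim (s'.sub_tm h) (s'.sub_tm (s.sub_tm hQ)) fun _ _ t h => h.mp (t.sub_tm hp)

theorem stab_neg (hP : Derives T (isTy Γ P .prop)) :
    Derives T (holds Γ (Expr.stab (Expr.neg P))) :=
  stab_imp hP (stab_falsum hP.ty_ctx)

/-- Each instance is stable, so the instance may be taken under the double negation. -/
theorem stab_all (hA : Derives T (isTy Γ A .col)) (hP : Derives T (holds (A :: Γ) (Expr.stab P))) :
    Derives T (holds Γ (Expr.stab (all A P))) := by
  have tP := hP.prop_of_holds.imp_inv.2
  refine .stab_intro_sub (.all_form .large hA tP) fun Δ σ s h => ?_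
  refine .all_intro_sub (s.sub_ty hA) ((s.up hA).sub_ty tP) fun Δ' σ' t s' ht => ?_
  have s2 : Sb T Δ' (scons t (cmp σ σ')) (A :: Γ) := (s.comp s').cons (by simpa using ht)
  have := nn_elim (s'.sub_tm h) (s2.sub_tm hP) fun Δ τ r h => by
    have := h.all_apply (a := t.sub τ) (by simpa using r.sub_tm ht)
    simpa using this
  simpa using this

/-- With the cases as implications over `Γ`, they can be substituted without entering the contexts
of the branches. -/
theorem or_elim (h : Derives T (holds Γ (disj P Q))) (h1 : Derives T (holds Γ (imp P C)))
    (h2 : Derives T (holds Γ (imp Q C))) : Derives T (holds Γ C) := by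
  have i1 := h1.prop_of_holds.imp_inv
  have i2 := h2.prop_of_holds.imp_inv
  refine .disj_elim i1.1 i2.1 i1.2 h ?_ ?_
  · simpa using ((Sb.shift_one i1.1.ctx_ext).sub_tm h1).mp i1.1.hyp_zero
  · simpa using ((Sb.shift_one i2.1.ctx_ext).sub_tm h2).mp i2.1.hyp_zero

/-! ### Induction towards propositions -/

theorem n0_ind (hP : Derives T (isTy (n0 :: Γ) P .prop)) (hd : Derives T (isTm Γ t n0)) :
    Derives T (holds Γ (P.inst 0 t)) :=
  .prop_true (hP.inst_ty hd) (.n0_elim hP.col hd)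

theorem n1_ind (hP : Derives T (isTy (n1 :: Γ) P .prop)) (h : Derives T (holds Γ (P.inst 0 star)))
    (hd : Derives T (isTm Γ t n1)) : Derives T (holds Γ (P.inst 0 t)) :=
  .prop_true (hP.inst_ty hd) (.n1_elim hP.col hd h)

/-- As in the other induction principles, the case is assumed over every substitution and is used
only at the generic one, the weakening by the variables of the branch. -/
theorem sigma_ind (hP : Derives T (isTy (sigma A B :: Γ) P .prop))
    (h : ∀ Δ σ a b, Sb T Δ σ Γ → Derives T (isTm Δ a (A.sub σ)) →
      Derives T (isTm Δ b (B.sub (scons a σ))) →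
      Derives T (holds Δ (P.sub (scons (pair (A.sub σ) (B.sub (up σ)) a b) σ))))
    (hd : Derives T (isTm Γ t (sigma A B))) : Derives T (holds Γ (P.inst 0 t)) := by
  have i := hd.of_isTm.inv.1
  have := h _ _ (.var 1) (.var 0) (Sb.shift_two i.2) (by simpa using var_one i.2)
    (by simpa using var_zero i.2.ctx_ext)
  exact .prop_true (hP.inst_ty hd) (.sigma_elim i.1 i.2 hP.col hd
    (m := triv (P.inst 2 (pair (A.wk 2) (B.wk₁ 2) (.var 1) (.var 0)))) (by simpa using this))

theorem list_ind (hP : Derives T (isTy (list A :: Γ) P .prop))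
    (h : Derives T (holds Γ (P.inst 0 (nil A))))
    (h' : ∀ Δ σ s a, Sb T Δ σ Γ → Derives T (isTm Δ s (list (A.sub σ))) →
      Derives T (isTm Δ a (A.sub σ)) → Derives T (holds Δ (P.sub (scons s σ))) →
      Derives T (holds Δ (P.sub (scons (cons (A.sub σ) s a) σ))))
    (hd : Derives T (isTm Γ t (list A))) : Derives T (holds Γ (P.inst 0 t)) := by
  have hA : Derives T (isTy Γ A .set) := hd.of_isTm.inv.1
  have hL := list_form hA
  have hwA : Derives T (.isTy (list A :: Γ) (A.wk 1) .set) := by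
    simpa using (Sb.shift_one hL.ctx_ext).sub_ty hA
  have v := var_one hwA
  have hQ := ((Sb.shift_two hwA).cons (A := list A) (t := .var 1) (by simpa using v)).sub_ty hP
  have := h' _ _ (.var 2) (.var 1) (Sb.shift_three hQ) (by simpa using var_two hQ)
    (by simpa using var_one hQ) (by simpa using hQ.hyp_zero)
  exact .prop_true (hP.inst_ty hd) (.list_elim hA hP.col hd h
    (l := triv (P.inst 3 (cons (A.wk 3) (.var 2) (.var 1)))) (by simpa using this))

theorem sum_ind (hP : Derives T (isTy (sum A B :: Γ) P .prop))
    (h : ∀ Δ σ a, Sb T Δ σ Γ → Derives T (isTm Δ a (A.sub σ)) →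
      Derives T (holds Δ (P.sub (scons (inl (A.sub σ) (B.sub σ) a) σ))))
    (h' : ∀ Δ σ b, Sb T Δ σ Γ → Derives T (isTm Δ b (B.sub σ)) →
      Derives T (holds Δ (P.sub (scons (inr (A.sub σ) (B.sub σ) b) σ))))
    (hd : Derives T (isTm Γ t (sum A B))) : Derives T (holds Γ (P.inst 0 t)) := by
  have i := hd.of_isTm.inv.1
  have l := h _ _ (.var 0) (Sb.shift_one i.1.ctx_ext) (by simpa using var_zero i.1.ctx_ext)
  have r := h' _ _ (.var 0) (Sb.shift_one i.2.ctx_ext) (by simpa using var_zero i.2.ctx_ext)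
  exact .prop_true (hP.inst_ty hd) (.sum_elim i.1 i.2 hP.col hd
    (l := triv (P.inst 1 (inl (A.wk 1) (B.wk 1) (.var 0))))
    (r := triv (P.inst 1 (inr (A.wk 1) (B.wk 1) (.var 0)))) (by simpa using l) (by simpa using r))

/-- Compatibility of the branch with `R` is free by proof irrelevance, once the instances of `P` at
two related elements are identified along the equality of their classes. -/
theorem quot_ind {R : Ty} (hQ : Derives T (isTy Γ (quot A R) .set))
    (hP : Derives T (isTy (quot A R :: Γ) P .prop))
    (h : ∀ Δ σ a, Sb T Δ σ Γ → Derives T (isTm Δ a (A.sub σ)) →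
      Derives T (holds Δ (P.sub (scons (cls (A.sub σ) (R.sub (up (up σ))) a) σ))))
    (hd : Derives T (isTm Γ t (quot A R))) : Derives T (holds Γ (P.inst 0 t)) := by
  have i := hQ.inv.1
  have s := Sb.shift_three i.2
  have v2 := var_two i.2
  have v1 := var_one i.2
  have hR1 := ((Sb.shift_one i.2.ctx_ext).sub_ty i.2).prop .small
  have r0 := prop_true hR1 (by simpa using var_zero i.2.ctx_ext)
  have q := quot_eq (s.sub_ty hQ) (a := .var 2) (b := .var 1) (by simpa using v2)
      (by simpa using v1) (by simpa using r0)
  have e := s.sub_scons_eq (.ty_refl hP) hP q.left q.right q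
  have h2 := h _ _ (.var 2) s (by simpa using v2)
  have h1 := h _ _ (.var 1) s (by simpa using v1)
  have h0 := h _ _ (.var 0) (Sb.shift_one i.1.ctx_ext) (by simpa using var_zero i.1.ctx_ext)
  have m := prop_mono e.presup.1 h2 (.conv h1 (.ty_symm e.eq_col))
  exact .prop_true (hP.inst_ty hd) (.quot_elim hQ hP.col hd
    (l := triv (P.inst 1 (cls (A.wk 1) (R.wk₂ 1) (.var 0)))) (by simpa using h0)
    (by simpa using m))

end Derives

end

section
variable {T : Theory} {Γ Δ Θ : Ctx} {σ τ : ℕ → Tm} {A A' B B' P P' Q C R : Ty}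
  {a a' b b' d d' f g t t' : Tm} {k : Kind}

/-! ### Stable equality -/

/-- Equality of the type `A` is stable under double negation, in all contexts over `Γ`. -/
def SEq (T : Theory) (Γ : Ctx) (A : Ty) : Prop :=
  ∀ Δ σ a b, Sb T Δ σ Γ → Derives T (isTm Δ a (A.sub σ)) → Derives T (isTm Δ b (A.sub σ)) →
    Derives T (holds Δ (neg (neg (eq (A.sub σ) a b)))) → Derives T (eqTm Δ a b (A.sub σ))

theorem SEq.sub (h : SEq T Γ A) (s : Sb T Δ σ Γ) : SEq T Δ (A.sub σ) := by
  intro Δ' σ' a b s' ha hb hn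
  simpa using h Δ' _ a b (s.comp s') (by simpa using ha) (by simpa using hb) (by simpa using hn)

theorem SEq.apply (h : SEq T Γ A) (ha : Derives T (isTm Γ a A)) (hb : Derives T (isTm Γ b A))
    (hn : Derives T (holds Γ (neg (neg (eq A a b))))) : Derives T (eqTm Γ a b A) := by
  simpa using h Γ .var a b (.id ha.tm_ctx) (by simpa using ha) (by simpa using hb)
    (by simpa using hn)

theorem SEq.stab_eq (h : SEq T Γ A) (ha : Derives T (isTm Γ a A)) (hb : Derives T (isTm Γ b A)) :
    Derives T (holds Γ (stab (eq A a b))) :=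
  .stab_intro_sub (.eq_form (.col _) ha.of_isTm ha hb) fun _ _ s hn =>
    .holds_eq (h _ _ _ _ s (s.sub_tm ha) (s.sub_tm hb) hn)

theorem SEq.of_stab (h : ∀ Δ σ a b, Sb T Δ σ Γ → Derives T (isTm Δ a (A.sub σ)) →
    Derives T (isTm Δ b (A.sub σ)) → Derives T (holds Δ (stab (eq (A.sub σ) a b)))) : SEq T Γ A :=
  fun Δ σ a b s ha hb hn => .eq_of_holds ((h Δ σ a b s ha hb).mp hn)

/-- Inside the double negation the equality can be reflected, so congruence and injectivity of
judgemental equality may be applied there. -/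
theorem Derives.nn_eq_map {fa fb : Tm} (hn : Derives T (holds Γ (Expr.neg (Expr.neg (eq A a b)))))
    (hfa : Derives T (isTm Γ fa B)) (hfb : Derives T (isTm Γ fb B))
    (f : ∀ Δ σ, Sb T Δ σ Γ → Derives T (eqTm Δ (a.sub σ) (b.sub σ) (A.sub σ)) →
      Derives T (eqTm Δ (fa.sub σ) (fb.sub σ) (B.sub σ))) :
    Derives T (holds Γ (Expr.neg (Expr.neg (eq B fa fb)))) :=
  hn.nn_map (.eq_form (.col _) hfa.of_isTm hfa hfb) fun _ _ s h => .holds_eq (f _ _ s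
    (.eq_of_holds h))

theorem Derives.nn_eq_falsum (hn : Derives T (holds Γ (Expr.neg (Expr.neg (eq A a b)))))
    (f : ∀ Δ σ, Sb T Δ σ Γ → Derives T (eqTm Δ (a.sub σ) (b.sub σ) (A.sub σ)) →
      Derives T (holds Δ falsum)) : Derives T (holds Γ falsum) :=
  .nn_falsum (hn.nn_map (.incl .props_prop (.falsum_form hn.tm_ctx)) fun _ _ s h =>
    f _ _ s (.eq_of_holds h))

theorem Derives.stab_eq_motive (h : Derives T (isTm Γ t A)) :
    Derives T (isTy (A :: Γ) (Expr.stab (eq (A.wk 1) (.var 0) (t.wk 1))) .prop) := by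
  have s := Sb.shift_one h.of_isTm.ctx_ext
  refine Derives.stab (.eq_form (.col _) ?_ (var_zero h.of_isTm.ctx_ext) ?_) .large
  · simpa using s.sub_ty h.of_isTm
  · simpa using s.sub_tm h

theorem Derives.stab_eq_motive_right (h : Derives T (isTm Γ t A)) :
    Derives T (isTy (A :: Γ) (Expr.stab (eq (A.wk 1) (t.wk 1) (.var 0))) .prop) := by
  have s := Sb.shift_one h.of_isTm.ctx_ext
  refine Derives.stab (.eq_form (.col _) ?_ ?_ (var_zero h.of_isTm.ctx_ext)) .large
  · simpa using s.sub_ty h.of_isTm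
  · simpa using s.sub_tm h

theorem SEq.prop (h : Derives T (isTy Γ P .prop)) : SEq T Γ P :=
  fun _ _ _ _ s ha hb _ => .prop_mono (s.sub_ty h) ha hb

theorem SEq.n0 : SEq T Γ n0 := by
  refine .of_stab fun Δ σ a b s ha hb => ?_
  have hb : Derives T (isTm Δ b .n0) := hb
  simpa using Derives.n0_ind hb.stab_eq_motive ha

theorem SEq.n1 : SEq T Γ n1 := by
  refine .of_stab fun Δ σ a b s ha hb => .stab_of_holds ?_
  have hs := Derives.n1_intro (T := T) ha.tm_ctx
  -- There is no judgemental $\eta$ for the singleton; induction proves it propositionally, and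
  -- reflection then makes all elements equal.
  have key : ∀ {c}, Derives T (isTm Δ c .n1) → Derives T (holds Δ (eq .n1 c star)) := by
    intro c hc
    have hv := Derives.var_zero hc.of_isTm.ctx_ext
    have := Derives.n1_ind (P := eq .n1 (.var 0) star) (t := c)
      (.eq_form (.col _) (Derives.n1_form hv.tm_ctx).col hv (.n1_intro hv.tm_ctx))
      (.holds_eq (.tm_refl hs)) hc
    exact this
  exact .holds_eq (.tm_trans (key ha).eq_of_holds (.tm_symm (key hb).eq_of_holds))

/-! #### Products -/

theorem Derives.pi_ext (hk : PiCod B k) (hA : Derives T (isTy Γ A .set))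
    (hB : Derives T (isTy (A :: Γ) B k)) (hf : Derives T (isTm Γ f (pi A B)))
    (hg : Derives T (isTm Γ g (pi A B)))
    (h : Derives T (eqTm (A :: Γ) (app (A.wk 1) (B.wk₁ 1) (f.wk 1) (.var 0))
      (app (A.wk 1) (B.wk₁ 1) (g.wk 1) (.var 0)) B)) : Derives T (eqTm Γ f g (pi A B)) :=
  .tm_trans (.tm_symm (.pi_eta hk hA hB hf)) (.tm_trans (.pi_intro_eq hk hA (.ty_refl hA) hB
    (.ty_refl hB) h) (.pi_eta hk hA hB hg))

theorem Derives.app_wk (hk : PiCod B k) (hA : Derives T (isTy Γ A .set))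
    (hB : Derives T (isTy (A :: Γ) B k)) (hf : Derives T (isTm Γ f (pi A B))) :
    Derives T (isTm (A :: Γ) (app (A.wk 1) (B.wk₁ 1) (f.wk 1) (.var 0)) B) := by
  have w := Sb.shift_one hA.ctx_ext
  have := Derives.pi_elim (hk.sub _) (w.sub_ty hA) ((w.up hA).sub_ty hB)
    (f := f.sub (shift 1)) (by simpa using w.sub_tm hf) (by simpa using Derives.var_zero hA.ctx_ext)
  simpa using this

/-- From $\neg\neg(f=g)$ follows $\neg\neg(f(x)=g(x))$ at a fresh $x$, hence $f(x)=g(x)$ by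
stability in `B`; then `Derives.pi_ext` applies. -/
theorem SEq.pi (hk : PiCod B k) (hA : Derives T (isTy Γ A .set))
    (hB : Derives T (isTy (A :: Γ) B k)) (sB : SEq T (A :: Γ) B) : SEq T Γ (pi A B) := by
  intro Δ σ f g s hf hg hn
  have hA' := s.sub_ty hA
  have hB' := (s.up hA).sub_ty hB
  have hk' := hk.sub (up σ)
  refine .pi_ext hk' hA' hB' hf hg ?_
  have hf' := Derives.app_wk hk' hA' hB' hf
  have hg' := Derives.app_wk hk' hA' hB' hg
  refine (sB.sub (s.up hA)).apply hf' hg' ?_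
  refine Derives.nn_eq_map ((Sb.shift_one hA'.ctx_ext).sub_tm hn) hf' hg' fun Θ τ r h => ?_
  have e := (SbEq.refl r).repl_ty hB'
  have hAr := (Sb.shift_one hA'.ctx_ext).sub_ty hA'
  have hBr := ((Sb.shift_one hA'.ctx_ext).up hA').sub_ty hB'
  have := Derives.pi_elim_eq ((hk'.sub (up (shift 1))).sub (up τ)) (r.sub_ty hAr) (.ty_refl
    (r.sub_ty hAr))
    ((r.up hAr).sub_ty hBr) (.ty_refl ((r.up hAr).sub_ty hBr)) h
    (.tm_refl (a := τ 0) (by simpa using r.sub_tm (Derives.var_zero hA'.ctx_ext)))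
  simpa using this

/-! #### Dependent sums -/

/-- The second projection of a dependent sum. -/
def proj₂ (A B : Ty) (d : Tm) : Tm :=
  elSigma A B (B.sub (scons (proj₁ (A.wk 1) (B.wk₁ 1) (.var 0)) (shift 1))) d (.var 0)

namespace Derives

theorem wk_fst (hA : Derives T (isTy Γ A .col)) (hB : Derives T (isTy (A :: Γ) B .col)) :
    Derives T (isTy (sigma A B :: Γ) (A.wk 1) .col) := by
  simpa using (Sb.shift_one (sigma_form .col hA hB).ctx_ext).sub_ty hA

theorem proj₁_tm (hd : Derives T (isTm Γ d (sigma A B))) : Derives T (isTm Γ (proj₁ A B d) A) := by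
  have i := hd.of_isTm.inv.1
  simpa [proj₁] using Derives.sigma_elim i.1 i.2 (wk_fst i.1 i.2) hd (m := .var 1)
    (by simpa using var_one i.2)

theorem proj₁_congr (e : Derives T (eqTm Γ d d' (sigma A B))) :
    Derives T (eqTm Γ (proj₁ A B d) (proj₁ A B d') A) := by
  have i := e.left.of_isTm.inv.1
  simpa [proj₁] using Derives.sigma_elim_eq i.1 (.ty_refl i.1) i.2 (.ty_refl i.2) (wk_fst i.1 i.2)
    (.ty_refl (wk_fst i.1 i.2)) e (m := .var 1) (m' := .var 1)
    (.tm_refl (by simpa using var_one i.2))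

theorem proj₁_pair (hA : Derives T (isTy Γ A .col)) (hB : Derives T (isTy (A :: Γ) B .col))
    (ha : Derives T (isTm Γ a A)) (hb : Derives T (isTm Γ b (B.inst 0 a))) :
    Derives T (eqTm Γ (proj₁ A B (pair A B a b)) a A) := by
  simpa [proj₁] using Derives.sigma_comp hA hB (wk_fst hA hB) ha hb (m := .var 1)
    (by simpa using var_one hB)

theorem snd_ty (hA : Derives T (isTy Γ A .col)) (hB : Derives T (isTy (A :: Γ) B k)) :
    Derives T (isTy (sigma A B :: Γ)
      (B.sub (scons (proj₁ (A.wk 1) (B.wk₁ 1) (.var 0)) (shift 1))) k) := by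
  have hS := sigma_form .col hA hB.col
  have s := Sb.shift_one hS.ctx_ext
  have := proj₁_tm (A := A.wk 1) (B := B.wk₁ 1) (var_zero hS.ctx_ext)
  exact (s.cons (by simpa using this)).sub_ty hB

/-- The last variable has type $B(x)$, while the motive asks for $B(\pi_1\langle x,y\rangle)$; the
two agree by the computation of the first projection. -/
theorem snd_case (hA : Derives T (isTy Γ A .col)) (hB : Derives T (isTy (A :: Γ) B .col)) :
    Derives T (isTm (B :: A :: Γ) (.var 0)
      ((B.sub (scons (proj₁ (A.wk 1) (B.wk₁ 1) (.var 0)) (shift 1))).inst 2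
        (pair (A.wk 2) (B.wk₁ 2) (.var 1) (.var 0)))) := by
  have s := Sb.shift_two hB
  have v1 := var_one hB
  have v0 := var_zero hB.ctx_ext
  have p := proj₁_pair (s.sub_ty hA) ((s.up hA).sub_ty hB) (a := .var 1) (b := .var 0)
    (by simpa using v1) (by simpa using v0)
  have e := s.sub_scons_eq (.ty_refl hB) hB p.left p.right p
  exact .conv (by simpa using v0) (by simpa using ty_symm e)

theorem proj₂_congr (e : Derives T (eqTm Γ d d' (sigma A B))) :
    Derives T (eqTm Γ (proj₂ A B d) (proj₂ A B d') (B.inst 0 (proj₁ A B d))) := by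
  have i := e.left.of_isTm.inv.1
  simpa [proj₂] using Derives.sigma_elim_eq i.1 (.ty_refl i.1) i.2 (.ty_refl i.2) (snd_ty i.1 i.2)
    (.ty_refl (snd_ty i.1 i.2)) e (.tm_refl (snd_case i.1 i.2))

theorem proj₂_pair (hA : Derives T (isTy Γ A .col)) (hB : Derives T (isTy (A :: Γ) B .col))
    (ha : Derives T (isTm Γ a A)) (hb : Derives T (isTm Γ b (B.inst 0 a))) :
    Derives T (eqTm Γ (proj₂ A B (pair A B a b)) b (B.inst 0 a)) := by
  have p := proj₁_pair hA hB ha hb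
  have := Derives.sigma_comp hA hB (snd_ty hA hB) ha hb (snd_case hA hB)
  exact .eq_conv (by simpa [proj₂] using this) ((ty_refl hB).inst_eqTy hB p.left p.right p)

theorem pair_inj (hA : Derives T (isTy Γ A .col)) (hB : Derives T (isTy (A :: Γ) B .col))
    (ha : Derives T (isTm Γ a A)) (hb : Derives T (isTm Γ b (B.inst 0 a)))
    (ha' : Derives T (isTm Γ a' A)) (hb' : Derives T (isTm Γ b' (B.inst 0 a')))
    (e : Derives T (eqTm Γ (pair A B a b) (pair A B a' b') (sigma A B))) :
    Derives T (eqTm Γ a a' A) ∧ Derives T (eqTm Γ b b' (B.inst 0 a)) := by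
  have p := proj₁_pair hA hB ha hb
  have p' := proj₁_pair hA hB ha' hb'
  have e1 := tm_trans (tm_symm p) (tm_trans (proj₁_congr e) p')
  have e2 := eq_conv (proj₂_congr e) ((ty_refl hB).inst_eqTy hB p.left p.right p)
  -- The second projection of the second pair lives in $B(a')$; the equality just obtained brings it
  -- to $B(a)$.
  have e3 := eq_conv (proj₂_pair hA hB ha' hb') (ty_symm ((ty_refl hB).inst_eqTy hB ha ha' e1))
  exact ⟨e1, tm_trans (tm_symm (proj₂_pair hA hB ha hb)) (tm_trans e2 e3)⟩

/-- The first components come first: only once they are known to be equal do both second components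
belong to $B(a)$, where stability can be applied to them. -/
theorem pair_eq_of_nn (hA : Derives T (isTy Γ A .col)) (hB : Derives T (isTy (A :: Γ) B .col))
    (sA : SEq T Γ A) (sB : SEq T (A :: Γ) B)
    (ha : Derives T (isTm Γ a A)) (hb : Derives T (isTm Γ b (B.inst 0 a)))
    (ha' : Derives T (isTm Γ a' A)) (hb' : Derives T (isTm Γ b' (B.inst 0 a')))
    (hn : Derives T (holds Γ (Expr.neg (Expr.neg (eq (sigma A B) (pair A B a b)
      (pair A B a' b')))))) :
    Derives T (eqTm Γ (pair A B a b) (pair A B a' b') (sigma A B)) := by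
  have inj : ∀ Δ σ, Sb T Δ σ Γ →
      Derives T (eqTm Δ ((pair A B a b).sub σ) ((pair A B a' b').sub σ) ((sigma A B).sub σ)) →
      Derives T (eqTm Δ (a.sub σ) (a'.sub σ) (A.sub σ)) ∧
        Derives T (eqTm Δ (b.sub σ) (b'.sub σ) ((B.inst 0 a).sub σ)) := fun Δ σ s h => by
    simpa using pair_inj (s.sub_ty hA) ((s.up hA).sub_ty hB) (s.sub_tm ha)
      (b := b.sub σ) (by simpa using s.sub_tm hb) (s.sub_tm ha') (b' := b'.sub σ)
      (by simpa using s.sub_tm hb') h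
  have e1 := sA.apply ha ha' (hn.nn_eq_map ha ha' fun Δ σ s h => (inj Δ σ s h).1)
  have hb'' := conv hb' (ty_symm ((ty_refl hB).inst_eqTy hB ha ha' e1))
  have sBa : SEq T Γ (B.inst 0 a) := by simpa using sB.sub (Sb.single ha)
  have e2 := sBa.apply hb hb'' (hn.nn_eq_map hb hb'' fun Δ σ s h => (inj Δ σ s h).2)
  exact .sigma_intro_eq hA (.ty_refl hA) hB (.ty_refl hB) e1 e2

/-- Induction on both elements reduces to pairs. -/
theorem stab_eq_sigma (hA : Derives T (isTy Γ A .col)) (hB : Derives T (isTy (A :: Γ) B .col))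
    (sA : SEq T Γ A) (sB : SEq T (A :: Γ) B) (hd : Derives T (isTm Γ d (sigma A B)))
    (hd' : Derives T (isTm Γ d' (sigma A B))) :
    Derives T (holds Γ (Expr.stab (eq (sigma A B) d d'))) := by
  have h := sigma_ind hd'.stab_eq_motive (fun Δ σ a b s ha hb => ?_) hd
  · simpa using h
  have hA' := s.sub_ty hA
  have hB' := (s.up hA).sub_ty hB
  have hp := sigma_intro hA' hB' ha (by simpa using hb)
  have h := sigma_ind hp.stab_eq_motive_right (fun Θ τ a' b' r ha' hb' => ?_) (s.sub_tm hd')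
  · simpa using h
  · have hA2 := r.sub_ty hA'
    have hB2 := (r.up hA').sub_ty hB'
    have hb2 : Derives T (isTm Θ (b.sub τ) (((B.sub (up σ)).sub (up τ)).inst 0 (a.sub τ))) := by
      simpa using r.sub_tm hb
    have hb2' : Derives T (isTm Θ b' (((B.sub (up σ)).sub (up τ)).inst 0 a')) := by
      simpa using hb'
    have q := sigma_intro hA2 hB2 (r.sub_tm ha) hb2
    have q' := sigma_intro hA2 hB2 ha' hb2'
    have key := stab_intro_sub (.eq_form (.col _) q.of_isTm q q') fun Ξ ρ u hn =>
      holds_eq (pair_eq_of_nn (u.sub_ty hA2) ((u.up hA2).sub_ty hB2) (((sA.sub s).sub r).sub u)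
        (((sB.sub (s.up hA)).sub (r.up hA')).sub (u.up hA2)) (u.sub_tm (r.sub_tm ha))
        (b := (b.sub τ).sub ρ) (by simpa using u.sub_tm hb2) (u.sub_tm ha')
        (b' := b'.sub ρ) (by simpa using u.sub_tm hb2') (by simpa using hn))
    simpa using key

end Derives

theorem SEq.sigma (hA : Derives T (isTy Γ A .col)) (hB : Derives T (isTy (A :: Γ) B .col))
    (sA : SEq T Γ A) (sB : SEq T (A :: Γ) B) : SEq T Γ (sigma A B) :=
  .of_stab fun _ _ _ _ s ha hb => .stab_eq_sigma (s.sub_ty hA) ((s.up hA).sub_ty hB) (sA.sub s)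
    (sB.sub (s.up hA)) ha hb

end

section
variable {T : Theory} {Γ Δ Θ : Ctx} {σ τ : ℕ → Tm} {A A' B B' P P' Q C R : Ty}
  {a a' b b' d d' f g s s' t t' : Tm} {k : Kind}

namespace Derives

theorem wk_ty (hA : Derives T (isTy Γ A .col)) (hB : Derives T (isTy Γ B k)) :
    Derives T (isTy (A :: Γ) (B.wk 1) k) := by
  simpa using (Sb.shift_one hA.ctx_ext).sub_ty hB

theorem wk_tm (hA : Derives T (isTy Γ A .col)) (hb : Derives T (isTm Γ b B)) :
    Derives T (isTm (A :: Γ) (b.wk 1) (B.wk 1)) := by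
  simpa using (Sb.shift_one hA.ctx_ext).sub_tm hb

theorem top_ty (h : Derives T (.ctx Γ)) : Derives T (isTy Γ top .props) :=
  (Derives.falsum_form h).neg .small

/-- The source of every disjointness below: effectiveness of `pow1` yields $\top\Rightarrow\bot$. -/
theorem falsum_of_code_eq (h : Derives T (eqTm Γ (code top) (code falsum) pow1)) :
    Derives T (holds Γ falsum) :=
  (Derives.pow1_eff (top_ty h.left.tm_ctx) (.falsum_form h.left.tm_ctx) h).fst.mp
    (top_holds h.left.tm_ctx)

/-! #### Disjoint sums -/

/-- A left inverse of `inl` is defined by cases. Its value on the other summand does not matter, and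
`a` serves as default. -/
theorem inl_inj (hA : Derives T (isTy Γ A .set)) (hB : Derives T (isTy Γ B .set))
    (ha : Derives T (isTm Γ a A)) (ha' : Derives T (isTm Γ a' A))
    (e : Derives T (eqTm Γ (inl A B a) (inl A B a') (sum A B))) : Derives T (eqTm Γ a a' A) := by
  have hM := wk_ty (sum_form hA hB).col hA.col
  have hl : Derives T (isTm (A :: Γ) (.var 0) ((A.wk 1).inst 1 (inl (A.wk 1) (B.wk 1)
    (.var 0)))) := by
    simpa using var_zero hA.ctx_ext
  have hr : Derives T (isTm (B :: Γ) (a.wk 1)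
      ((A.wk 1).inst 1 (inr (A.wk 1) (B.wk 1) (.var 0)))) := by
    simpa using wk_tm hB.col ha
  have c := sum_elim_eq hA (.ty_refl hA) hB (.ty_refl hB) hM (.ty_refl hM) e (.tm_refl hl)
    (.tm_refl hr)
  have c1 := sum_comp_inl hA hB hM ha hl hr
  have c2 := sum_comp_inl hA hB hM ha' hl hr
  exact .tm_trans (.tm_symm (by simpa using c1)) (.tm_trans (by simpa using c) (by simpa using c2))

theorem inr_inj (hA : Derives T (isTy Γ A .set)) (hB : Derives T (isTy Γ B .set))
    (hb : Derives T (isTm Γ b B)) (hb' : Derives T (isTm Γ b' B))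
    (e : Derives T (eqTm Γ (inr A B b) (inr A B b') (sum A B))) : Derives T (eqTm Γ b b' B) := by
  have hM := wk_ty (sum_form hA hB).col hB.col
  have hl : Derives T (isTm (A :: Γ) (b.wk 1)
      ((B.wk 1).inst 1 (inl (A.wk 1) (B.wk 1) (.var 0)))) := by
    simpa using wk_tm hA.col hb
  have hr : Derives T (isTm (B :: Γ) (.var 0) ((B.wk 1).inst 1 (inr (A.wk 1) (B.wk 1)
    (.var 0)))) := by
    simpa using var_zero hB.ctx_ext
  have c := sum_elim_eq hA (.ty_refl hA) hB (.ty_refl hB) hM (.ty_refl hM) e (.tm_refl hl)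
    (.tm_refl hr)
  have c1 := sum_comp_inr hA hB hM hb hl hr
  have c2 := sum_comp_inr hA hB hM hb' hl hr
  exact .tm_trans (.tm_symm (by simpa using c1)) (.tm_trans (by simpa using c) (by simpa using c2))

/-- The function with values $[\top]$ on the left and $[\bot]$ on the right separates the summands.
It exists because eliminators act towards collections. -/
theorem inl_ne_inr (hA : Derives T (isTy Γ A .set)) (hB : Derives T (isTy Γ B .set))
    (ha : Derives T (isTm Γ a A)) (hb : Derives T (isTm Γ b B))
    (e : Derives T (eqTm Γ (inl A B a) (inr A B b) (sum A B))) : Derives T (holds Γ falsum) := by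
  have hM := pow1_form (sum_form hA hB).ctx_ext
  have hl : Derives T (isTm (A :: Γ) (code top) pow1) := .pow1_intro (top_ty hA.ctx_ext)
  have hr : Derives T (isTm (B :: Γ) (code falsum) pow1) := .pow1_intro (.falsum_form hB.ctx_ext)
  have c := sum_elim_eq hA (.ty_refl hA) hB (.ty_refl hB) hM (.ty_refl hM) e (.tm_refl hl)
    (.tm_refl hr)
  have c1 := sum_comp_inl hA hB hM ha hl hr
  have c2 := sum_comp_inr hA hB hM hb hl hr
  exact falsum_of_code_eq (.tm_trans (.tm_symm c1) (.tm_trans c c2))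

theorem stab_eq_inl_inl (hA : Derives T (isTy Γ A .set)) (hB : Derives T (isTy Γ B .set))
    (sA : SEq T Γ A) (ha : Derives T (isTm Γ a A)) (ha' : Derives T (isTm Γ a' A)) :
    Derives T (holds Γ (Expr.stab (eq (sum A B) (inl A B a) (inl A B a')))) :=
  .stab_intro_sub (.eq_form (.col _) (sum_form hA hB).col (.sum_inl hA hB ha) (.sum_inl hA hB ha'))
    fun _ _ s hn => .holds_eq (.sum_inl_eq (.ty_refl (s.sub_ty hA)) (.ty_refl (s.sub_ty hB))
      ((sA.sub s).apply (s.sub_tm ha) (s.sub_tm ha') (hn.nn_eq_map (s.sub_tm ha) (s.sub_tm ha')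
        fun _ _ r h => inl_inj (r.sub_ty (s.sub_ty hA)) (r.sub_ty (s.sub_ty hB))
          (r.sub_tm (s.sub_tm ha)) (r.sub_tm (s.sub_tm ha')) h)))

theorem stab_eq_inr_inr (hA : Derives T (isTy Γ A .set)) (hB : Derives T (isTy Γ B .set))
    (sB : SEq T Γ B) (hb : Derives T (isTm Γ b B)) (hb' : Derives T (isTm Γ b' B)) :
    Derives T (holds Γ (Expr.stab (eq (sum A B) (inr A B b) (inr A B b')))) :=
  .stab_intro_sub (.eq_form (.col _) (sum_form hA hB).col (.sum_inr hA hB hb) (.sum_inr hA hB hb'))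
    fun _ _ s hn => .holds_eq (.sum_inr_eq (.ty_refl (s.sub_ty hA)) (.ty_refl (s.sub_ty hB))
      ((sB.sub s).apply (s.sub_tm hb) (s.sub_tm hb') (hn.nn_eq_map (s.sub_tm hb) (s.sub_tm hb')
        fun _ _ r h => inr_inj (r.sub_ty (s.sub_ty hA)) (r.sub_ty (s.sub_ty hB))
          (r.sub_tm (s.sub_tm hb)) (r.sub_tm (s.sub_tm hb')) h)))

/-- A refutable equality is stable. -/
theorem stab_eq_of_ne (ha : Derives T (isTm Γ a A)) (hb : Derives T (isTm Γ b A))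
    (h : ∀ Δ σ, Sb T Δ σ Γ → Derives T (eqTm Δ (a.sub σ) (b.sub σ) (A.sub σ)) →
      Derives T (holds Δ falsum)) : Derives T (holds Γ (Expr.stab (eq A a b))) :=
  have hE := eq_form (.col _) ha.of_isTm ha hb
  .stab_intro_sub hE fun _ _ s hn => (hn.nn_eq_falsum fun Δ τ r e => by
    simpa using h Δ _ (s.comp r) (by simpa using e)).ex_falso (s.sub_ty hE)

/-- Double induction gives four cases: equal tags reduce to a summand, different tags are refutable.
-/
theorem stab_eq_sum (hA : Derives T (isTy Γ A .set)) (hB : Derives T (isTy Γ B .set))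
    (sA : SEq T Γ A) (sB : SEq T Γ B) (hd : Derives T (isTm Γ d (sum A B)))
    (hd' : Derives T (isTm Γ d' (sum A B))) :
    Derives T (holds Γ (Expr.stab (eq (sum A B) d d'))) := by
  have h := sum_ind hd'.stab_eq_motive (fun Δ σ a s ha => ?_) (fun Δ σ b s hb => ?_) hd
  · simpa using h
  · have hA1 := s.sub_ty hA
    have hB1 := s.sub_ty hB
    have h := sum_ind (sum_inl hA1 hB1 ha).stab_eq_motive_right (fun Θ τ a' r ha' => ?_)
      (fun Θ τ b' r hb' => ?_) (s.sub_tm hd')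
    · simpa using h
    · simpa using stab_eq_inl_inl (r.sub_ty hA1) (r.sub_ty hB1) ((sA.sub s).sub r) (r.sub_tm ha) ha'
    · have hA2 := r.sub_ty hA1
      have hB2 := r.sub_ty hB1
      have key := stab_eq_of_ne (sum_inl hA2 hB2 (r.sub_tm ha)) (sum_inr hA2 hB2 hb') fun _ _ u e =>
        inl_ne_inr (u.sub_ty hA2) (u.sub_ty hB2) (u.sub_tm (r.sub_tm ha)) (u.sub_tm hb') e
      simpa using key
  · have hA1 := s.sub_ty hA
    have hB1 := s.sub_ty hB
    have h := sum_ind (sum_inr hA1 hB1 hb).stab_eq_motive_right (fun Θ τ a' r ha' => ?_)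
      (fun Θ τ b' r hb' => ?_) (s.sub_tm hd')
    · simpa using h
    · have hA2 := r.sub_ty hA1
      have hB2 := r.sub_ty hB1
      have key := stab_eq_of_ne (sum_inr hA2 hB2 (r.sub_tm hb)) (sum_inl hA2 hB2 ha') fun _ _ u e =>
        inl_ne_inr (u.sub_ty hA2) (u.sub_ty hB2) (u.sub_tm ha') (u.sub_tm (r.sub_tm hb))
          (.tm_symm e)
      simpa using key
    · simpa using stab_eq_inr_inr (r.sub_ty hA1) (r.sub_ty hB1) ((sB.sub s).sub r) (r.sub_tm hb) hb'

/-! #### Lists -/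

/-- Equal lists have equal images under functions defined by cases. -/
theorem elList_cons_eq {l : Tm} (hA : Derives T (isTy Γ A .set)) (hC : Derives T (isTy Γ C .col))
    (hs : Derives T (isTm Γ s (list A))) (ha : Derives T (isTm Γ a A))
    (hb : Derives T (isTm Γ b C))
    (hl : Derives T (isTm (C.wk 2 :: A.wk 1 :: list A :: Γ) l (C.wk 3)))
    (e : Derives T (eqTm Γ t (cons A s a) (list A))) :
    Derives T (eqTm Γ (elList A (C.wk 1) t b l) (l.inst₃ s a (elList A (C.wk 1) s b l)) C) := by
  have hM := wk_ty (list_form hA).col hC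
  have hb' : Derives T (isTm Γ b ((C.wk 1).inst 0 (nil A))) := by simpa using hb
  have hl' : Derives T (isTm ((C.wk 1).inst 2 (.var 1) :: A.wk 1 :: list A :: Γ) l
      ((C.wk 1).inst 3 (cons (A.wk 3) (.var 2) (.var 1)))) := by simpa using hl
  have c := list_elim_eq hA (.ty_refl hA) hM (.ty_refl hM) e (.tm_refl hb') (.tm_refl hl')
  have c' := list_comp_cons hA hM hs ha hb' hl'
  simpa using Derives.tm_trans (by simpa using c) (by simpa using c')

/-- In a branch of the list eliminator, variables `2` and `1` are the shorter list and the added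
element. Used as branches themselves, they define the two inverses of `cons`. -/
theorem list_ext_ctx (hA : Derives T (isTy Γ A .set)) (hC : Derives T (isTy Γ C .col)) :
    Derives T (isTm (C.wk 2 :: A.wk 1 :: list A :: Γ) (.var 2) (list (A.wk 3))) ∧
      Derives T (isTm (C.wk 2 :: A.wk 1 :: list A :: Γ) (.var 1) (A.wk 3)) := by
  have hwA := wk_ty (list_form hA).col hA
  have hC2 : Derives T (isTy (A.wk 1 :: list A :: Γ) (C.wk 2) .col) := by
    simpa using (Sb.shift_two hwA).sub_ty hC
  exact ⟨by simpa using var_two hC2, by simpa using var_one hC2⟩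

theorem cons_inj (hA : Derives T (isTy Γ A .set)) (hs : Derives T (isTm Γ s (list A)))
    (ha : Derives T (isTm Γ a A)) (hs' : Derives T (isTm Γ s' (list A)))
    (ha' : Derives T (isTm Γ a' A))
    (e : Derives T (eqTm Γ (cons A s a) (cons A s' a') (list A))) :
    Derives T (eqTm Γ s s' (list A)) ∧ Derives T (eqTm Γ a a' A) := by
  have hL := (list_form hA).col
  have hc := list_cons hA hs ha
  have key : ∀ {C b l}, Derives T (isTy Γ C .col) → Derives T (isTm Γ b C) →
      Derives T (isTm (C.wk 2 :: A.wk 1 :: list A :: Γ) l (C.wk 3)) →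
      Derives T (eqTm Γ (l.inst₃ s a (elList A (C.wk 1) s b l))
        (l.inst₃ s' a' (elList A (C.wk 1) s' b l)) C) := fun hC hb hl =>
    .tm_trans (.tm_symm (elList_cons_eq hA hC hs ha hb hl (.tm_refl hc)))
      (elList_cons_eq hA hC hs' ha' hb hl e)
  -- The inverses also need values on the empty list: `s` and `a` are taken.
  exact ⟨by simpa using key hL hs (list_ext_ctx hA hL).1,
    by simpa using key hA.col ha (list_ext_ctx hA hA.col).2⟩

theorem nil_ne_cons (hA : Derives T (isTy Γ A .set)) (hs : Derives T (isTm Γ s (list A)))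
    (ha : Derives T (isTm Γ a A)) (e : Derives T (eqTm Γ (nil A) (cons A s a) (list A))) :
    Derives T (holds Γ falsum) := by
  have hC := pow1_form (T := T) hA.ty_ctx
  have hL := list_form hA
  have hwA := wk_ty hL.col hA
  have hM := pow1_form hL.ctx_ext
  have hl : Derives T (isTm (pow1 :: A.wk 1 :: list A :: Γ) (code falsum) pow1) :=
    .pow1_intro (.falsum_form (pow1_form hwA.ctx_ext).ctx_ext)
  have hb : Derives T (isTm Γ (code top) pow1) := .pow1_intro (top_ty hA.ty_ctx)
  exact falsum_of_code_eq (.tm_trans (.tm_symm (.list_comp_nil hA hM hb hl))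
    (elList_cons_eq hA hC hs ha hb hl e))

/-- Stability for the shorter lists is assumed only for the given pair, since it will be an
induction hypothesis. -/
theorem stab_eq_cons (hA : Derives T (isTy Γ A .set)) (sA : SEq T Γ A)
    (hs : Derives T (isTm Γ s (list A))) (ha : Derives T (isTm Γ a A))
    (hs' : Derives T (isTm Γ s' (list A))) (ha' : Derives T (isTm Γ a' A))
    (h : Derives T (holds Γ (Expr.stab (eq (list A) s s')))) :
    Derives T (holds Γ (Expr.stab (eq (list A) (cons A s a) (cons A s' a')))) := by
  refine .stab_intro_sub (.eq_form (.col _) (list_form hA).col (.list_cons hA hs ha)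
    (.list_cons hA hs' ha')) fun Δ σ r hn => ?_
  have inj := fun Θ τ (u : Sb T Θ τ Δ) e => cons_inj (u.sub_ty (r.sub_ty hA)) (u.sub_tm
    (r.sub_tm hs))
    (u.sub_tm (r.sub_tm ha)) (u.sub_tm (r.sub_tm hs')) (u.sub_tm (r.sub_tm ha')) e
  have e1 := (sA.sub r).apply (r.sub_tm ha) (r.sub_tm ha') (hn.nn_eq_map (r.sub_tm ha)
    (r.sub_tm ha') fun Θ τ u e => (inj Θ τ u e).2)
  have e2 := ((r.sub_tm h).mp (hn.nn_eq_map (r.sub_tm hs) (r.sub_tm hs')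
    fun Θ τ u e => (inj Θ τ u e).1)).eq_of_holds
  exact .holds_eq (.list_cons_eq (.ty_refl (r.sub_ty hA)) e2 e1)

theorem stab_eq_list (hA : Derives T (isTy Γ A .set)) (sA : SEq T Γ A)
    (hd : Derives T (isTm Γ d (list A))) (hd' : Derives T (isTm Γ d' (list A))) :
    Derives T (holds Γ (Expr.stab (eq (list A) d d'))) := by
  have hL := (list_form hA).col
  have hLL := wk_ty hL hL
  have hE : ∀ {Δ σ c}, Sb T Δ σ Γ → Derives T (isTm Δ c ((list A).sub σ)) →
      Derives T (isTy (list (A.sub σ) :: Δ) (Expr.stab (eq (list (A.sub (cmp σ (shift 1))))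
        (c.sub (shift 1)) (.var 0))) .prop) := fun s hc => by
    simpa using hc.stab_eq_motive_right
  -- The motive quantifies over the second list, so that the induction hypothesis can be applied to
  -- whatever list its last element was added to.
  have hP : Derives T (isTy (list A :: Γ) (all ((list A).wk 1)
      (Expr.stab (eq ((list A).wk 2) (.var 1) (.var 0)))) .prop) := by
    refine .all_form .large hLL ?_
    simpa using (var_zero hL.ctx_ext).stab_eq_motive_right
  have h := list_ind hP ?_ (fun Δ σ s a r hs ha ih => ?_) hd
  · have := h.all_apply (a := d') (by simpa using hd')
    simpa using this
  · have key := all_intro_sub hL (list_nil hA).stab_eq_motive_right fun Δ σ t r ht => by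
      have hA1 := r.sub_ty hA
      have h := list_ind (list_nil hA1).stab_eq_motive_right ?_ (fun Θ τ s' a' u hs' ha' _ => ?_) ht
      · simpa using h
      · simpa using stab_of_holds (holds_eq (tm_refl (list_nil hA1)))
      · have hA2 := u.sub_ty hA1
        simpa using stab_eq_of_ne (list_nil hA2) (list_cons hA2 hs' ha') fun _ _ v e =>
          nil_ne_cons (v.sub_ty hA2) (v.sub_tm hs') (v.sub_tm ha') e
    simpa using key
  · have hA1 := r.sub_ty hA
    have key := all_intro_sub (list_form hA1).col (list_cons hA1 hs ha).stab_eq_motive_right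
      fun Δ' σ' t r' ht => by
        have hA2 := r'.sub_ty hA1
        have h := list_ind (list_cons hA2 (r'.sub_tm hs) (r'.sub_tm ha)).stab_eq_motive_right ?_
          (fun Θ τ s' a' u hs' ha' _ => ?_) ht
        · simpa using h
        · have := stab_eq_of_ne (list_cons hA2 (r'.sub_tm hs) (r'.sub_tm ha)) (list_nil hA2)
            fun _ _ v e => nil_ne_cons (v.sub_ty hA2) (v.sub_tm (r'.sub_tm hs))
              (v.sub_tm (r'.sub_tm ha)) (.tm_symm e)
          simpa using this
        · have ih' := (u.sub_tm (r'.sub_tm ih)).all_apply (a := s') (by simpa using hs')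
          have := stab_eq_cons (u.sub_ty hA2) (((sA.sub r).sub r').sub u)
            (u.sub_tm (r'.sub_tm hs)) (u.sub_tm (r'.sub_tm ha)) hs' ha' (by simpa using ih')
          simpa using this
    simpa using key

/-! #### Quotients -/

/-- Effectiveness leads from equality of classes to `R` under the double negation, where stability
of `R` removes it. -/
theorem stab_eq_cls (hQ : Derives T (isTy Γ (quot A R) .set))
    (hR : Derives T (holds (A.wk 1 :: A :: Γ) (Expr.stab R)))
    (ha : Derives T (isTm Γ a A)) (hb : Derives T (isTm Γ b A)) :
    Derives T (holds Γ (Expr.stab (eq (quot A R) (cls A R a) (cls A R b)))) := by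
  refine .stab_intro_sub (.eq_form (.col _) hQ.col (.quot_intro hQ ha) (.quot_intro hQ hb))
    fun Δ σ s hn => ?_
  have sR := s.sub_tm (((Sb.single ha).cons (A := A.wk 1) (t := b) (by simpa using hb)).sub_tm hR)
  have hr := nn_elim hn sR fun Θ τ r h => by
    have := Derives.quot_eff (r.sub_ty (s.sub_ty hQ)) (r.sub_tm (s.sub_tm ha))
      (r.sub_tm (s.sub_tm hb)) h.eq_of_holds
    simpa using this
  exact .holds_eq (.quot_eq (s.sub_ty hQ) (s.sub_tm ha) (s.sub_tm hb) (by simpa using hr))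

theorem stab_eq_quot (hQ : Derives T (isTy Γ (quot A R) .set))
    (hR : Derives T (holds (A.wk 1 :: A :: Γ) (Expr.stab R)))
    (hd : Derives T (isTm Γ d (quot A R))) (hd' : Derives T (isTm Γ d' (quot A R))) :
    Derives T (holds Γ (Expr.stab (eq (quot A R) d d'))) := by
  have hA : Derives T (isTy Γ A .set) := hQ.inv.1.1
  have hRs : ∀ {Δ σ}, Sb T Δ σ Γ → Derives T (holds ((A.sub σ).wk 1 :: A.sub σ :: Δ)
      (Expr.stab (R.sub (up (up σ))))) := fun s => by
    have := ((s.up hA).up (wk_ty hA.col hA)).sub_tm hR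
    simpa using this
  have h := quot_ind hQ hd'.stab_eq_motive (fun Δ σ a s ha => ?_) hd
  · simpa using h
  have hQ1 := s.sub_ty hQ
  have h := quot_ind hQ1 (quot_intro hQ1 ha).stab_eq_motive_right (fun Θ τ a' r ha' => ?_)
    (s.sub_tm hd')
  · simpa using h
  · have hRr := hRs (s.comp r)
    have := stab_eq_cls (r.sub_ty hQ1) (by simpa using hRr) (r.sub_tm ha) ha'
    simpa using this

end Derives

theorem SEq.sum (hA : Derives T (isTy Γ A .set)) (hB : Derives T (isTy Γ B .set)) (sA : SEq T Γ A)
    (sB : SEq T Γ B) : SEq T Γ (sum A B) :=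
  .of_stab fun _ _ _ _ s ha hb => .stab_eq_sum (s.sub_ty hA) (s.sub_ty hB) (sA.sub s)
    (sB.sub s) ha hb

theorem SEq.list (hA : Derives T (isTy Γ A .set)) (sA : SEq T Γ A) : SEq T Γ (list A) :=
  .of_stab fun _ _ _ _ s ha hb => .stab_eq_list (s.sub_ty hA) (sA.sub s) ha hb

theorem SEq.quot (hQ : Derives T (isTy Γ (quot A R) .set))
    (hR : Derives T (holds (A.wk 1 :: A :: Γ) (stab R))) : SEq T Γ (quot A R) := by
  have hA : Derives T (isTy Γ A .set) := hQ.inv.1.1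
  refine .of_stab fun _ _ _ _ s ha hb => .stab_eq_quot (s.sub_ty hQ) ?_ ha hb
  have := ((s.up hA).up (Derives.wk_ty hA.col hA)).sub_tm hR
  simpa using this

end

section
variable {T : Theory} {Γ Δ Θ : Ctx} {σ τ : ℕ → Tm} {A A' B B' P P' Q C R : Ty}
  {a a' b b' d d' f g u u' U V : Tm} {k : Kind}

namespace Derives

/-! ### Subcollections -/

theorem subset_tm (hA : Derives T (isTy Γ A .col)) (hP : Derives T (isTy (A :: Γ) P .prop))
    (ha : Derives T (isTm Γ a A)) (h : Derives T (holds Γ (P.inst 0 a))) :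
    Derives T (isTm Γ (pair A P a (triv (P.inst 0 a))) (sigma A P)) :=
  .sigma_intro hA hP.col ha h

/-- The second components are proofs, hence equal once they are placed in the same instance of `P`.
-/
theorem subset_pair_eq (hA : Derives T (isTy Γ A .col)) (hP : Derives T (isTy (A :: Γ) P .prop))
    (e : Derives T (eqTm Γ a a' A)) (hb : Derives T (isTm Γ b (P.inst 0 a)))
    (hb' : Derives T (isTm Γ b' (P.inst 0 a'))) :
    Derives T (eqTm Γ (pair A P a b) (pair A P a' b') (sigma A P)) :=
  .sigma_intro_eq hA (.ty_refl hA) hP.col (.ty_refl hP.col) e (.prop_mono (hP.inst_ty e.left) hb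
    (.conv hb' (.ty_symm ((ty_refl hP).inst_eqTy hP e.left e.right e).eq_col)))

theorem subset_snd (hP : Derives T (isTy (A :: Γ) P .prop)) (hd : Derives T (isTm Γ d
    (sigma A P))) :
    Derives T (holds Γ (P.inst 0 (proj₁ A P d))) := by
  have hA := hd.of_isTm.inv.1.1
  have h := sigma_ind (snd_ty hA hP) (fun Δ σ a b s ha hb => ?_) hd
  · simpa using h
  · have hA' := s.sub_ty hA
    have hP' := (s.up hA).sub_ty hP
    have p := proj₁_pair hA' hP'.col ha (b := b) (by simpa using hb)
    have e := (ty_refl hP').inst_eqTy hP' p.right p.left (.tm_symm p)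
    have hb' := prop_true (P := P.sub (scons a σ)) (by simpa using e.presup.1) hb
    have := hb'.holds_conv (Q := (P.sub (up σ)).inst 0 (proj₁ (A.sub σ) (P.sub (up σ))
      (pair (A.sub σ) (P.sub (up σ)) a b))) (by simpa using e)
    simpa using this

/-- Dependent sums have no judgemental $\eta$ rule. The propositional equality is proved by
induction on the sum and then reflected. -/
theorem subset_eta (hP : Derives T (isTy (A :: Γ) P .prop)) (hd : Derives T (isTm Γ d
    (sigma A P))) :
    Derives T (eqTm Γ (pair A P (proj₁ A P d) (triv (P.inst 0 (proj₁ A P d)))) d (sigma A P)) := by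
  have hS := hd.of_isTm
  have hA := hS.inv.1.1
  have s := Sb.shift_one hS.ctx_ext
  have hv := var_zero hS.ctx_ext
  have hA1 := s.sub_ty hA
  have hP1 := (s.up hA).sub_ty hP
  have hv' : Derives T (isTm (sigma A P :: Γ) (.var 0) (sigma (A.sub (shift 1)) (P.sub (up
    (shift 1))))) := by
    simpa using hv
  have hp := subset_tm hA1 hP1 (proj₁_tm hv') (subset_snd hP1 hv')
  have h := sigma_ind (P := eq _ _ _) (eq_form (.col _) hp.of_isTm hp hv')
    (fun Δ σ a b r ha hb => ?_) hd
  · exact eq_of_holds (by simpa using h)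
  · have hA2 := r.sub_ty hA
    have hP2 := (r.up hA).sub_ty hP
    have hb2 : Derives T (isTm Δ b ((P.sub (up σ)).inst 0 a)) := by simpa using hb
    have p := proj₁_pair hA2 hP2.col ha hb2
    have := holds_eq (subset_pair_eq hA2 hP2 p
      (subset_snd hP2 (sigma_intro hA2 hP2.col ha hb2)) hb2)
    simpa using this

theorem subset_ext (hP : Derives T (isTy (A :: Γ) P .prop)) (hd : Derives T (isTm Γ d (sigma A P)))
    (hd' : Derives T (isTm Γ d' (sigma A P)))
    (e : Derives T (eqTm Γ (proj₁ A P d) (proj₁ A P d') A)) :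
    Derives T (eqTm Γ d d' (sigma A P)) :=
  .tm_trans (.tm_symm (subset_eta hP hd)) (.tm_trans (subset_pair_eq hd.of_isTm.inv.1.1 hP e
    (subset_snd hP hd) (subset_snd hP hd')) (subset_eta hP hd'))

/-! ### Stable propositions in the power collection of the singleton -/

theorem dc_congr (e : Derives T (eqTm Γ U V pow1)) (h : Derives T (holds Γ (Expr.dc U))) :
    Derives T (holds Γ (Expr.dc V)) :=
  .holds_eq (.tm_trans (.tm_symm e) h.eq_of_holds)

/-- Extensionality of `pow1`, through $U=[\mathsf{Dc}(U)]$. -/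
theorem eq_of_dc_imp (hU : Derives T (isTm Γ U pow1)) (hV : Derives T (isTm Γ V pow1))
    (h : Derives T (holds Γ (imp (Expr.dc U) (Expr.dc V))))
    (h' : Derives T (holds Γ (imp (Expr.dc V) (Expr.dc U)))) : Derives T (eqTm Γ U V pow1) :=
  .tm_trans (.pow1_eta hU) (.tm_trans (.pow1_eq hU.dc hV.dc (.and h h')) (.tm_symm (.pow1_eta hV)))

theorem dc_prop (hU : Derives T (isTm Γ U pow1)) : Derives T (isTy Γ (Expr.dc U) .prop) :=
  hU.dc.prop .small

/-- To derive $\mathsf{Dc}(V)$ from $\mathsf{Dc}(U)$, stability of the goal allows $U=V$ to be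
assumed; and symmetrically. This is why `pow1` is restricted to its stable elements. -/
theorem pow1_eq_of_nn (hU : Derives T (holds Γ (Expr.stab (Expr.dc U))))
    (hV : Derives T (holds Γ (Expr.stab (Expr.dc V))))
    (hn : Derives T (holds Γ (Expr.neg (Expr.neg (eq pow1 U V))))) :
    Derives T (eqTm Γ U V pow1) := by
  have i : Derives T (isTm Γ U pow1) ∧ Derives T (isTm Γ V pow1) :=
    hn.prop_of_holds.imp_inv.1.imp_inv.1.inv.1.2
  refine eq_of_dc_imp i.1 i.2
    (.imp_intro_sub (dc_prop i.1) (dc_prop i.2) fun Δ σ s h => nn_elim (s.sub_tm hn) (s.sub_tm hV)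
      fun Θ τ r e => dc_congr e.eq_of_holds (r.sub_tm h))
    (.imp_intro_sub (dc_prop i.2) (dc_prop i.1) fun Δ σ s h => nn_elim (s.sub_tm hn) (s.sub_tm hU)
      fun Θ τ r e => dc_congr (.tm_symm e.eq_of_holds) (r.sub_tm h))

theorem stab_eq_pow1 (hU : Derives T (holds Γ (Expr.stab (Expr.dc U))))
    (hV : Derives T (holds Γ (Expr.stab (Expr.dc V)))) :
    Derives T (holds Γ (Expr.stab (eq pow1 U V))) := by
  have iU : Derives T (isTm Γ U pow1) := hU.prop_of_holds.imp_inv.2.inv.1.2.1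
  have iV : Derives T (isTm Γ V pow1) := hV.prop_of_holds.imp_inv.2.inv.1.2.1
  exact .stab_intro_sub (.eq_form (.col _) iU.of_isTm iU iV) fun Δ σ s hn =>
    .holds_eq (pow1_eq_of_nn (s.sub_tm hU) (s.sub_tm hV) hn)

theorem dc_code (hP : Derives T (isTy Γ P .props)) (h : Derives T (holds Γ P)) :
    Derives T (holds Γ (Expr.dc (code P))) := by
  have tP := hP.prop .small
  have tT := (top_ty (T := T) h.tm_ctx).prop .small
  exact .holds_eq (.pow1_eq hP (top_ty h.tm_ctx) (.and
    (.imp_intro_sub tP tT fun _ _ s _ => top_holds s.ctx) (.imp_intro_sub tT tP fun _ _ s _ =>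
      s.sub_tm h)))

theorem of_dc_code (hP : Derives T (isTy Γ P .props)) (h : Derives T (holds Γ (Expr.dc (code P)))) :
    Derives T (holds Γ P) :=
  (Derives.pow1_eff hP (top_ty h.tm_ctx) h.eq_of_holds).snd.mp (top_holds h.tm_ctx)

/-- $\mathsf{Dc}([P])$ and $P$ are equiprovable. -/
theorem stab_dc_code (hP : Derives T (isTy Γ P .props)) (h : Derives T (holds Γ (Expr.stab P))) :
    Derives T (holds Γ (Expr.stab (Expr.dc (code P)))) :=
  .stab_intro_sub (dc_prop (.pow1_intro hP)) fun _ _ s hn => dc_code (s.sub_ty hP)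
    (hn.nn_elim (s.sub_tm h) fun _ _ r h => of_dc_code (r.sub_ty (s.sub_ty hP)) h)

theorem stab_dc_congr (e : Derives T (eqTm Γ U V pow1)) (h : Derives T (holds Γ (Expr.stab
    (Expr.dc U)))) :
    Derives T (holds Γ (Expr.stab (Expr.dc V))) :=
  .stab_intro_sub (dc_prop e.right) fun _ _ s hn => dc_congr (s.sub_eqTm e)
    (hn.nn_elim (s.sub_tm h) fun _ _ r h => dc_congr (r.sub_eqTm (s.sub_eqTm (.tm_symm e))) h)

theorem stab_dc_var (h : Derives T (.ctx Γ)) :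
    Derives T (isTy (pow1 :: Γ) (Expr.stab (Expr.dc (.var 0))) .prop) :=
  (dc_prop (var_zero (pow1_form h).ctx_ext)).stab .large

theorem stabPow1_form (h : Derives T (.ctx Γ)) : Derives T (isTy Γ stabPow1 .col) :=
  .sigma_form .col (.pow1_form h) (stab_dc_var h).col

theorem fromStab_tm (hu : Derives T (isTm Γ u stabPow1)) : Derives T (isTm Γ (fromStab u) pow1) :=
  proj₁_tm hu

theorem fromStab_congr (e : Derives T (eqTm Γ u u' stabPow1)) :
    Derives T (eqTm Γ (fromStab u) (fromStab u') pow1) :=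
  proj₁_congr e

theorem fromStab_stab (hu : Derives T (isTm Γ u stabPow1)) :
    Derives T (holds Γ (Expr.stab (Expr.dc (fromStab u)))) :=
  subset_snd (stab_dc_var hu.tm_ctx) hu

theorem toStab_tm (h : Derives T (holds Γ (Expr.stab (Expr.dc U)))) :
    Derives T (isTm Γ (toStab U) stabPow1) :=
  subset_tm (.pow1_form h.tm_ctx) (stab_dc_var h.tm_ctx) h.prop_of_holds.imp_inv.2.inv.1.2.1 h

theorem toStab_congr (h : Derives T (holds Γ (Expr.stab (Expr.dc U)))) (e : Derives T
    (eqTm Γ U V pow1)) :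
    Derives T (eqTm Γ (toStab U) (toStab V) stabPow1) :=
  subset_pair_eq (.pow1_form h.tm_ctx) (stab_dc_var h.tm_ctx) e h (stab_dc_congr e h)

theorem fromStab_toStab (h : Derives T (holds Γ (Expr.stab (Expr.dc U)))) :
    Derives T (eqTm Γ (fromStab (toStab U)) U pow1) :=
  proj₁_pair (.pow1_form h.tm_ctx) (stab_dc_var h.tm_ctx).col h.prop_of_holds.imp_inv.2.inv.1.2.1 h

theorem toStab_fromStab (hu : Derives T (isTm Γ u stabPow1)) :
    Derives T (eqTm Γ (toStab (fromStab u)) u stabPow1) :=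
  subset_eta (stab_dc_var hu.tm_ctx) hu

theorem stabPow1_ext (hu : Derives T (isTm Γ u stabPow1)) (hu' : Derives T (isTm Γ u' stabPow1))
    (e : Derives T (eqTm Γ (fromStab u) (fromStab u') pow1)) : Derives T (eqTm Γ u u' stabPow1) :=
  subset_ext (stab_dc_var hu.tm_ctx) hu hu' e

end Derives

theorem SEq.stabPow1 : SEq T Γ stabPow1 := by
  intro Δ σ u u' s hu hu' hn
  rw [stabPow1_sub] at *
  exact .stabPow1_ext hu hu' (.pow1_eq_of_nn (.fromStab_stab hu) (.fromStab_stab hu')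
    (hn.nn_eq_map (.fromStab_tm hu) (.fromStab_tm hu') fun Θ τ r e => by
      simpa using Derives.fromStab_congr (by simpa using e)))

/-! ### Functions with stable values -/

/-- The values of the function given by the variable `0` are stable. -/
def stabVals (A : Ty) : Ty := all (A.wk 1) (stab (dc (app (A.wk 2) pow1 (.var 1) (.var 0))))

/-- The right-hand side is the proposition recorded in the proof component of `toStabPow`. -/
theorem stabVals_inst (A : Ty) (g : Tm) :
    (stabVals A).inst 0 g = all A (stab (dc (app (A.wk 1) pow1 (g.wk 1) (.var 0)))) := by
  simp [stabVals]

namespace Derives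

theorem app_wk_pow1 (hA : Derives T (isTy Γ A .set)) (hg : Derives T (isTm Γ g (pi A pow1))) :
    Derives T (isTm (A :: Γ) (app (A.wk 1) pow1 (g.wk 1) (.var 0)) pow1) :=
  app_wk .pow1 hA (.pow1_form hA.ctx_ext) hg

theorem powA_form (hA : Derives T (isTy Γ A .set)) : Derives T (isTy Γ (pi A pow1) .col) :=
  .pi_form .pow1 hA (.pow1_form hA.ctx_ext)

theorem stabVals_form (hA : Derives T (isTy Γ A .set)) :
    Derives T (isTy (pi A pow1 :: Γ) (stabVals A) .prop) := by
  have hF := powA_form hA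
  have hA1 := wk_ty hF hA
  refine .all_form .large hA1.col ((dc_prop ?_).stab .large)
  have := app_wk_pow1 hA1 (g := .var 0) (by simpa using var_zero hF.ctx_ext)
  simpa using this

theorem stabPow_form (hA : Derives T (isTy Γ A .set)) : Derives T (isTy Γ (stabPow A) .col) :=
  .sigma_form .col (powA_form hA) (stabVals_form hA).col

theorem fromStabPow_tm (hf : Derives T (isTm Γ f (stabPow A))) :
    Derives T (isTm Γ (fromStabPow A f) (pi A pow1)) :=
  proj₁_tm hf

theorem fromStabPow_congr (e : Derives T (eqTm Γ f g (stabPow A))) :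
    Derives T (eqTm Γ (fromStabPow A f) (fromStabPow A g) (pi A pow1)) :=
  proj₁_congr e

theorem app_stab (hA : Derives T (isTy Γ A .set)) (hf : Derives T (isTm Γ f (stabPow A)))
    (ha : Derives T (isTm Γ a A)) :
    Derives T (holds Γ (Expr.stab (Expr.dc (app A pow1 (fromStabPow A f) a)))) := by
  have h := subset_snd (stabVals_form hA) hf
  rw [stabVals_inst] at h
  have h := h.all_apply ha
  simp at h
  exact h

theorem toStabPow_tm (hA : Derives T (isTy Γ A .set)) (hg : Derives T (isTm Γ g (pi A pow1)))
    (h : Derives T (holds (A :: Γ) (Expr.stab (Expr.dc (app (A.wk 1) pow1 (g.wk 1) (.var 0)))))) :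
    Derives T (isTm Γ (toStabPow A g) (stabPow A)) :=
  .sigma_intro (powA_form hA) (stabVals_form hA).col hg (by
    change Derives T (isTm _ _ ((stabVals A).inst 0 g))
    rw [stabVals_inst]
    exact .all_intro hA.col h.prop_of_holds h)

theorem fromStabPow_toStabPow (hA : Derives T (isTy Γ A .set)) (hg : Derives T (isTm Γ g
    (pi A pow1)))
    (h : Derives T (holds (A :: Γ) (Expr.stab (Expr.dc (app (A.wk 1) pow1 (g.wk 1) (.var 0)))))) :
    Derives T (eqTm Γ (fromStabPow A (toStabPow A g)) g (pi A pow1)) :=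
  proj₁_pair (powA_form hA) (stabVals_form hA).col hg (by
    change Derives T (isTm _ _ ((stabVals A).inst 0 g))
    rw [stabVals_inst]
    exact .all_intro hA.col h.prop_of_holds h)

theorem stabPow_ext (hA : Derives T (isTy Γ A .set)) (hf : Derives T (isTm Γ f (stabPow A)))
    (hg : Derives T (isTm Γ g (stabPow A)))
    (e : Derives T (eqTm Γ (fromStabPow A f) (fromStabPow A g) (pi A pow1))) :
    Derives T (eqTm Γ f g (stabPow A)) :=
  subset_ext (stabVals_form hA) hf hg e

theorem app_congr_pow1 (hA : Derives T (isTy Γ A .set)) (eA : Derives T (eqTy Γ A A' .set))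
    (ef : Derives T (eqTm Γ f g (pi A pow1))) (ea : Derives T (eqTm Γ a a' A)) :
    Derives T (eqTm Γ (app A pow1 f a) (app A' pow1 g a') pow1) :=
  .pi_elim_eq .pow1 hA eA (.pow1_form hA.ctx_ext) (.ty_refl (.pow1_form hA.ctx_ext)) ef ea

end Derives

/-- `SEq.sigma` and `SEq.pi` do not apply, since equality of `pow1` is not known to be stable. Two
functions are compared at a fresh argument, where both values are stable. -/
theorem SEq.stabPow (hA : Derives T (isTy Γ A .set)) : SEq T Γ (stabPow A) := by
  intro Δ σ f g s hf hg hn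
  have hB := s.sub_ty hA
  rw [stabPow_sub] at *
  generalize A.sub σ = B at *
  have w := Sb.shift_one hB.ctx_ext
  have hB2 := Derives.wk_ty hB.col hB
  have hf2 := Derives.wk_tm hB.col hf
  have hg2 := Derives.wk_tm hB.col hg
  have hv := Derives.var_zero hB.ctx_ext
  rw [wk_eq 1 (Expr.stabPow B), stabPow_sub, ← wk_eq] at hf2 hg2
  have tf := Derives.app_stab hB2 hf2 hv
  have tg := Derives.app_stab hB2 hg2 hv
  refine .stabPow_ext hB hf hg (.pi_ext .pow1 hB (.pow1_form hB.ctx_ext) (.fromStabPow_tm hf)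
    (.fromStabPow_tm hg) ?_)
  have key := Derives.pow1_eq_of_nn tf tg ((w.sub_tm hn).nn_eq_map
    tf.prop_of_holds.imp_inv.2.inv.1.2.1 tg.prop_of_holds.imp_inv.2.inv.1.2.1 fun Θ τ r e => ?_)
  · simpa using key
  · have := Derives.app_congr_pow1 (r.sub_ty hB2) (.ty_refl (r.sub_ty hB2))
      (.fromStabPow_congr (A := (B.wk 1).sub τ) (by simpa using e)) (.tm_refl (r.sub_tm hv))
    simpa using this

end

section
variable {T : Theory} {Γ Δ Θ : Ctx} {σ τ : ℕ → Tm} {A A' B B' P P' Q Q' C R : Ty}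
  {a a' b b' c d d' f g u u' U V : Tm} {k : Kind}

namespace Derives

/-! ### Congruence rules for the translated constructors -/

theorem neg_form_eq (e : Derives T (eqTy Γ P P' k)) (hk : k.Logical) :
    Derives T (eqTy Γ (Expr.neg P) (Expr.neg P') k) := by
  refine .imp_form_eq hk e (.ty_refl ?_)
  have hF := falsum_form (T := T) e.presup.1.ty_ctx
  cases hk
  · exact hF
  · exact .incl .props_prop hF

theorem stab_form_eq (e : Derives T (eqTy Γ P P' k)) (hk : k.Logical) :
    Derives T (eqTy Γ (Expr.stab P) (Expr.stab P') k) :=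
  .imp_form_eq hk (neg_form_eq (neg_form_eq e hk) hk) e

theorem dc_form_eq (e : Derives T (eqTm Γ U V pow1)) :
    Derives T (eqTy Γ (Expr.dc U) (Expr.dc V) .props) :=
  .eq_form_eq .pow1 e.left.of_isTm (.ty_refl e.left.of_isTm) e
    (.tm_refl (.pow1_intro (top_ty e.left.tm_ctx)))

/-- Congruence of `code` is not a primitive rule; it follows because equal propositions are
equiprovable. -/
theorem code_congr (e : Derives T (eqTy Γ P Q .props)) :
    Derives T (eqTm Γ (code P) (code Q) pow1) := by
  have hP := e.presup.1.prop .small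
  have hQ := e.presup.2.prop .small
  exact .pow1_eq e.presup.1 e.presup.2 (.and
    (.imp_intro_sub hP hQ fun _ _ s h => h.holds_conv (.eq_incl .props_prop (s.sub_eqTy e)))
    (.imp_intro_sub hQ hP fun _ _ s h => h.holds_conv (.eq_incl .props_prop (s.sub_eqTy
      (.ty_symm e)))))

/-- Congruence in the annotations as well, needed because the translation of an application contains
its domain. -/
theorem proj₁_congr_ann (eA : Derives T (eqTy Γ A A' .col)) (eB : Derives T (eqTy
    (A :: Γ) B B' .col))
    (e : Derives T (eqTm Γ d d' (sigma A B))) :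
    Derives T (eqTm Γ (proj₁ A B d) (proj₁ A' B' d') A) := by
  have i := e.left.of_isTm.inv.1
  have w : Derives T (eqTy (sigma A B :: Γ) (A.wk 1) (A'.wk 1) .col) := by
    simpa using (Sb.shift_one e.left.of_isTm.ctx_ext).sub_eqTy eA
  simpa [proj₁] using Derives.sigma_elim_eq i.1 eA i.2 eB (wk_fst i.1 i.2) w e
    (m := .var 1) (m' := .var 1) (.tm_refl (by simpa using var_one i.2))

theorem powA_form_eq (eA : Derives T (eqTy Γ A A' .set)) :
    Derives T (eqTy Γ (pi A pow1) (pi A' pow1) .col) :=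
  have h := pow1_form eA.presup.1.ctx_ext
  .pi_form_eq .pow1 eA.presup.1 eA h (.ty_refl h)

theorem stabVals_form_eq (eA : Derives T (eqTy Γ A A' .set)) :
    Derives T (eqTy (pi A pow1 :: Γ) (stabVals A) (stabVals A') .prop) := by
  have hA := eA.presup.1
  have hF := powA_form hA
  have s := Sb.shift_one hF.ctx_ext
  have eA1 : Derives T (eqTy (pi A pow1 :: Γ) (A.wk 1) (A'.wk 1) .set) := by
      simpa using s.sub_eqTy eA
  have hA1 := eA1.presup.1
  refine .all_form_eq .large hA1.col eA1.eq_col (stab_form_eq (.eq_incl .props_prop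
    (dc_form_eq ?_)) .large)
  have s2 := Sb.shift_two hA1
  refine .app_congr_pow1 (by simpa using s2.sub_ty hA) (by simpa using s2.sub_eqTy eA) (.tm_refl ?_)
    (.tm_refl ?_)
  · simpa using var_one hA1
  · simpa using var_zero hA1.ctx_ext

theorem stabPow_form_eq (eA : Derives T (eqTy Γ A A' .set)) :
    Derives T (eqTy Γ (stabPow A) (stabPow A') .col) :=
  .sigma_form_eq .col (powA_form eA.presup.1) (powA_form_eq eA) (stabVals_form eA.presup.1).col
    (stabVals_form_eq eA).eq_col

theorem fromStabPow_congr_ann (eA : Derives T (eqTy Γ A A' .set))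
    (e : Derives T (eqTm Γ f g (stabPow A))) :
    Derives T (eqTm Γ (fromStabPow A f) (fromStabPow A' g) (pi A pow1)) :=
  proj₁_congr_ann (powA_form_eq eA) (stabVals_form_eq eA).eq_col e

theorem toStabPow_congr (eA : Derives T (eqTy Γ A A' .set)) (eg : Derives T (eqTm Γ f g
    (pi A pow1)))
    (h : Derives T (holds (A :: Γ) (Expr.stab (Expr.dc (app (A.wk 1) pow1 (f.wk 1) (.var 0))))))
    (h' : Derives T (holds (A' :: Γ) (Expr.stab (Expr.dc (app (A'.wk 1) pow1 (g.wk 1)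
      (.var 0)))))) :
    Derives T (eqTm Γ (toStabPow A f) (toStabPow A' g) (stabPow A)) := by
  have hA := eA.presup.1
  have eV := stabVals_form_eq eA
  have e := (eV.inst_eqTy eV.presup.2 eg.left eg.right eg).eq_col
  refine .sigma_intro_eq (powA_form hA) (powA_form_eq eA) (stabVals_form hA).col eV.eq_col eg ?_
  refine .prop_mono ((stabVals_form hA).inst_ty eg.left) ?_ (.conv ?_ (.ty_symm e))
  · change Derives T (isTm _ _ ((stabVals A).inst 0 f))
    rw [stabVals_inst]
    exact .all_intro hA.col h.prop_of_holds h
  · rw [stabVals_inst]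
    exact .all_intro eA.presup.2.col h'.prop_of_holds h'

theorem app_wk_lam (hA : Derives T (isTy Γ A .set)) (hc : Derives T (isTm (A :: Γ) c pow1)) :
    Derives T (eqTm (A :: Γ) (app (A.wk 1) pow1 ((lam A pow1 c).wk 1) (.var 0)) c pow1) := by
  have hA1 := wk_ty hA.col hA
  have w := (Sb.shift_one hA.ctx_ext).up hA
  have := pi_beta .pow1 hA1 (pow1_form hA1.ctx_ext) (b := c.sub (up (shift 1)))
    (by simpa using w.sub_tm hc) (var_zero hA.ctx_ext)
  simpa using this

theorem stab_app_lam (hA : Derives T (isTy Γ A .set)) (hb : Derives T (isTm (A :: Γ) b stabPow1)) :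
    Derives T (holds (A :: Γ) (Expr.stab (Expr.dc (app (A.wk 1) pow1
      ((lam A pow1 (fromStab b)).wk 1) (.var 0))))) :=
  stab_dc_congr (.tm_symm (app_wk_lam hA (fromStab_tm hb))) (fromStab_stab hb)

theorem lam_fromStab_tm (hA : Derives T (isTy Γ A .set)) (hb : Derives T (isTm
    (A :: Γ) b stabPow1)) :
    Derives T (isTm Γ (lam A pow1 (fromStab b)) (pi A pow1)) :=
  .pi_intro .pow1 hA (.pow1_form hA.ctx_ext) (fromStab_tm hb)

/-- Three reductions are chained: the projection of a pair, $\beta$ for functions into `pow1`, and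
the surjectivity of pairing in `stabPow1`. -/
theorem stabPow_beta (hA : Derives T (isTy Γ A .set)) (hb : Derives T (isTm (A :: Γ) b stabPow1))
    (ha : Derives T (isTm Γ a A)) :
    Derives T (eqTm Γ (toStab (app A pow1 (fromStabPow A (toStabPow A (lam A pow1
      (fromStab b)))) a))
      (b.inst 0 a) stabPow1) := by
  have hp := pow1_form hA.ctx_ext
  have ht := toStabPow_tm hA (lam_fromStab_tm hA hb) (stab_app_lam hA hb)
  have e := fromStabPow_toStabPow hA (lam_fromStab_tm hA hb) (stab_app_lam hA hb)
  have e1 := app_congr_pow1 hA (.ty_refl hA) e (.tm_refl ha)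
  have e2 := pi_beta .pow1 hA hp (fromStab_tm hb) ha
  have hba : Derives T (isTm Γ (b.inst 0 a) stabPow1) := by simpa using (Sb.single ha).sub_tm hb
  have e3 := toStab_congr (app_stab hA ht ha) (.tm_trans e1 e2)
  exact .tm_trans (by simpa using e3) (by simpa using toStab_fromStab hba)

/-- By extensionality of the subcollection it is enough to compare underlying functions, where it is
$\eta$ for functions into `pow1`. -/
theorem stabPow_eta (hA : Derives T (isTy Γ A .set)) (hf : Derives T (isTm Γ f (stabPow A))) :
    Derives T (eqTm Γ (toStabPow A (lam A pow1 (fromStab (toStab (app (A.wk 1) pow1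
      (fromStabPow (A.wk 1) (f.wk 1)) (.var 0)))))) f (stabPow A)) := by
  have hp := pow1_form hA.ctx_ext
  have hA1 := wk_ty hA.col hA
  have hf1 := wk_tm hA.col hf
  rw [wk_eq 1 (stabPow A), stabPow_sub, ← wk_eq] at hf1
  have st := app_stab hA1 hf1 (var_zero hA.ctx_ext)
  have hb := toStab_tm st
  refine .stabPow_ext hA (toStabPow_tm hA (lam_fromStab_tm hA hb) (stab_app_lam hA hb)) hf ?_
  refine .tm_trans (fromStabPow_toStabPow hA (lam_fromStab_tm hA hb) (stab_app_lam hA hb)) ?_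
  refine .tm_trans (.pi_intro_eq .pow1 hA (.ty_refl hA) hp (.ty_refl hp) (fromStab_toStab st)) ?_
  have := pi_eta .pow1 hA hp (fromStabPow_tm hf)
  simpa using this

/-- The translation of $U=[\mathsf{Dc}(U)]$: the translated decoding compares $\pi_1(U)$ with
$\pi_1\langle[\top],\mathsf{true}\rangle$, which computes to $[\top]$. -/
theorem stabPow1_eta (hU : Derives T (isTm Γ U stabPow1)) :
    Derives T (eqTm Γ U (toStab (code (eq pow1 (fromStab U) (fromStab (toStab
      (code top)))))) stabPow1) := by
  have hV := fromStab_tm hU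
  have hT := top_ty (T := T) hU.tm_ctx
  have e := fromStab_toStab (stab_dc_code hT (stab_of_holds (top_holds hU.tm_ctx)))
  have eE := eq_form_eq .pow1 hV.of_isTm (.ty_refl hV.of_isTm) (.tm_refl hV) (.tm_symm e)
  exact .tm_trans (.tm_symm (toStab_fromStab hU)) (toStab_congr (fromStab_stab hU)
    (.tm_trans (.pow1_eta hV) (code_congr eE)))

theorem nn_lem (hP : Derives T (isTy Γ P .prop)) :
    Derives T (holds Γ (Expr.neg (Expr.neg (disj P (Expr.neg P))))) := by
  have hN := hP.neg .large
  have hF := hN.imp_inv.2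
  have hD := disj_form .large hP hN
  refine .imp_intro_sub (hD.neg .large) hF fun Δ σ s h => ?_
  refine Derives.mp h (.disj_right (s.sub_ty hP) (s.sub_ty hN) (.imp_intro_sub (s.sub_ty hP)
    (s.sub_ty hF) fun Θ τ r hp => ?_))
  exact (r.sub_tm h).mp (.disj_left (r.sub_ty (s.sub_ty hP)) (r.sub_ty (s.sub_ty hN)) hp)

/-- The translated elimination of $\vee$; this, with the one of $\exists$ below, is what forces all
translated propositions to be stable. -/
theorem nn_disj_elim (hC : Derives T (holds Γ (Expr.stab C))) (hP : Derives T (isTy Γ P .prop))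
    (hQ : Derives T (isTy Γ Q .prop)) (h : Derives T (holds Γ (Expr.neg (Expr.neg (disj P Q)))))
    (h1 : Derives T (holds (P :: Γ) (C.wk 1))) (h2 : Derives T (holds (Q :: Γ) (C.wk 1))) :
    Derives T (holds Γ C) :=
  have tC := hC.prop_of_holds.imp_inv.2
  h.nn_elim hC fun _ _ s h => or_elim h (s.sub_tm (.imp_intro hP tC h1))
    (s.sub_tm (.imp_intro hQ tC h2))

theorem nn_ex_elim (hC : Derives T (holds Γ (Expr.stab C))) (hA : Derives T (isTy Γ A .col))
    (hP : Derives T (isTy (A :: Γ) P .prop)) (h : Derives T (holds Γ (Expr.neg (Expr.neg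
      (ex A P)))))
    (h1 : Derives T (holds (P :: A :: Γ) (C.wk 2))) : Derives T (holds Γ C) :=
  have tC := hC.prop_of_holds.imp_inv.2
  h.nn_elim hC fun _ _ s h => .ex_elim (s.sub_ty hA) ((s.up hA).sub_ty hP) (s.sub_ty tC) h (by
    simpa using ((s.up hA).up hP).sub_tm h1)

/-- Guarantees that products of sets fall under the ordinary clause of `dn`. -/
theorem ne_pow1 (h : Derives T (isTy Γ A .set)) : A ≠ pow1 := fun e => nomatch h.inv.2 e

end Derives

/-! ### Validity of the translation -/

@[simp] theorem Ctx.dn_cons (A : Ty) (Γ : Ctx) : Ctx.dn (A :: Γ) = A.dn :: Γ.dn := rfl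

theorem Lookup.dn {i : ℕ} (h : Lookup Γ i A) : Lookup Γ.dn i A.dn := by
  induction h with
  | zero => rw [dn_wk]; exact .zero _ _
  | succ B _ ih => rw [dn_wk]; exact ih.succ _

/-- A substitution into the translated context must be checked on all its variables, whereas the
induction only speaks of variables of the original one. -/
theorem Lookup.exists_of_dn {i : ℕ} (h : Lookup Γ.dn i A) : ∃ C, Lookup Γ i C ∧ C.dn = A := by
  induction Γ generalizing i A with
  | nil => cases h
  | cons B Γ ih =>
    cases h with
    | zero => exact ⟨_, .zero _ _, dn_wk _ _⟩
    | succ _ h =>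
      obtain ⟨C, hC, rfl⟩ := ih h
      exact ⟨_, hC.succ _, dn_wk _ _⟩

namespace Expr

theorem dn_neg (P : Ty) : (neg P).dn = neg P.dn := rfl

theorem dn_iff (P Q : Ty) : (iff P Q).dn = iff P.dn Q.dn := rfl

theorem dn_dc (U : Tm) : (dc U).dn = eq pow1 (fromStab U.dn) (fromStab (toStab (code top))) := rfl

end Expr

/-- The translation of a judgement is derivable, and so are the stability of the propositions and
the stability of the equality of the types that it introduces. -/
def Judgement.Valid : Judgement → Prop
  | .ctx Γ => Derives .emTT (.ctx Γ.dn)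
  | .isTy Γ A k => Derives .emTT (.isTy Γ.dn A.dn k) ∧
      (k.Logical → Derives .emTT (holds Γ.dn (stab A.dn))) ∧ SEq .emTT Γ.dn A.dn
  | .eqTy Γ A B k => Derives .emTT (.eqTy Γ.dn A.dn B.dn k)
  | .isTm Γ a A => Derives .emTT (.isTm Γ.dn a.dn A.dn)
  | .eqTm Γ a b A => Derives .emTT (.eqTm Γ.dn a.dn b.dn A.dn)

theorem Sb.dn (hΔ : Derives T (.ctx Δ.dn))
    (h : ∀ i C, Lookup Γ i C → Derives T (.isTm Δ.dn (σ i).dn (C.dn.sub fun i => (σ i).dn))) :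
    Sb T Δ.dn (fun i => (σ i).dn) Γ.dn :=
  ⟨hΔ, fun i D hD => by obtain ⟨C, hC, rfl⟩ := hD.exists_of_dn; exact h i C hC⟩

theorem SbEq.dn (hσ : Sb T Δ.dn (fun i => (σ i).dn) Γ.dn) (hτ : Sb T Δ.dn (fun i => (τ i).dn) Γ.dn)
    (h : ∀ i C, Lookup Γ i C →
      Derives T (.eqTm Δ.dn (σ i).dn (τ i).dn (C.dn.sub fun i => (σ i).dn))) :
    SbEq T Δ.dn (fun i => (σ i).dn) (fun i => (τ i).dn) Γ.dn :=
  ⟨hσ, hτ, fun i D hD => by obtain ⟨C, hC, rfl⟩ := hD.exists_of_dn; exact h i C hC⟩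

/-- Most rules are translated into themselves. The exceptions concern disjunction, existence, `pow1`
and functions towards it, equality, and excluded middle. Formation rules must also supply the two
stability invariants. -/
theorem Derives.valid {J : Judgement} (h : Derives .emTTc J) : J.Valid := by
  induction h with (simp only [Judgement.Valid, Ctx.dn_cons, dn, dn_inst, dn_inst₂, dn_inst₃, dn_wk,
    dn_wk₁, dn_wk₂, dn_sub, dn_neg, dn_iff, dn_dc] at *)
  | ctx_nil => exact .ctx_nil
  | ctx_cons _ ih => exact .ctx_cons ih.1
  | var _ h ih => exact .var ih h.dn
  | incl hk _ ih =>
    refine ⟨.incl hk ih.1, fun h => ih.2.1 ?_, ih.2.2⟩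
    -- The inclusion of small propositions into propositions is the only one with a logical target.
    cases hk <;> cases h
    constructor
  | eq_incl hk _ ih => exact .eq_incl hk ih
  | ty_refl _ ih => exact .ty_refl ih.1
  | ty_symm _ ih => exact .ty_symm ih
  | ty_trans _ _ ih ih' => exact .ty_trans ih ih'
  | tm_refl _ ih => exact .tm_refl ih
  | tm_symm _ ih => exact .tm_symm ih
  | tm_trans _ _ ih ih' => exact .tm_trans ih ih'
  | conv _ _ ih ih' => exact .conv ih ih'
  | eq_conv _ _ ih ih' => exact .eq_conv ih ih'
  | sub_ty _ _ _ ihΔ ihσ ih =>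
    have s := Sb.dn ihΔ ihσ
    exact ⟨s.sub_ty ih.1, fun hk => s.sub_tm (ih.2.1 hk), ih.2.2.sub s⟩
  | sub_eqTy _ _ _ ihΔ ihσ ih => exact (Sb.dn ihΔ ihσ).sub_eqTy ih
  | sub_tm _ _ _ ihΔ ihσ ih => exact (Sb.dn ihΔ ihσ).sub_tm ih
  | sub_eqTm _ _ _ ihΔ ihσ ih => exact (Sb.dn ihΔ ihσ).sub_eqTm ih
  | repl_ty _ _ _ _ _ ihΔ ihσ ihτ ihe ih =>
    exact (SbEq.dn (.dn ihΔ ihσ) (.dn ihΔ ihτ) ihe).repl_ty ih.1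
  | repl_tm _ _ _ _ _ ihΔ ihσ ihτ ihe ih =>
    exact (SbEq.dn (.dn ihΔ ihσ) (.dn ihΔ ihτ) ihe).repl_tm ih
  | n0_form _ ih => exact ⟨.n0_form ih, nofun, .n0⟩
  | n0_elim _ _ ihM ihc => exact .n0_elim ihM.1 ihc
  | n0_elim_eq _ _ ihM ihc => exact .n0_elim_eq ihM ihc
  | n1_form _ ih => exact ⟨.n1_form ih, nofun, .n1⟩
  | n1_intro _ ih => exact .n1_intro ih
  | n1_elim _ _ _ ihM iht ihc => exact .n1_elim ihM.1 iht ihc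
  | n1_elim_eq _ _ _ ihM iht ihc => exact .n1_elim_eq ihM iht ihc
  | n1_comp _ _ ihM ihc => exact .n1_comp ihM.1 ihc
  | sigma_form hk _ _ ihA ihB =>
    exact ⟨.sigma_form hk ihA.1 ihB.1, fun h => (by cases hk <;> cases h),
      .sigma ihA.1.col ihB.1.col ihA.2.2 ihB.2.2⟩
  | sigma_form_eq hk _ _ _ _ ihA iheA ihB iheB => exact .sigma_form_eq hk ihA.1 iheA ihB.1 iheB
  | sigma_intro _ _ _ _ ihA ihB iha ihb => exact .sigma_intro ihA.1 ihB.1 iha ihb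
  | sigma_intro_eq _ _ _ _ _ _ ihA iheA ihB iheB iha ihb =>
    exact .sigma_intro_eq ihA.1 iheA ihB.1 iheB iha ihb
  | sigma_elim _ _ _ _ _ ihA ihB ihM ihd ihm => exact .sigma_elim ihA.1 ihB.1 ihM.1 ihd ihm
  | sigma_elim_eq _ _ _ _ _ _ _ _ ihA iheA ihB iheB ihM iheM ihd ihm =>
    exact .sigma_elim_eq ihA.1 iheA ihB.1 iheB ihM.1 iheM ihd ihm
  | sigma_comp _ _ _ _ _ _ ihA ihB ihM iha ihb ihm =>
    exact .sigma_comp ihA.1 ihB.1 ihM.1 iha ihb ihm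
  | pi_form hk _ hB ihA ihB =>
    cases hk with
    | set =>
      rw [dn_pi hB.ne_pow1]
      exact ⟨.pi_form (.set _) ihA.1 ihB.1, nofun, .pi (.set _) ihA.1 ihB.1 ihB.2.2⟩
    | pow1 => exact ⟨.stabPow_form ihA.1, nofun, .stabPow ihA.1⟩
  | pi_form_eq hk _ _ hB eB ihA iheA ihB iheB =>
    cases hk with
    | set =>
      rw [dn_pi hB.ne_pow1, dn_pi eB.presup.2.ne_pow1]
      exact .pi_form_eq (.set _) ihA.1 iheA ihB.1 iheB
    | pow1 =>
      -- A codomain equal to `pow1` is `pow1`, so both sides fall under the same clause of the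
      -- translation.
      rw [eB.inv.1 rfl]
      exact .stabPow_form_eq iheA
  | pi_intro hk _ hB _ ihA ihB ihb =>
    cases hk with
    | set =>
      rw [dn_pi hB.ne_pow1, dn_lam hB.ne_pow1]
      exact .pi_intro (.set _) ihA.1 ihB.1 ihb
    | pow1 => exact .toStabPow_tm ihA.1 (.lam_fromStab_tm ihA.1 ihb) (.stab_app_lam ihA.1 ihb)
  | pi_intro_eq hk _ _ hB eB _ ihA iheA ihB iheB ihb =>
    cases hk with
    | set =>
      rw [dn_pi hB.ne_pow1, dn_lam hB.ne_pow1, dn_lam eB.presup.2.ne_pow1]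
      exact .pi_intro_eq (.set _) ihA.1 iheA ihB.1 iheB ihb
    | pow1 =>
      rw [eB.inv.1 rfl]
      have hp := Derives.pow1_form (T := .emTT) ihA.1.ctx_ext
      have s := Sb.conv_last iheA.presup.2.col (.ty_symm iheA.eq_col)
      exact .toStabPow_congr iheA
        (.pi_intro_eq .pow1 ihA.1 iheA hp (.ty_refl hp) (.fromStab_congr ihb))
        (.stab_app_lam ihA.1 ihb.left) (.stab_app_lam iheA.presup.2 (s.isTm ihb.right))
  | pi_elim hk _ hB _ _ ihA ihB ihf iha =>
    cases hk with
    | set =>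
      rw [dn_app hB.ne_pow1]
      rw [dn_pi hB.ne_pow1] at ihf
      exact .pi_elim (.set _) ihA.1 ihB.1 ihf iha
    | pow1 => exact .toStab_tm (.app_stab ihA.1 ihf iha)
  | pi_elim_eq hk _ _ hB eB _ _ ihA iheA ihB iheB ihf iha =>
    cases hk with
    | set =>
      rw [dn_app hB.ne_pow1, dn_app eB.presup.2.ne_pow1]
      rw [dn_pi hB.ne_pow1] at ihf
      exact .pi_elim_eq (.set _) ihA.1 iheA ihB.1 iheB ihf iha
    | pow1 =>
      rw [eB.inv.1 rfl]
      exact .toStab_congr (.app_stab ihA.1 ihf.left iha.left)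
        (.app_congr_pow1 ihA.1 iheA (.fromStabPow_congr_ann iheA ihf) iha)
  | pi_beta hk _ hB _ _ ihA ihB ihb iha =>
    cases hk with
    | set =>
      rw [dn_app hB.ne_pow1, dn_lam hB.ne_pow1]
      exact .pi_beta (.set _) ihA.1 ihB.1 ihb iha
    | pow1 => exact .stabPow_beta ihA.1 ihb iha
  | @pi_eta Γ A B k f hk _ hB _ ihA ihB ihf =>
    cases hk with
    | set =>
      have h := hB.ne_pow1
      rw [dn_pi h] at ihf ⊢
      rw [dn_lam h, dn_app (B := B.wk₁ 1) (mt ren_eq_pow1.1 h), dn_wk, dn_wk₁, dn_wk]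
      exact .pi_eta (.set _) ihA.1 ihB.1 ihf
    | pow1 =>
      have := Derives.stabPow_eta ihA.1 ihf
      rw [← dn_wk, ← dn_wk] at this
      exact this
  | list_form _ ih => exact ⟨.list_form ih.1, nofun, .list ih.1 ih.2.2⟩
  | list_form_eq _ ih => exact .list_form_eq ih
  | list_nil _ ih => exact .list_nil ih.1
  | list_nil_eq _ ih => exact .list_nil_eq ih
  | list_cons _ _ _ ihA ihs iha => exact .list_cons ihA.1 ihs iha
  | list_cons_eq _ _ _ ihA ihs iha => exact .list_cons_eq ihA ihs iha
  | list_elim _ _ _ _ _ ihA ihM ihs ihb ihl => exact .list_elim ihA.1 ihM.1 ihs ihb ihl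
  | list_elim_eq _ _ _ _ _ _ _ ihA iheA ihM iheM ihs ihb ihl =>
    exact .list_elim_eq ihA.1 iheA ihM.1 iheM ihs ihb ihl
  | list_comp_nil _ _ _ _ ihA ihM ihb ihl => exact .list_comp_nil ihA.1 ihM.1 ihb ihl
  | list_comp_cons _ _ _ _ _ _ ihA ihM ihs iha ihb ihl =>
    exact .list_comp_cons ihA.1 ihM.1 ihs iha ihb ihl
  | sum_form _ _ ihA ihB => exact ⟨.sum_form ihA.1 ihB.1, nofun, .sum ihA.1 ihB.1 ihA.2.2 ihB.2.2⟩
  | sum_form_eq _ _ ihA ihB => exact .sum_form_eq ihA ihB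
  | sum_inl _ _ _ ihA ihB iha => exact .sum_inl ihA.1 ihB.1 iha
  | sum_inl_eq _ _ _ ihA ihB iha => exact .sum_inl_eq ihA ihB iha
  | sum_inr _ _ _ ihA ihB ihb => exact .sum_inr ihA.1 ihB.1 ihb
  | sum_inr_eq _ _ _ ihA ihB ihb => exact .sum_inr_eq ihA ihB ihb
  | sum_elim _ _ _ _ _ _ ihA ihB ihM ihd ihl ihr => exact .sum_elim ihA.1 ihB.1 ihM.1 ihd ihl ihr
  | sum_elim_eq _ _ _ _ _ _ _ _ _ ihA iheA ihB iheB ihM iheM ihd ihl ihr =>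
    exact .sum_elim_eq ihA.1 iheA ihB.1 iheB ihM.1 iheM ihd ihl ihr
  | sum_comp_inl _ _ _ _ _ _ ihA ihB ihM iha ihl ihr =>
    exact .sum_comp_inl ihA.1 ihB.1 ihM.1 iha ihl ihr
  | sum_comp_inr _ _ _ _ _ _ ihA ihB ihM ihb ihl ihr =>
    exact .sum_comp_inr ihA.1 ihB.1 ihM.1 ihb ihl ihr
  | quot_form _ _ _ _ _ ihA ihR ih1 ih2 ih3 =>
    have hQ := Derives.quot_form ihA.1 ihR.1 ih1 ih2 ih3
    -- Here the stability of a translated proposition feeds the stability of an equality, which is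
    -- why both are carried by the same induction.
    exact ⟨hQ, nofun, .quot hQ (ihR.2.1 .small)⟩
  | quot_form_eq _ _ _ _ ihA ihR ihQ ihQ' => exact .quot_form_eq ihA ihR ihQ.1 ihQ'.1
  | quot_intro _ _ ihQ iha => exact .quot_intro ihQ.1 iha
  | quot_intro_eq _ _ _ _ _ ihA ihR ihQ ihQ' iha => exact .quot_intro_eq ihA ihR ihQ.1 ihQ'.1 iha
  | quot_eq _ _ _ _ ihQ iha ihb ih => exact .quot_eq ihQ.1 iha ihb ih
  | quot_eff _ _ _ _ ihQ iha ihb ih => exact .quot_eff ihQ.1 iha ihb ih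
  | quot_elim _ _ _ _ _ ihQ ihM ihp ihl ihc => exact .quot_elim ihQ.1 ihM.1 ihp ihl ihc
  | quot_elim_eq _ _ _ _ _ _ _ _ _ ihA ihR ihQ ihQ' ihM iheM ihp ihl ihc =>
    exact .quot_elim_eq ihA ihR ihQ.1 ihQ'.1 ihM.1 iheM ihp ihl ihc
  | quot_comp _ _ _ _ _ ihQ ihM iha ihl ihc => exact .quot_comp ihQ.1 ihM.1 iha ihl ihc
  | pow1_form _ ih => exact ⟨.stabPow1_form ih, nofun, .stabPow1⟩
  | pow1_intro _ ih => exact .toStab_tm (.stab_dc_code ih.1 (ih.2.1 .small))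
  | pow1_eq _ _ _ ihP ihQ ih =>
    exact .toStab_congr (.stab_dc_code ihP.1 (ihP.2.1 .small)) (.pow1_eq ihP.1 ihQ.1 ih)
  | pow1_eff _ _ _ ihP ihQ ih =>
    -- The given equality is between elements of `stabPow1`; its first projections compute to the
    -- two codes, to which effectiveness applies.
    have e1 := Derives.fromStab_toStab (.stab_dc_code ihP.1 (ihP.2.1 .small))
    have e2 := Derives.fromStab_toStab (.stab_dc_code ihQ.1 (ihQ.2.1 .small))
    exact .pow1_eff ihP.1 ihQ.1 (.tm_trans (.tm_symm e1) (.tm_trans (.fromStab_congr ih) e2))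
  | pow1_eta _ ih => exact .stabPow1_eta ih
  | falsum_form _ ih =>
    have h := Derives.falsum_form ih
    exact ⟨h, fun _ => .stab_falsum ih, .prop (h.prop .small)⟩
  | conj_form hk _ _ ihP ihQ =>
    have h := Derives.conj_form hk ihP.1 ihQ.1
    exact ⟨h, fun _ => .stab_conj (ihP.2.1 hk) (ihQ.2.1 hk), .prop (h.prop hk)⟩
  | conj_form_eq hk _ _ ihP ihQ => exact .conj_form_eq hk ihP ihQ
  | disj_form hk _ _ ihP ihQ =>
    have h := Derives.disj_form hk ihP.1 ihQ.1
    have h' := (h.neg hk).neg hk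
    exact ⟨h', fun _ => .stab_neg ((h.neg hk).prop hk), .prop (h'.prop hk)⟩
  | disj_form_eq hk _ _ ihP ihQ =>
    exact .neg_form_eq (.neg_form_eq (.disj_form_eq hk ihP ihQ) hk) hk
  | imp_form hk _ _ ihP ihQ =>
    have h := Derives.imp_form hk ihP.1 ihQ.1
    exact ⟨h, fun _ => .stab_imp (ihP.1.prop hk) (ihQ.2.1 hk), .prop (h.prop hk)⟩
  | imp_form_eq hk _ _ ihP ihQ => exact .imp_form_eq hk ihP ihQ
  | all_form hk _ _ ihA ihP =>
    have h := Derives.all_form hk ihA.1 ihP.1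
    exact ⟨h, fun hk => .stab_all ihA.1.col (ihP.2.1 hk), .prop (h.prop hk.logical)⟩
  | all_form_eq hk _ _ _ ihA iheA ihP => exact .all_form_eq hk ihA.1 iheA ihP
  | ex_form hk _ _ ihA ihP =>
    have hl := hk.logical
    have h := Derives.ex_form hk ihA.1 ihP.1
    have h' := (h.neg hl).neg hl
    exact ⟨h', fun _ => .stab_neg ((h.neg hl).prop hl), .prop (h'.prop hl)⟩
  | ex_form_eq hk _ _ _ ihA iheA ihP =>
    exact .neg_form_eq (.neg_form_eq (.ex_form_eq hk ihA.1 iheA ihP) hk.logical) hk.logical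
  | @eq_form Γ A a b k k' hk hA _ _ ihA iha ihb =>
    by_cases h : A = pow1
    · subst h
      have e := Derives.eq_form (T := .emTT) .pow1 (.pow1_form iha.tm_ctx) (.fromStab_tm iha)
        (.fromStab_tm ihb)
      have st := Derives.stab_eq_pow1 (.fromStab_stab iha) (.fromStab_stab ihb)
      refine ⟨?_, fun _ => st, .prop (e.prop .small)⟩
      cases hk with
      | set => exact absurd rfl hA.ne_pow1
      | col => exact e.prop .small
      | pow1 => exact e
    · rw [dn_eq h]
      cases hk with
      | set =>
        have e := Derives.eq_form (.set _) ihA.1 iha ihb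
        exact ⟨e, fun _ => ihA.2.2.stab_eq iha ihb, .prop (e.prop .small)⟩
      | col =>
        have e := Derives.eq_form (.col _) ihA.1 iha ihb
        exact ⟨e, fun _ => ihA.2.2.stab_eq iha ihb, .prop e⟩
      | pow1 => exact absurd rfl h
  | @eq_form_eq Γ A A' a a' b b' k k' hk hA eA _ _ ihA iheA iha ihb =>
    by_cases h : A = pow1
    · subst h
      rw [eA.inv.1 rfl]
      have hp := Derives.pow1_form (T := .emTT) iha.left.tm_ctx
      have e := Derives.eq_form_eq .pow1 hp (.ty_refl hp) (.fromStab_congr iha)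
        (.fromStab_congr ihb)
      cases hk with
      | set => exact absurd rfl hA.ne_pow1
      | col => exact .eq_incl .props_prop e
      | pow1 => exact e
    · rw [dn_eq h, dn_eq (mt eA.inv.2 h)]
      cases hk with
      | set => exact .eq_form_eq (.set _) ihA.1 iheA iha ihb
      | col => exact .eq_form_eq (.col _) ihA.1 iheA iha ihb
      | pow1 => exact absurd rfl h
  | prop_mono _ _ _ ihP ihp ihq => exact .prop_mono ihP.1 ihp ihq
  | prop_true _ _ ihP ihp => exact .prop_true ihP.1 ihp
  | falsum_elim _ _ ihP ih => exact .falsum_elim ihP.1 ih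
  | conj_intro _ _ _ _ ihP ihQ ih ih' => exact .conj_intro ihP.1 ihQ.1 ih ih'
  | conj_left _ _ _ ihP ihQ ih => exact .conj_left ihP.1 ihQ.1 ih
  | conj_right _ _ _ ihP ihQ ih => exact .conj_right ihP.1 ihQ.1 ih
  | disj_left _ _ _ ihP ihQ ih => exact .nn_intro (.disj_left ihP.1 ihQ.1 ih)
  | disj_right _ _ _ ihP ihQ ih => exact .nn_intro (.disj_right ihP.1 ihQ.1 ih)
  | disj_elim _ _ _ _ _ _ ihP ihQ ihC ih ih1 ih2 =>
    exact .nn_disj_elim (ihC.2.1 .large) ihP.1 ihQ.1 ih ih1 ih2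
  | imp_intro _ _ _ ihP ihQ ih => exact .imp_intro ihP.1 ihQ.1 ih
  | imp_elim _ _ _ _ ihP ihQ ih ih' => exact .imp_elim ihP.1 ihQ.1 ih ih'
  | all_intro _ _ _ ihA ihP ih => exact .all_intro ihA.1 ihP.1 ih
  | all_elim _ _ _ _ ihA ihP ih iha => exact .all_elim ihA.1 ihP.1 ih iha
  | ex_intro _ _ _ _ ihA ihP iha ih => exact .nn_intro (.ex_intro ihA.1 ihP.1 iha ih)
  | ex_elim _ _ _ _ _ ihA ihP ihC ih ih1 => exact .nn_ex_elim (ihC.2.1 .large) ihA.1 ihP.1 ih ih1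
  | @eq_intro Γ A a _ _ ihA iha =>
    by_cases h : A = pow1
    · subst h
      exact .holds_eq (.tm_refl (.fromStab_tm iha))
    · rw [dn_eq h]
      exact .eq_intro ihA.1 iha
  | @eq_elim Γ A a b _ _ _ _ ihA iha ihb ih =>
    by_cases h : A = pow1
    · subst h
      -- Reflection only gives equality of first projections, which suffices in a subcollection.
      exact .stabPow1_ext iha ihb (.eq_of_holds ih)
    · rw [dn_eq h] at ih
      exact .eq_elim ihA.1 iha ihb ih
  | lem _ _ ihP => exact .nn_lem ihP.1

end
end EmTT

/-! ### The theorem -/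

open EmTT EmTT.Judgement EmTT.Expr in
theorem mainTheorem3 :
    (∀ Γ : Ctx, Derives .emTTc (ctx Γ) → Derives .emTT (ctx Γ.dn)) ∧
    (∀ (Γ : Ctx) (A : Ty) (k : Kind),
      Derives .emTTc (isTy Γ A k) → Derives .emTT (isTy Γ.dn A.dn k)) ∧
    (∀ (Γ : Ctx) (a : Tm) (A : Ty),
      Derives .emTTc (isTm Γ a A) → Derives .emTT (isTm Γ.dn a.dn A.dn)) ∧
    (∀ (Γ : Ctx) (A B : Ty) (k : Kind),
      Derives .emTTc (eqTy Γ A B k) → Derives .emTT (eqTy Γ.dn A.dn B.dn k)) ∧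
    (∀ (Γ : Ctx) (a b : Tm) (A : Ty),
      Derives .emTTc (eqTm Γ a b A) → Derives .emTT (eqTm Γ.dn a.dn b.dn A.dn)) ∧
    (∀ (Γ : Ctx) (P : Ty),
      Derives .emTTc (isTy Γ P .prop) →
        Derives .emTT (holds Γ.dn (imp (neg (neg P.dn)) P.dn))) ∧
    (∀ (Γ : Ctx) (A : Ty),
      Derives .emTTc (isTy Γ A .col) →
        Derives .emTT (holds (A.dn.wk 1 :: A.dn :: Γ.dn)
          (imp (neg (neg (eq (A.dn.wk 2) (var 1) (var 0)))) (eq (A.dn.wk 2) (var 1) (var 0))))) ∧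
    (∀ (Γ : Ctx) (a b : Tm),
      Derives .emTTc (isTm Γ a pow1) → Derives .emTTc (isTm Γ b pow1) →
        Derives .emTT (holds Γ.dn (iff (eq pow1 a b).dn (eq pow1.dn a.dn b.dn)))) := by
  refine ⟨fun Γ h => h.valid, fun Γ A k h => h.valid.1, fun Γ a A h => h.valid,
    fun Γ A B k h => h.valid, fun Γ a b A h => h.valid, fun Γ P h => h.valid.2.1 .large,
    fun Γ A h => ?_, fun Γ a b ha hb => ?_⟩
  · obtain ⟨hA, -, sA⟩ := h.valid
    have hA1 := Derives.wk_ty hA hA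
    -- Since `SEq` ranges over all substitutions, the claim is its instance at the weakening by the
    -- two variables $x$ and $y$.
    have s := sA.sub (Sb.shift_two hA1)
    rw [← wk_eq] at s
    exact s.stab_eq (Derives.var_one hA1) (by simpa using Derives.var_zero hA1.ctx_ext)
  · have ha : Derives .emTT (isTm Γ.dn a.dn stabPow1) := ha.valid
    have hb : Derives .emTT (isTm Γ.dn b.dn stabPow1) := hb.valid
    have hE := Derives.eq_form (.col _) (.pow1_form ha.tm_ctx) (.fromStab_tm ha) (.fromStab_tm hb)
    have hE' := Derives.eq_form (.col _) ha.of_isTm ha hb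
    -- One direction is extensionality of the subcollection of stable elements, the other congruence
    -- of the first projection.
    refine .and (.imp_intro_sub hE hE' fun Δ σ s h => .holds_eq ?_)
      (.imp_intro_sub hE' hE fun Δ σ s h => .holds_eq ?_)
    · have e := h.eq_of_holds
      rw [fromStab_sub, fromStab_sub] at e
      exact .stabPow1_ext (s.sub_tm ha) (s.sub_tm hb) e
    · rw [fromStab_sub, fromStab_sub]
      exact .fromStab_congr h.eq_of_holds
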